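/- Let $n\ge 1$, let $J=\begin{pmatrix}0&I_n\\-I_n&0\end{pmatrix}$, and let $\mathbb{H}^n=\mathbb{R}^{2n}\times\mathbb{R}$ be the Heisenberg group with group law $(x,t)\cdot(y,s)=(x+y,\,t+s+x^{t}Jy)$ and Lebesgue (Haar) measure. Let $A$ be a real symmetric $2n\times 2n$ matrix, let $\varphi(y)=y^{t}Ay$, and let $\eta:\mathbb{R}^{2n}\to[0,1]$ be a $C^\infty$ function with $\eta(y)=1$ for $|y|\le 1$ and $\eta(y)=0$ for $|y|\ge 2$. Let $\nu_0$ be the Borel measure on $\mathbb{H}^n$ given by $\nu_0(E)=\int_{\mathbb{R}^{2n}}\chi_E(y,\varphi(y))\,\eta(y)\,dy$, and let $(T_{\nu_0}f)(x,t)=\int_{\mathbb{H}^n} f\big((x,t)\cdot(y,s)^{-1}\big)\,d\nu_0(y,s)$. If $\det(2A+J)\ne 0$ and $\det(2A-J)\neq 0$, then the type set $$E_{\nu_0}=\Big\{\big(\tfrac1p,\tfrac1q\big)\in[0,1]\times[0,1] : T_{\nu_0}\text{ is bounded from }L^p(\mathbb{H}^n)\text{ to }L^q(\mathbb{H}^n)\Big\}$$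 (with $1/\infty=0$) is exactly the closed triangle with vertices $(0,0)$, $(1,1)$ and $\left(\frac{2n+1}{2n+2},\frac{1}{2n+2}\right)$. -/

import Mathlib

open MeasureTheory Matrix
open scoped ENNReal NNReal ContDiff

noncomputable section

/-- The underlying space `ℝ²ⁿ` with its Euclidean norm and Lebesgue measure. Coordinates are
indexed by `Fin n ⊕ Fin n`, that is, two consecutive blocks of length `n`. -/
abbrev R2n (n : ℕ) : Type := EuclideanSpace ℝ (Fin n ⊕ Fin n)

/-- The skew-symmetric block matrix `J = (0, Iₙ; -Iₙ, 0)`. (Mathlib's `Matrix.J` is its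
negative.) -/
def symplJ (n : ℕ) : Matrix (Fin n ⊕ Fin n) (Fin n ⊕ Fin n) ℝ :=
  Matrix.fromBlocks 0 1 (-1) 0

/-- The standard symplectic form `⟨x, y⟩ = xᵗ J y` on `ℝ²ⁿ`. -/
def symplForm {n : ℕ} (x y : R2n n) : ℝ := x.ofLp ⬝ᵥ (symplJ n *ᵥ y.ofLp)

/-- The quadratic function `φ(y) = yᵗ A y`. -/
def quadPhi {n : ℕ} (A : Matrix (Fin n ⊕ Fin n) (Fin n ⊕ Fin n) ℝ) (y : R2n n) : ℝ :=
  y.ofLp ⬝ᵥ (A *ᵥ y.ofLp)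

/-- The underlying set `ℝ²ⁿ × ℝ` of the Heisenberg group `ℍⁿ`, with the product topology, the Borel
sets of that topology, and Lebesgue measure `volume` (which is a Haar measure of the group). -/
abbrev Heis (n : ℕ) : Type := R2n n × ℝ

theorem symplForm_add_left {n : ℕ} (x y z : R2n n) :
    symplForm (x + y) z = symplForm x z + symplForm y z := by
  simp [symplForm, add_dotProduct]

theorem symplForm_add_right {n : ℕ} (x y z : R2n n) :
    symplForm x (y + z) = symplForm x y + symplForm x z := by
  simp [symplForm, mulVec_add, dotProduct_add]

theorem symplForm_neg_left {n : ℕ} (x y : R2n n) :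
    symplForm (-x) y = -symplForm x y := by
  simp [symplForm]

theorem symplForm_self {n : ℕ} (x : R2n n) : symplForm x x = 0 := by
  simp [symplForm, symplJ, dotProduct, mulVec, Fintype.sum_sum_type, Matrix.one_apply, mul_comm]

theorem symplForm_zero_left {n : ℕ} (x : R2n n) : symplForm 0 x = 0 := by
  simp [symplForm]

theorem symplForm_zero_right {n : ℕ} (x : R2n n) : symplForm x 0 = 0 := by
  simp [symplForm]

/-- The Heisenberg group law `(x, t) · (y, s) = (x + y, t + s + ⟨x, y⟩)`, with neutral element
`(0, 0)` and inverse `(x, t)⁻¹ = (-x, -t)`. -/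
instance heisGroup (n : ℕ) : Group (Heis n) where
  mul a b := (a.1 + b.1, a.2 + b.2 + symplForm a.1 b.1)
  one := (0, 0)
  inv a := (-a.1, -a.2)
  mul_assoc a b c := by
    refine Prod.ext (add_assoc a.1 b.1 c.1) ?_
    change a.2 + b.2 + symplForm a.1 b.1 + c.2 + symplForm (a.1 + b.1) c.1
      = a.2 + (b.2 + c.2 + symplForm b.1 c.1) + symplForm a.1 (b.1 + c.1)
    rw [symplForm_add_left, symplForm_add_right]
    ring
  one_mul a := by
    refine Prod.ext (zero_add a.1) ?_
    change 0 + a.2 + symplForm 0 a.1 = a.2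
    rw [symplForm_zero_left]
    ring
  mul_one a := by
    refine Prod.ext (add_zero a.1) ?_
    change a.2 + 0 + symplForm a.1 0 = a.2
    rw [symplForm_zero_right]
    ring
  inv_mul_cancel a := by
    refine Prod.ext (neg_add_cancel a.1) ?_
    change -a.2 + a.2 + symplForm (-a.1) a.1 = 0
    rw [symplForm_neg_left, symplForm_self]
    ring

theorem Heis.mul_def {n : ℕ} (a b : Heis n) :
    a * b = (a.1 + b.1, a.2 + b.2 + symplForm a.1 b.1) := rfl

theorem Heis.inv_def {n : ℕ} (a : Heis n) : a⁻¹ = (-a.1, -a.2) := rfl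

/-- Right convolution by a measure: `(f ∗ μ)(x) = ∫ f(x · y⁻¹) dμ(y)`. -/
def heisConv {n : ℕ} (f : Heis n → ℂ) (μ : Measure (Heis n)) (x : Heis n) : ℂ :=
  ∫ y, f (x * y⁻¹) ∂μ

/-- `f ↦ f ∗ μ` is bounded from `Lᵖ(ℍⁿ)` to `L^q(ℍⁿ)`, i.e. `‖T_μ‖_{p,q} < ∞`: for every Borel
function `f` in `Lᵖ`, the integral defining `f ∗ μ` exists almost everywhere, `f ∗ μ` is in
`L^q`, and `‖f ∗ μ‖_q ≤ C ‖f‖_p` with `C` finite and independent of `f`. -/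
def ConvBounded {n : ℕ} (μ : Measure (Heis n)) (p q : ℝ≥0∞) : Prop :=
  ∃ C : ℝ≥0, ∀ f : Heis n → ℂ, Measurable f → MemLp f p volume →
    (∀ᵐ x : Heis n, Integrable (fun y => f (x * y⁻¹)) μ) ∧
    MemLp (heisConv f μ) q volume ∧
    eLpNorm (heisConv f μ) q volume ≤ C * eLpNorm f p volume

/-- The type set of `μ`: all `(1/p, 1/q)` in `[0,1] × [0,1]`, where `1 ≤ p, q ≤ ∞` and
`1/∞ = 0`, such that `f ↦ f ∗ μ` is bounded from `Lᵖ` to `L^q`. -/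
def typeSet {n : ℕ} (μ : Measure (Heis n)) : Set (ℝ × ℝ) :=
  {z | ∃ p q : ℝ≥0∞, 1 ≤ p ∧ 1 ≤ q ∧ z = (p⁻¹.toReal, q⁻¹.toReal) ∧ ConvBounded μ p q}

/-- A cut-off function: smooth, with values in `[0,1]`, equal to `1` for `|y| ≤ 1` and to `0`
for `|y| ≥ 2`. -/
structure IsCutoff {n : ℕ} (η : R2n n → ℝ) : Prop where
  smooth : ContDiff ℝ ∞ η
  mem_Icc : ∀ y, η y ∈ Set.Icc (0 : ℝ) 1
  eq_one : ∀ y, ‖y‖ ≤ 1 → η y = 1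
  eq_zero : ∀ y, 2 ≤ ‖y‖ → η y = 0

/-- The measure `ν₀(E) = ∫ χ_E(y, φ(y)) η(y) dy` on `ℍⁿ`, where `φ(y) = yᵗ A y`: the image of
`η(y) dy` under `y ↦ (y, φ(y))`. -/
def nuZero {n : ℕ} (A : Matrix (Fin n ⊕ Fin n) (Fin n ⊕ Fin n) ℝ) (η : R2n n → ℝ) :
    Measure (Heis n) :=
  ((volume : Measure (R2n n)).withDensity (fun y => ENNReal.ofReal (η y))).map
    (fun y => ((y, quadPhi A y) : Heis n))

theorem measurable_graph {n : ℕ} (A : Matrix (Fin n ⊕ Fin n) (Fin n ⊕ Fin n) ℝ) :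
    Measurable (fun y : R2n n => ((y, quadPhi A y) : Heis n)) := by
  refine Continuous.measurable (continuous_id.prodMk ?_)
  change Continuous fun y : R2n n => ∑ i, y.ofLp i * ∑ j, A i j * y.ofLp j
  fun_prop

theorem nuZero_apply {n : ℕ} (A : Matrix (Fin n ⊕ Fin n) (Fin n ⊕ Fin n) ℝ) (η : R2n n → ℝ)
    (E : Set (Heis n)) (hE : MeasurableSet E) :
    nuZero A η E = ∫⁻ y, ((fun y : R2n n => ((y, quadPhi A y) : Heis n)) ⁻¹' E).indicator
      (fun y => ENNReal.ofReal (η y)) y := by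
  have h := measurable_graph A
  rw [nuZero, Measure.map_apply h hE, withDensity_apply _ (h hE), lintegral_indicator (h hE)]

end

/-! Sufficiency rests on the single endpoint estimate from L^p to L^q with q = 2n + 2 and p = q' =
(2n + 2)/(2n + 1), that is, on the third vertex. Writing y = x - w, the operator integrates f(w, t -
Φ(x, w)) against η(x - w) dw, where by symmetry of A the phase is Φ(x, w) = φ(x) + φ(w) + ⟨w, Lx⟩
with L = -(2A + J)ᵗ (`heisPhase_eq`). Pair with g and apply Parseval in the central variable. At
frequency ξ there remains a bilinear form with kernel η(x - w) exp(-2πiξΦ(x, w)). The terms φ(x),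
φ(w) only modulate the two functions, and η(x - w), being the inverse Fourier transform of an
integrable function, is a superposition of modulations (`exists_enorm_oscillatory_form_le`). What is
left is a Fourier transform evaluated at ξLx.

Since L is invertible, Hölder and Hausdorff–Young (`exists_lintegral_fourier_rpow_le`) bound the
form by a constant times |ξ|^(-2n/q) and the L^p norms of the partial transforms at ξ. For q = 2n +
2 one has 2n/q = 1 - 2/q, which is exactly the weight for which ∫ |ξ|^(-(1 - 2/q)) |ĥ(ξ)|² dξ is
controlled by the squared L^p norm of h. This is Hardy–Littlewood–Sobolev on the line, read on the
Fourier side (`exists_lintegral_weight_mul_fourier_sq_le`). Cauchy–Schwarz in ξ and Minkowski (p <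
2) sum the frequencies (`exists_lintegral_form_le`), and duality gives
`exists_lintegral_lconv_rpow_le`.

The rest of the triangle follows by interpolating with the bounds on L¹ and L^∞. As the operator is
positive, two applications of Hölder's inequality suffice (`lintegral_lconv_rpow_le_of_weights`).

Necessity: each side of the triangle is forced by testing on one family of indicator functions: tall
slabs (`ConvBounded.inv_le_inv`), a δ-box mapped to a δ-neighbourhood of a graph
(`ConvBounded.inv_sub_le_inv`), and a δ-neighbourhood of a graph mapped to a δ-box
(`ConvBounded.inv_le_mul_inv`). -/

noncomputable section

/-! ### Duality for L^q norms and Minkowski's integral inequality. -/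

/-- Truncation of `G` in height and to an exhausting sequence of sets. -/
def truncation {α : Type*} (S : ℕ → Set α) (G : α → ℝ≥0∞) (k : ℕ) : α → ℝ≥0∞ :=
  (S k).indicator fun x => min (G x) k

section truncation

variable {α : Type*} {S : ℕ → Set α} {G : α → ℝ≥0∞}

theorem measurable_truncation [MeasurableSpace α] (hG : Measurable G)
    (hS : ∀ k, MeasurableSet (S k)) (k : ℕ) : Measurable (truncation S G k) :=
  (hG.min measurable_const).indicator (hS k)

theorem truncation_le (k : ℕ) (x : α) : truncation S G k x ≤ G x :=
  Set.indicator_le' (fun _ _ => min_le_left _ _) (fun _ _ => zero_le) x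

theorem truncation_le_natCast (k : ℕ) (x : α) : truncation S G k x ≤ (k : ℝ≥0∞) :=
  Set.indicator_le' (fun _ _ => min_le_right _ _) (fun _ _ => zero_le) x

theorem truncation_of_notMem {k : ℕ} {x : α} (hx : x ∉ S k) : truncation S G k x = 0 :=
  Set.indicator_of_notMem hx _

theorem truncation_mono (hS : Monotone S) : Monotone (truncation S G) := by
  intro i j hij x
  refine Set.indicator_le_indicator_of_subset (hS hij) (fun _ => zero_le) x |>.trans ?_
  refine Set.indicator_le_indicator ?_
  exact min_le_min le_rfl (by exact_mod_cast hij)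

theorem iSup_truncation (hS : Monotone S) (hU : ⋃ k, S k = Set.univ) (x : α) :
    ⨆ k, truncation S G k x = G x := by
  refine le_antisymm (iSup_le fun k => truncation_le k x) ?_
  obtain ⟨k0, hk0⟩ := Set.mem_iUnion.1 (hU ▸ Set.mem_univ x)
  refine le_of_forall_lt fun c hc => ?_
  obtain ⟨m, hm⟩ := ENNReal.exists_nat_gt hc.ne_top
  refine lt_of_lt_of_le ?_ (le_iSup _ (max k0 m))
  have : x ∈ S (max k0 m) := hS (le_max_left _ _) hk0
  simp only [truncation, Set.indicator_of_mem this]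
  refine lt_min hc (hm.trans_le ?_)
  exact_mod_cast le_max_right _ _

end truncation

/-- Converse of Hölder's inequality. Truncating G makes the integral of its q-th power finite, so
that one may divide by a power of it; monotone convergence then removes the truncation. It is
therefore enough to test on bounded g vanishing off some `S k`. -/
theorem lintegral_rpow_le_of_forall_lintegral_mul_le {α : Type*} [MeasurableSpace α]
    {μ : Measure α} {p q : ℝ} (hpq : p.HolderConjugate q) {G : α → ℝ≥0∞} (hG : Measurable G)
    (S : ℕ → Set α) (hSm : ∀ k, MeasurableSet (S k)) (hmono : Monotone S)
    (hU : ⋃ k, S k = Set.univ) (hfin : ∀ k, μ (S k) < ⊤) (A : ℝ≥0∞)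
    (h : ∀ g : α → ℝ≥0∞, Measurable g → ∀ (K : ℝ≥0) (k : ℕ), (∀ x, g x ≤ K) →
      (∀ x ∉ S k, g x = 0) → ∫⁻ x, G x * g x ∂μ ≤ A * (∫⁻ x, g x ^ p ∂μ) ^ (1 / p)) :
    ∫⁻ x, G x ^ q ∂μ ≤ A ^ q := by
  have hp0 := hpq.pos
  have hq0 := hpq.symm.pos
  have hp1 := hpq.lt
  have hq1 := hpq.symm.lt
  let Gk := truncation S G
  have hGkm : ∀ k, Measurable (Gk k) := measurable_truncation hG hSm
  have hGkle : ∀ k x, Gk k x ≤ G x := truncation_le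
  have hGkk : ∀ k x, Gk k x ≤ (k : ℝ≥0∞) := truncation_le_natCast
  have hGk0 : ∀ k, ∀ x ∉ S k, Gk k x = 0 := fun k x hx => truncation_of_notMem hx
  have hGkmono : Monotone Gk := truncation_mono hmono
  have hsup : ∀ x, ⨆ k, Gk k x = G x := iSup_truncation hmono hU
  have hbound : ∀ k, ∫⁻ x, Gk k x ^ q ∂μ ≤ A ^ q := by
    intro k
    set I := ∫⁻ x, Gk k x ^ q ∂μ with hI
    have hIfin : I ≠ ⊤ := by
      have : I ≤ ∫⁻ x, (S k).indicator (fun _ => (k : ℝ≥0∞) ^ q) x ∂μ := by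
        refine lintegral_mono fun x => ?_
        by_cases hx : x ∈ S k
        · simp only [Set.indicator_of_mem hx]
          exact ENNReal.rpow_le_rpow (hGkk k x) hq0.le
        · simp [hGk0 k x hx, hq0]
      refine ne_top_of_le_ne_top ?_ this
      rw [lintegral_indicator_const (hSm k)]
      exact ENNReal.mul_ne_top (ENNReal.rpow_ne_top_of_nonneg hq0.le (by simp)) (hfin k).ne
    by_cases hI0 : I = 0
    · rw [hI0]; exact zero_le
    -- The extremal test function is the (q - 1)-st power of the truncation, because (q - 1)p = q.
    have h1 : I ≤ A * I ^ (1 / p) := by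
      calc I ≤ ∫⁻ x, G x * Gk k x ^ (q - 1) ∂μ := by
            refine lintegral_mono fun x => ?_
            calc Gk k x ^ q = Gk k x ^ (1 + (q - 1)) := by ring_nf
              _ = Gk k x * Gk k x ^ (q - 1) := by
                rw [ENNReal.rpow_add_of_nonneg _ _ (by norm_num) (by linarith), ENNReal.rpow_one]
              _ ≤ _ := by gcongr; exact hGkle k x
        _ ≤ A * (∫⁻ x, (Gk k x ^ (q - 1)) ^ p ∂μ) ^ (1 / p) := by
            refine h _ ((hGkm k).pow_const _) ((k : ℝ≥0) ^ (q - 1)) k (fun x => ?_) ?_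
            · rw [ENNReal.coe_rpow_of_nonneg _ (by linarith)]
              exact ENNReal.rpow_le_rpow (by simpa using hGkk k x) (by linarith)
            · intro x hx
              rw [hGk0 k x hx, ENNReal.zero_rpow_of_pos (by linarith)]
        _ = _ := by
            congr 3
            ext x
            rw [← ENNReal.rpow_mul]
            congr 1
            rw [mul_comm, mul_sub, mul_one]
            have := hpq.mul_eq_add
            linarith
    have h2 : I ^ (1 / q) ≤ A := by
      have h3 : I ^ (1 / q) * I ^ (1 / p) ≤ A * I ^ (1 / p) := by
        rw [← ENNReal.rpow_add _ _ hI0 hIfin]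
        have : 1 / q + 1 / p = 1 := by
          have := hpq.inv_add_inv_eq_one
          simp only [one_div]; linarith
        rwa [this, ENNReal.rpow_one]
      refine (ENNReal.mul_le_mul_iff_left ?_ ?_).1 h3
      · simp only [ne_eq, ENNReal.rpow_eq_zero_iff]; push Not
        exact ⟨fun h => absurd h hI0, fun h => absurd h hIfin⟩
      · exact ENNReal.rpow_ne_top_of_nonneg (by positivity) hIfin
    calc I = (I ^ (1 / q)) ^ q := by
          rw [← ENNReal.rpow_mul, one_div, inv_mul_cancel₀ hq0.ne', ENNReal.rpow_one]
      _ ≤ A ^ q := ENNReal.rpow_le_rpow h2 hq0.le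
  have : ∀ x, G x ^ q = ⨆ k, Gk k x ^ q := by
    intro x
    rw [← hsup x]
    exact (ENNReal.orderIsoRpow q hq0).map_iSup _
  simp_rw [this]
  rw [lintegral_iSup (fun k => (hGkm k).pow_const q)]
  · exact iSup_le hbound
  · intro i j hij x
    exact ENNReal.rpow_le_rpow (hGkmono hij x) hq0.le

/-- Minkowski's integral inequality. -/
theorem lintegral_lintegral_rpow_le {α β : Type*} [MeasurableSpace α] [MeasurableSpace β]
    {μ : Measure α} {ν : Measure β} [SFinite μ] [SigmaFinite ν] {r : ℝ} (hr : 1 < r)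
    {H : α → β → ℝ≥0∞} (hH : Measurable (Function.uncurry H)) :
    ∫⁻ y, (∫⁻ x, H x y ∂μ) ^ r ∂ν ≤ (∫⁻ x, (∫⁻ y, H x y ^ r ∂ν) ^ (1 / r) ∂μ) ^ r := by
  -- By duality: pair with g, exchange the integrals, and apply Hölder in y for each fixed x.
  have hpq : r.conjExponent.HolderConjugate r := (Real.HolderConjugate.conjExponent hr).symm
  refine lintegral_rpow_le_of_forall_lintegral_mul_le hpq ?_ (spanningSets ν)
    (measurableSet_spanningSets ν) (monotone_spanningSets ν) (iUnion_spanningSets ν)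
    (measure_spanningSets_lt_top ν) _ ?_
  · exact (hH.comp measurable_swap).lintegral_prod_right'
  · intro g hg K k _ _
    calc ∫⁻ y, (∫⁻ x, H x y ∂μ) * g y ∂ν = ∫⁻ y, ∫⁻ x, H x y * g y ∂μ ∂ν := by
          refine lintegral_congr fun y => ?_
          rw [lintegral_mul_const]
          exact hH.comp (measurable_id.prodMk measurable_const)
      _ = ∫⁻ x, ∫⁻ y, H x y * g y ∂ν ∂μ := by
          refine lintegral_lintegral_swap ?_
          exact ((hH.comp measurable_swap).mul (hg.comp measurable_fst)).aemeasurable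
      _ ≤ ∫⁻ x, (∫⁻ y, H x y ^ r ∂ν) ^ (1 / r) * (∫⁻ y, g y ^ r.conjExponent ∂ν) ^
            (1 / r.conjExponent) ∂μ := by
          refine lintegral_mono fun x => ?_
          exact ENNReal.lintegral_mul_le_Lp_mul_Lq ν hpq.symm
            (hH.comp (measurable_const.prodMk measurable_id)).aemeasurable hg.aemeasurable
      _ = _ := by
          rw [lintegral_mul_const]
          exact ((hH.pow_const r).lintegral_prod_right').pow_const _

/-! ### Hardy–Littlewood–Sobolev on the line, by an elementary truncation argument. -/

theorem lintegral_comp_abs {g : ℝ → ℝ≥0∞} :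
    ∫⁻ x, g |x| = 2 * ∫⁻ x in Set.Ioi 0, g x := by
  have h1 : ∫⁻ x in Set.Ioi (0 : ℝ), g |x| = ∫⁻ x in Set.Ioi 0, g x :=
    setLIntegral_congr_fun measurableSet_Ioi fun x hx => by rw [abs_of_pos hx]
  have h2 : ∫⁻ x in Set.Iio (0 : ℝ), g |x| = ∫⁻ x in Set.Ioi 0, g x := by
    rw [← h1]
    have := (Measure.measurePreserving_neg (volume : Measure ℝ)).setLIntegral_comp_preimage_emb
      (MeasurableEquiv.neg ℝ).measurableEmbedding (fun x => g |x|) (Set.Iio 0)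
    simpa using this.symm
  rw [← lintegral_add_compl _ (measurableSet_Iio (a := (0 : ℝ))), h2, Set.compl_Iio,
    setLIntegral_congr (Ioi_ae_eq_Ici (a := (0 : ℝ))).symm, h1, two_mul]

theorem setLIntegral_abs_rpow_Iio {γ R : ℝ} (hγ : γ < 1) (hR : 0 < R) :
    ∫⁻ x in {x : ℝ | |x| < R}, ENNReal.ofReal (|x| ^ (-γ)) =
      ENNReal.ofReal (2 / (1 - γ) * R ^ (1 - γ)) := by
  have hm : MeasurableSet {x : ℝ | |x| < R} := measurableSet_lt measurable_id.abs measurable_const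
  rw [← lintegral_indicator hm]
  have : ∀ x : ℝ, {x : ℝ | |x| < R}.indicator (fun x => ENNReal.ofReal (|x| ^ (-γ))) x =
      (fun y => (Set.Iio R).indicator (fun y => ENNReal.ofReal (y ^ (-γ))) y) |x| := by
    intro x; simp [Set.indicator]
  simp_rw [this]
  rw [lintegral_comp_abs, lintegral_indicator measurableSet_Iio,
    Measure.restrict_restrict measurableSet_Iio, Set.inter_comm, Set.Ioi_inter_Iio,
    setLIntegral_congr Ioo_ae_eq_Ioc, ← ofReal_integral_eq_lintegral_ofReal,
    ← intervalIntegral.integral_of_le hR.le, integral_rpow (Or.inl (by linarith)),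
    ← ENNReal.ofReal_ofNat, ← ENNReal.ofReal_mul (by norm_num)]
  · rw [Real.zero_rpow (by linarith)]
    ring_nf
  · exact (intervalIntegral.intervalIntegrable_rpow' (by linarith)).1
  · refine (ae_restrict_mem measurableSet_Ioc).mono fun x hx => ?_
    exact Real.rpow_nonneg hx.1.le _

theorem setLIntegral_abs_rpow_Ici {γ R : ℝ} (hγ : 1 < γ) (hR : 0 < R) :
    ∫⁻ x in {x : ℝ | R ≤ |x|}, ENNReal.ofReal (|x| ^ (-γ)) =
      ENNReal.ofReal (2 / (γ - 1) * R ^ (1 - γ)) := by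
  have hm : MeasurableSet {x : ℝ | R ≤ |x|} := measurableSet_le measurable_const measurable_id.abs
  rw [← lintegral_indicator hm]
  have : ∀ x : ℝ, {x : ℝ | R ≤ |x|}.indicator (fun x => ENNReal.ofReal (|x| ^ (-γ))) x =
      (fun y => (Set.Ici R).indicator (fun y => ENNReal.ofReal (y ^ (-γ))) y) |x| := by
    intro x; simp [Set.indicator]
  simp_rw [this]
  rw [lintegral_comp_abs, lintegral_indicator measurableSet_Ici,
    Measure.restrict_restrict measurableSet_Ici,
    Set.inter_eq_left.2 (show Set.Ici R ⊆ Set.Ioi 0 from fun x hx => hR.trans_le hx),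
    setLIntegral_congr Ioi_ae_eq_Ici.symm, ← ofReal_integral_eq_lintegral_ofReal,
    integral_Ioi_rpow_of_lt (by linarith) hR,
    ← ENNReal.ofReal_ofNat, ← ENNReal.ofReal_mul (by norm_num)]
  · congr 1
    rw [show -γ + 1 = 1 - γ by ring]
    have h1 : γ - 1 ≠ 0 := by linarith
    have h2 : 1 - γ ≠ 0 := by linarith
    field_simp
    ring
  · exact integrableOn_Ioi_rpow_of_lt (by linarith) hR
  · refine (ae_restrict_mem measurableSet_Ioi).mono fun x hx => ?_
    exact Real.rpow_nonneg (hR.trans hx).le _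

/-- The part of the potential of `f` coming from values at most `a`. -/
theorem lintegral_sublevel_potential_le {p q : ℝ} (hpq : p.HolderConjugate q) (hq : 2 < q)
    {f : ℝ → ℝ≥0} (hf : Measurable f) {N a : ℝ} (hN : 0 < N) (ha : 0 < a)
    (hfN : ∫⁻ y, (f y : ℝ≥0∞) ^ p = ENNReal.ofReal N) (x : ℝ) :
    ∫⁻ y in {y | (f y : ℝ) ≤ a}, f y * ENNReal.ofReal (|x - y| ^ (-(2 / q))) ≤
      ENNReal.ofReal ((2 / (1 - 2 / q) + 2 ^ (1 / q)) * (N ^ (1 - 2 / q) * a ^ (p - 1))) := by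
  have hp0 := hpq.pos
  have hq0 := hpq.symm.pos
  have hp1 := hpq.lt
  have hpe : p = q / (q - 1) := hpq.symm.conjugate_eq
  have hγ : 2 / q < 1 := by rw [div_lt_one hq0]; exact hq
  -- R balances the two estimates below. Near x, bounding f by a gives a·R^(1 - 2/q). Far from x,
  -- Hölder gives N^(1/p)·R^(-1/q), the kernel raised to the power q being |x - y|^(-2), integrable
  -- at infinity. The two agree up to constants when R = N/a^p.
  set R := N / a ^ p with hR
  have hap : 0 < a ^ p := Real.rpow_pos_of_pos ha p
  have hR0 : 0 < R := div_pos hN hap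
  have hm1 : MeasurableSet {y | |x - y| < R} :=
    measurableSet_lt (measurable_const.sub measurable_id).abs measurable_const
  have hms : MeasurableSet {y | (f y : ℝ) ≤ a} := measurableSet_le hf.coe_nnreal_real measurable_const
  have hk : Measurable fun y : ℝ => ENNReal.ofReal (|x - y| ^ (-(2 / q))) := by fun_prop
  have e1 : ∫⁻ y in {y | |x - y| < R}, ENNReal.ofReal (|x - y| ^ (-(2 / q))) =
      ENNReal.ofReal (2 / (1 - 2 / q) * R ^ (1 - 2 / q)) := by
    rw [← setLIntegral_abs_rpow_Iio hγ hR0]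
    exact (Measure.measurePreserving_sub_left volume x).setLIntegral_comp_preimage_emb
      (MeasurableEquiv.subLeft x).measurableEmbedding
      (fun y => ENNReal.ofReal (|y| ^ (-(2 / q)))) {y | |y| < R}
  have e2 : ∫⁻ y in {y | R ≤ |x - y|}, ENNReal.ofReal (|x - y| ^ (-(2 / q))) ^ q =
      ENNReal.ofReal (2 * R ^ (-1 : ℝ)) := by
    have : (2 : ℝ) * R ^ (-1 : ℝ) = 2 / (2 - 1) * R ^ ((1 : ℝ) - 2) := by norm_num
    rw [this, ← setLIntegral_abs_rpow_Ici (by norm_num) hR0]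
    rw [← (Measure.measurePreserving_sub_left volume x).setLIntegral_comp_preimage_emb
      (MeasurableEquiv.subLeft x).measurableEmbedding
      (fun y => ENNReal.ofReal (|y| ^ (-(2 : ℝ)))) {y | R ≤ |y|}]
    refine lintegral_congr fun y => ?_
    rw [ENNReal.ofReal_rpow_of_nonneg (by positivity) hq0.le, ← Real.rpow_mul (by positivity)]
    congr 2
    field_simp
  have b1 : ∫⁻ y in {y | (f y : ℝ) ≤ a} ∩ {y | |x - y| < R},
      f y * ENNReal.ofReal (|x - y| ^ (-(2 / q))) ≤
      ENNReal.ofReal (2 / (1 - 2 / q) * (N ^ (1 - 2 / q) * a ^ (p - 1))) := by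
    calc _ ≤ ∫⁻ y in {y | (f y : ℝ) ≤ a} ∩ {y | |x - y| < R},
            ENNReal.ofReal a * ENNReal.ofReal (|x - y| ^ (-(2 / q))) := by
          refine setLIntegral_mono (hk.const_mul _) fun y hy => ?_
          gcongr
          rw [← ENNReal.ofReal_coe_nnreal]
          exact ENNReal.ofReal_le_ofReal hy.1
      _ ≤ ∫⁻ y in {y | |x - y| < R},
            ENNReal.ofReal a * ENNReal.ofReal (|x - y| ^ (-(2 / q))) :=
          lintegral_mono_set Set.inter_subset_right
      _ = ENNReal.ofReal (2 / (1 - 2 / q) * (N ^ (1 - 2 / q) * a ^ (p - 1))) := by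
          rw [lintegral_const_mul _ hk, e1, ← ENNReal.ofReal_mul ha.le]
          congr 1
          rw [hR, Real.div_rpow hN.le hap.le, ← Real.rpow_mul ha.le]
          have : a ^ (p - 1) = a / a ^ (p * (1 - 2 / q)) := by
            rw [eq_div_iff (by positivity), ← Real.rpow_add ha]
            have : p - 1 + p * (1 - 2 / q) = 1 := by
              rw [hpe]; field_simp [show q - 1 ≠ 0 by linarith]; ring
            rw [this, Real.rpow_one]
          rw [this]; ring
  have b2 : ∫⁻ y in {y | (f y : ℝ) ≤ a} ∩ {y | |x - y| < R}ᶜ,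
      f y * ENNReal.ofReal (|x - y| ^ (-(2 / q))) ≤
      ENNReal.ofReal (2 ^ (1 / q) * (N ^ (1 - 2 / q) * a ^ (p - 1))) := by
    calc _ ≤ ∫⁻ y in {y | R ≤ |x - y|}, f y * ENNReal.ofReal (|x - y| ^ (-(2 / q))) := by
          refine lintegral_mono_set fun y hy => ?_
          simpa using hy.2
      _ ≤ (∫⁻ y in {y | R ≤ |x - y|}, (f y : ℝ≥0∞) ^ p) ^ (1 / p) *
          (∫⁻ y in {y | R ≤ |x - y|}, ENNReal.ofReal (|x - y| ^ (-(2 / q))) ^ q) ^ (1 / q) :=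
          ENNReal.lintegral_mul_le_Lp_mul_Lq _ hpq hf.coe_nnreal_ennreal.aemeasurable
            hk.aemeasurable
      _ ≤ (ENNReal.ofReal N) ^ (1 / p) * (ENNReal.ofReal (2 * R ^ (-1 : ℝ))) ^ (1 / q) := by
          rw [e2, ← hfN]
          gcongr
          exact Measure.restrict_le_self
      _ = _ := by
          rw [ENNReal.ofReal_rpow_of_nonneg hN.le (by positivity),
            ENNReal.ofReal_rpow_of_nonneg (by positivity) (by positivity),
            ← ENNReal.ofReal_mul (by positivity)]
          congr 1
          rw [Real.mul_rpow (by norm_num) (by positivity), ← Real.rpow_mul hR0.le, hR,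
            Real.div_rpow hN.le hap.le, ← Real.rpow_mul ha.le]
          have h1 : a ^ (p - 1) = (a ^ (p * (-1 * (1 / q))))⁻¹ := by
            rw [← Real.rpow_neg ha.le]
            congr 1
            rw [hpe]; field_simp [show q - 1 ≠ 0 by linarith]; ring
          have h2 : N ^ (1 - 2 / q) = N ^ (1 / p) * N ^ (-1 * (1 / q)) := by
            rw [← Real.rpow_add hN]
            congr 1
            rw [hpe]; field_simp [show q - 1 ≠ 0 by linarith]; ring
          rw [h1, h2]; ring
  rw [← lintegral_inter_add_sdiff _ _ hm1, add_mul, ENNReal.ofReal_add]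
  · exact add_le_add b1 b2
  · have : 0 < 1 - 2 / q := by linarith
    positivity
  · positivity

/-- The diagonal Hardy–Littlewood–Sobolev inequality on the line. -/
theorem exists_lintegral_lintegral_potential_le {p q : ℝ} (hpq : p.HolderConjugate q)
    (hq : 2 < q) : ∃ C : ℝ≥0, ∀ f : ℝ → ℝ≥0, Measurable f →
      ∫⁻ x, ∫⁻ y, (f x : ℝ≥0∞) * f y * ENNReal.ofReal (|x - y| ^ (-(2 / q))) ≤
        C * (∫⁻ x, (f x : ℝ≥0∞) ^ p) ^ (2 / p) := by
  have hp0 := hpq.pos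
  have hq0 := hpq.symm.pos
  have hp1 := hpq.lt
  have hpe : p = q / (q - 1) := hpq.symm.conjugate_eq
  have hγ : 0 < 1 - 2 / q := by rw [sub_pos, div_lt_one hq0]; exact hq
  set c : ℝ := 2 / (1 - 2 / q) + 2 ^ (1 / q) with hc
  have hc0 : 0 < c := by positivity
  refine ⟨Real.toNNReal (2 * c), fun f hf => ?_⟩
  by_cases hNtop : ∫⁻ x, (f x : ℝ≥0∞) ^ p = ⊤
  · rw [hNtop, ENNReal.top_rpow_of_pos (by positivity), ENNReal.mul_top]
    · exact le_top
    · simpa using hc0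
  by_cases hN0 : ∫⁻ x, (f x : ℝ≥0∞) ^ p = 0
  · rw [lintegral_eq_zero_iff (by fun_prop)] at hN0
    have : ∀ᵐ x, f x = 0 := by
      filter_upwards [hN0] with x hx
      simpa [hp0] using hx
    rw [lintegral_congr_ae (g := fun _ => 0)]
    · simp
    · filter_upwards [this] with x hx
      simp [hx]
  set N := (∫⁻ x, (f x : ℝ≥0∞) ^ p).toReal with hN
  have hfN : ∫⁻ y, (f y : ℝ≥0∞) ^ p = ENNReal.ofReal N := (ENNReal.ofReal_toReal hNtop).symm
  have hNpos : 0 < N := ENNReal.toReal_pos hN0 hNtop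
  set k : ℝ → ℝ → ℝ≥0∞ := fun x y => ENNReal.ofReal (|x - y| ^ (-(2 / q))) with hk
  have hkm : Measurable (Function.uncurry k) := by
    simp only [hk, Function.uncurry_def]; fun_prop
  have hksymm : ∀ x y, k x y = k y x := fun x y => by simp only [hk, abs_sub_comm]
  -- The kernel is symmetric, so the half of the plane where f y ≤ f x suffices. There the sublevel
  -- bound with a = f x supplies the factor (f x)^(p - 1), which together with f x gives the
  -- integrable (f x)^p.
  let D : Set (ℝ × ℝ) := {z | f z.2 ≤ f z.1}
  have hD : MeasurableSet D := measurableSet_le (hf.comp measurable_snd) (hf.comp measurable_fst)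
  let F : ℝ × ℝ → ℝ≥0∞ := D.indicator fun z => (f z.1 : ℝ≥0∞) * f z.2 * k z.1 z.2
  have hF : Measurable F := by
    refine Measurable.indicator ?_ hD
    exact (((hf.comp measurable_fst).coe_nnreal_ennreal).mul
      ((hf.comp measurable_snd).coe_nnreal_ennreal)).mul hkm
  have hsub : ∀ x y, (f x : ℝ≥0∞) * f y * k x y ≤ F (x, y) + F (y, x) := by
    intro x y
    rcases le_total (f y) (f x) with h | h
    · have : (x, y) ∈ D := h
      simp only [F, Set.indicator_of_mem this]
      exact le_self_add
    · have : (y, x) ∈ D := h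
      simp only [F, Set.indicator_of_mem this]
      rw [hksymm x y, mul_comm (f x : ℝ≥0∞)]
      exact le_add_self
  have hinner : ∫⁻ x, ∫⁻ y, F (x, y) ≤ ENNReal.ofReal (c * N ^ (2 / p)) := by
    calc ∫⁻ x, ∫⁻ y, F (x, y) ≤
          ∫⁻ x, (f x : ℝ≥0∞) ^ p * ENNReal.ofReal (c * N ^ (1 - 2 / q)) := by
          refine lintegral_mono fun x => ?_
          have hms : MeasurableSet {y | (f y : ℝ) ≤ f x} :=
            measurableSet_le hf.coe_nnreal_real measurable_const
          have : ∫⁻ y, F (x, y) = f x * ∫⁻ y in {y | (f y : ℝ) ≤ f x}, f y * k x y := by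
            rw [← lintegral_const_mul, ← lintegral_indicator hms]
            · refine lintegral_congr fun y => ?_
              simp only [F, D, Set.indicator, Set.mem_ofPred_eq, NNReal.coe_le_coe, mul_assoc]
            · exact hf.coe_nnreal_ennreal.mul (hkm.comp (measurable_const.prodMk measurable_id))
          rw [this]
          by_cases hx : f x = 0
          · simp [hx]
          have hx' : (0 : ℝ) < f x := by exact_mod_cast pos_iff_ne_zero.2 hx
          calc _ ≤ (f x : ℝ≥0∞) * ENNReal.ofReal (c * (N ^ (1 - 2 / q) * (f x : ℝ) ^ (p - 1))) := by
                gcongr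
                exact lintegral_sublevel_potential_le hpq hq hf hNpos hx' hfN x
            _ = _ := by
                rw [← ENNReal.ofReal_coe_nnreal, ENNReal.ofReal_rpow_of_nonneg hx'.le hp0.le,
                  ← ENNReal.ofReal_mul hx'.le, ← ENNReal.ofReal_mul (by positivity)]
                congr 1
                have : (f x : ℝ) ^ p = f x * (f x : ℝ) ^ (p - 1) := by
                  rw [Real.rpow_sub_one hx'.ne']; field_simp
                rw [this]; ring
      _ = _ := by
          rw [lintegral_mul_const _ (by fun_prop), hfN, ← ENNReal.ofReal_mul hNpos.le]
          congr 1
          have : N ^ (2 / p) = N * N ^ (1 - 2 / q) := by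
            rw [← Real.rpow_one_add' hNpos.le (by positivity)]
            congr 1
            rw [hpe]; field_simp [show q - 1 ≠ 0 by linarith]; ring
          rw [this]; ring
  calc ∫⁻ x, ∫⁻ y, (f x : ℝ≥0∞) * f y * k x y ≤ ∫⁻ x, ∫⁻ y, (F (x, y) + F (y, x)) :=
        lintegral_mono fun x => lintegral_mono fun y => hsub x y
    _ = (∫⁻ x, ∫⁻ y, F (x, y)) + ∫⁻ x, ∫⁻ y, F (y, x) := by
        rw [← lintegral_add_left (hF.lintegral_prod_right')]
        refine lintegral_congr fun x => ?_
        rw [lintegral_add_left]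
        exact hF.comp (measurable_const.prodMk measurable_id)
    _ = 2 * ∫⁻ x, ∫⁻ y, F (x, y) := by
        rw [two_mul]
        congr 1
        exact lintegral_lintegral_swap (f := fun x y => F (y, x))
          (hF.comp measurable_swap).aemeasurable
    _ ≤ 2 * ENNReal.ofReal (c * N ^ (2 / p)) := by gcongr
    _ = _ := by
        rw [hfN, ENNReal.ofReal_rpow_of_nonneg hNpos.le (by positivity), ← ENNReal.ofReal_ofNat,
          ← ENNReal.ofReal_mul (by norm_num), ENNReal.ofNNReal_toNNReal,
          ← ENNReal.ofReal_mul (by positivity)]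
        congr 1; ring

/-! ### Plancherel and Parseval for the Fourier integral on L¹ ∩ L². -/

section Plancherel

open FourierTransform

variable {V : Type*} [NormedAddCommGroup V] [InnerProductSpace ℝ V] [FiniteDimensional ℝ V]
  [MeasurableSpace V] [BorelSpace V]

theorem continuous_fourier_of_integrable {f : V → ℂ} (hf : Integrable f) : Continuous (𝓕 f) :=
  VectorFourier.fourierIntegral_continuous Real.continuous_fourierChar
    (innerSL ℝ).continuous₂ hf

theorem integral_fourier_mul_eq_flip {f g : V → ℂ} (hf : Integrable f) (hg : Integrable g) :
    ∫ ξ, 𝓕 f ξ * g ξ = ∫ x, f x * 𝓕 g x := by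
  have := VectorFourier.integral_fourierIntegral_smul_eq_flip (L := innerₗ V)
    Real.continuous_fourierChar continuous_inner hf hg
  simpa [Real.fourier_eq, VectorFourier.fourierIntegral, real_inner_comm] using! this

/-- On `L¹ ∩ L²`, the `L²` Fourier transform is given by the Fourier integral. -/
theorem fourier_toLp_ae_eq {f : V → ℂ} (hf1 : Integrable f) (hf2 : MemLp f 2) :
    (𝓕 (hf2.toLp f) : Lp (α := V) ℂ 2 volume) =ᵐ[volume] 𝓕 f := by
  -- Both sides are locally integrable, so they are compared as distributions: the L² transform acts
  -- on test functions by duality, and the multiplication formula says the same of the integral.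
  refine ae_eq_of_integral_contDiff_smul_eq ?_ ?_ ?_
  · exact (Lp.memLp _).locallyIntegrable (by norm_num)
  · exact (continuous_fourier_of_integrable hf1).locallyIntegrable
  · intro g g_smooth g_cpt
    have hg₁ : HasCompactSupport (Complex.ofRealCLM ∘ g) := g_cpt.comp_left rfl
    have hg₂ : ContDiff ℝ ∞ (Complex.ofRealCLM ∘ g) := by fun_prop
    let s : SchwartzMap V ℂ := hg₁.toSchwartzMap hg₂
    have hs : ∀ x, s x = (g x : ℂ) := fun x => by simp [s]
    have h1 : ∫ x, g x • (𝓕 (hf2.toLp f) : Lp (α := V) ℂ 2 volume) x =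
        ((𝓕 (hf2.toLp f) : Lp (α := V) ℂ 2 volume) : TemperedDistribution V ℂ) s := by
      rw [Lp.toTemperedDistribution_apply]
      simp [hs]
    rw [h1, ← Lp.fourier_toTemperedDistribution_eq, TemperedDistribution.fourier_apply,
      Lp.toTemperedDistribution_apply]
    calc ∫ x, (𝓕 s) x • (hf2.toLp f : V → ℂ) x = ∫ x, 𝓕 (s : V → ℂ) x * f x := by
          refine integral_congr_ae ?_
          filter_upwards [hf2.coeFn_toLp] with x hx
          rw [hx, SchwartzMap.fourier_coe, smul_eq_mul]
      _ = ∫ x, s x * 𝓕 f x := integral_fourier_mul_eq_flip s.integrable hf1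
      _ = _ := by simp [hs]

theorem lintegral_fourier_sq {f : V → ℂ} (hf1 : Integrable f) (hf2 : MemLp f 2) :
    ∫⁻ ξ, ‖𝓕 f ξ‖ₑ ^ (2 : ℝ) = ∫⁻ x, ‖f x‖ₑ ^ (2 : ℝ) := by
  have h1 : ‖(𝓕 (hf2.toLp f) : Lp (α := V) ℂ 2 volume)‖ₑ = ‖hf2.toLp f‖ₑ := by
    rw [← ofReal_norm, ← ofReal_norm, Lp.norm_fourier_eq]
  rw [Lp.enorm_toLp, Lp.enorm_def, eLpNorm_congr_ae (fourier_toLp_ae_eq hf1 hf2),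
    eLpNorm_eq_lintegral_rpow_enorm_toReal (by norm_num) (by norm_num),
    eLpNorm_eq_lintegral_rpow_enorm_toReal (by norm_num) (by norm_num)] at h1
  simpa using ENNReal.rpow_left_injective (x := 1 / 2) (by norm_num) (by simpa using h1)

theorem integral_conj_fourier_mul_fourier {f g : V → ℂ} (hf1 : Integrable f) (hf2 : MemLp f 2)
    (hg1 : Integrable g) (hg2 : MemLp g 2) :
    ∫ ξ, starRingEnd ℂ (𝓕 f ξ) * 𝓕 g ξ = ∫ x, starRingEnd ℂ (f x) * g x := by
  have h := Lp.inner_fourier_eq (hf2.toLp f) (hg2.toLp g)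
  rw [L2.inner_def, L2.inner_def] at h
  calc _ = ∫ ξ, inner ℂ ((𝓕 (hf2.toLp f) : Lp (α := V) ℂ 2 volume) ξ) ((𝓕 (hg2.toLp g) : Lp (α := V) ℂ 2 volume) ξ) := by
        refine integral_congr_ae ?_
        filter_upwards [fourier_toLp_ae_eq hf1 hf2, fourier_toLp_ae_eq hg1 hg2] with x h1 h2
        rw [h1, h2, RCLike.inner_apply, mul_comm]
    _ = _ := h
    _ = _ := by
        refine integral_congr_ae ?_
        filter_upwards [hf2.coeFn_toLp, hg2.coeFn_toLp] with x h1 h2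
        rw [h1, h2, RCLike.inner_apply, mul_comm]

end Plancherel

/-! ### Weighted L² bounds for the Fourier transform, by Gaussian subordination. -/

section FractionalWeight

open FourierTransform Real

/-- The Gaussian makes the integral converge absolutely, since the transform of h is only known to
be bounded. The multiplication formula moves one transform onto the product of the Gaussian and the
conjugate of ĥ, and that transform is dominated by the convolution of |h| with the transformed
Gaussian. -/
theorem lintegral_gaussian_mul_fourier_sq_le {h : ℝ → ℂ} (hh : Integrable h) {u : ℝ} (hu : 0 < u) :
    ∫⁻ ξ, ENNReal.ofReal (rexp (-π * u * ξ ^ 2)) * ‖𝓕 h ξ‖ₑ ^ (2 : ℝ) ≤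
      ∫⁻ x, ∫⁻ y, ‖h x‖ₑ * ‖h y‖ₑ *
        ENNReal.ofReal (u ^ (-(1 / 2) : ℝ) * rexp (-π / u * (x - y) ^ 2)) := by
  let G : ℝ → ℂ := fun ξ => Complex.exp (-π * u * ξ ^ 2)
  have hGr : ∀ ξ, G ξ = (rexp (-π * u * ξ ^ 2) : ℂ) := fun ξ => by simp [G]
  have hGi : Integrable G := by
    have := (integrable_exp_neg_mul_sq (b := π * u) (by positivity)).ofReal (𝕜 := ℂ)
    refine this.congr (Filter.Eventually.of_forall fun ξ => ?_)
    simp [G]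
  have hFG : ∀ t, 𝓕 G t = ((u ^ (-(1 / 2) : ℝ) * rexp (-π / u * t ^ 2) : ℝ) : ℂ) := by
    intro t
    have := congrFun (fourier_gaussian_pi (b := u) (by simpa using hu)) t
    rw [show 𝓕 G t = _ from this]
    push_cast
    rw [Complex.ofReal_cpow hu.le, one_div, ← Complex.cpow_neg]
    push_cast
    ring_nf
  have hcont := continuous_fourier_of_integrable hh
  obtain ⟨B, hB⟩ : ∃ B, ∀ ξ, ‖𝓕 h ξ‖ ≤ B :=
    ⟨_, fun ξ => VectorFourier.norm_fourierIntegral_le_integral_norm _ _ _ _ _⟩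
  have hGh : Integrable fun ξ => G ξ * starRingEnd ℂ (𝓕 h ξ) := by
    refine hGi.mul_bdd (c := B) ?_ ?_
    · exact (Complex.continuous_conj.comp hcont).aestronglyMeasurable
    · exact Filter.Eventually.of_forall fun ξ => by simpa using hB ξ
  have hGh' : ∀ y, ‖𝓕 (fun ξ => G ξ * starRingEnd ℂ (𝓕 h ξ)) y‖ₑ ≤
      ∫⁻ x, ‖h x‖ₑ * ENNReal.ofReal (u ^ (-(1 / 2) : ℝ) * rexp (-π / u * (y - x) ^ 2)) := by
    intro y
    have hmod : Integrable fun ξ => Real.fourierChar (y * ξ) * G ξ := by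
      refine hGi.bdd_mul (c := 1) ?_ ?_
      · exact (Continuous.aestronglyMeasurable (by fun_prop))
      · exact Filter.Eventually.of_forall fun ξ => (Circle.norm_coe _).le
    -- After conjugation the integrand is ĥ times a modulated Gaussian, so the multiplication
    -- formula applies a second time.
    have e1 : ‖𝓕 (fun ξ => G ξ * starRingEnd ℂ (𝓕 h ξ)) y‖ₑ =
        ‖∫ ξ, 𝓕 h ξ * (Real.fourierChar (y * ξ) * G ξ)‖ₑ := by
      rw [← RCLike.enorm_conj, Real.fourier_real_eq, ← integral_conj]
      congr 2
      ext ξ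
      rw [Circle.smul_def, smul_eq_mul, map_mul, map_mul, Complex.conj_conj, hGr,
        Complex.conj_ofReal, AddChar.map_neg_eq_inv, Circle.coe_inv_eq_conj, Complex.conj_conj,
        mul_comm y]
      ring
    rw [e1, integral_fourier_mul_eq_flip hh hmod]
    refine (enorm_integral_le_lintegral_enorm _).trans (lintegral_mono fun x => ?_)
    rw [enorm_mul]
    gcongr
    have : 𝓕 (fun ξ => (Real.fourierChar (y * ξ) : ℂ) * G ξ) x = 𝓕 G (x - y) := by
      rw [Real.fourier_real_eq, Real.fourier_real_eq]
      congr 1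
      ext ξ
      simp only [Circle.smul_def, smul_eq_mul, ← mul_assoc]
      congr 1
      rw [← Circle.coe_mul, ← AddChar.map_add_eq_mul]
      congr 2
      ring
    rw [this, hFG, ← ofReal_norm, Complex.norm_real, Real.norm_of_nonneg (by positivity)]
    rw [show (x - y) ^ 2 = (y - x) ^ 2 by ring]
  have key : ∫⁻ ξ, ENNReal.ofReal (rexp (-π * u * ξ ^ 2)) * ‖𝓕 h ξ‖ₑ ^ (2 : ℝ) =
      ‖∫ ξ, 𝓕 h ξ * (G ξ * starRingEnd ℂ (𝓕 h ξ))‖ₑ := by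
    have e2 : ∀ ξ, 𝓕 h ξ * (G ξ * starRingEnd ℂ (𝓕 h ξ)) =
        ((rexp (-π * u * ξ ^ 2) * ‖𝓕 h ξ‖ ^ 2 : ℝ) : ℂ) := by
      intro ξ
      rw [hGr, mul_left_comm, Complex.mul_conj, Complex.normSq_eq_norm_sq]
      push_cast; ring
    have hi : Integrable fun ξ => rexp (-π * u * ξ ^ 2) * ‖𝓕 h ξ‖ ^ 2 := by
      have : Integrable fun ξ => 𝓕 h ξ * (G ξ * starRingEnd ℂ (𝓕 h ξ)) :=
        hGh.bdd_mul (c := B) hcont.aestronglyMeasurable (Filter.Eventually.of_forall hB)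
      simp_rw [e2] at this
      refine this.re.congr (Filter.Eventually.of_forall fun ξ => ?_)
      exact Complex.ofReal_re _
    simp_rw [e2]
    rw [integral_complex_ofReal, ← ofReal_norm, Complex.norm_real, Real.norm_of_nonneg
      (integral_nonneg fun ξ => by positivity), ofReal_integral_eq_lintegral_ofReal hi
      (Filter.Eventually.of_forall fun ξ => by positivity)]
    refine lintegral_congr fun ξ => ?_
    rw [ENNReal.ofReal_mul (by positivity), ENNReal.ofReal_pow (norm_nonneg _), ofReal_norm]
    norm_num
  rw [key, integral_fourier_mul_eq_flip hh hGh]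
  refine (enorm_integral_le_lintegral_enorm _).trans (lintegral_mono fun x => ?_)
  rw [enorm_mul]
  refine (mul_le_mul_right (hGh' x) _).trans_eq ?_
  rw [← lintegral_const_mul']
  · simp only [mul_assoc]
  · simp

/-- With c = πξ² this writes a negative power of |ξ| as a superposition of Gaussians. Its companion
`lintegral_rpow_mul_exp_neg_div`, obtained by u ↦ 1/u, reassembles the transformed Gaussians into a
power of |x - y|. -/
theorem lintegral_rpow_mul_gaussian {s : ℝ} (hs : 0 < s) {c : ℝ} (hc : 0 < c) :
    ∫⁻ u in Set.Ioi (0 : ℝ), ENNReal.ofReal (u ^ (s - 1) * rexp (-(c * u))) =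
      ENNReal.ofReal (Gamma s * c ^ (-s)) := by
  have h := integral_rpow_mul_exp_neg_mul_Ioi hs hc
  rw [← ofReal_integral_eq_lintegral_ofReal, h]
  · rw [one_div, inv_rpow hc.le, ← rpow_neg hc.le, mul_comm]
  · refine Integrable.of_integral_ne_zero ?_
    rw [h]
    have := Gamma_pos_of_pos hs
    positivity
  · refine (ae_restrict_mem measurableSet_Ioi).mono fun x hx => ?_
    have : 0 < x := hx
    show 0 ≤ x ^ (s - 1) * rexp (-(c * x))
    positivity

theorem lintegral_rpow_mul_exp_neg_div {s : ℝ} (hs : 0 < s) {c : ℝ} (hc : 0 < c) :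
    ∫⁻ u in Set.Ioi (0 : ℝ), ENNReal.ofReal (u ^ (-s - 1) * rexp (-(c / u))) =
      ENNReal.ofReal (Gamma s * c ^ (-s)) := by
  have h := integral_comp_rpow_Ioi (fun u => u ^ (s - 1) * rexp (-(c * u))) (p := -1) (by norm_num)
  rw [integral_rpow_mul_exp_neg_mul_Ioi hs hc] at h
  have h2 : ∫ u in Set.Ioi (0 : ℝ), u ^ (-s - 1) * rexp (-(c / u)) = (1 / c) ^ s * Gamma s := by
    rw [← h]
    refine setIntegral_congr_fun measurableSet_Ioi fun u hu => ?_
    have hu : 0 < u := hu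
    simp only [abs_neg, abs_one, one_mul, smul_eq_mul]
    rw [← mul_assoc, ← rpow_mul hu.le, ← rpow_add hu, rpow_neg_one, div_eq_mul_inv]
    ring_nf
  rw [← ofReal_integral_eq_lintegral_ofReal, h2]
  · rw [one_div, inv_rpow hc.le, ← rpow_neg hc.le, mul_comm]
  · refine Integrable.of_integral_ne_zero ?_
    rw [h2]
    have := Gamma_pos_of_pos hs
    positivity
  · refine (ae_restrict_mem measurableSet_Ioi).mono fun x hx => ?_
    have : 0 < x := hx
    show 0 ≤ x ^ (-s - 1) * rexp (-(c / x))
    positivity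

/-- Hardy–Littlewood–Sobolev on the Fourier side: a weighted `L²` bound for the Fourier transform
of an `Lᵖ` function. -/
theorem exists_lintegral_weight_mul_fourier_sq_le {p q : ℝ} (hpq : p.HolderConjugate q)
    (hq : 2 < q) : ∃ C : ℝ≥0, ∀ h : ℝ → ℂ, Measurable h → Integrable h →
      ∫⁻ ξ, ENNReal.ofReal (|ξ| ^ (-(1 - 2 / q))) * ‖𝓕 h ξ‖ₑ ^ (2 : ℝ) ≤
        C * (∫⁻ x, ‖h x‖ₑ ^ p) ^ (2 / p) := by
  obtain ⟨C, hC⟩ := exists_lintegral_lintegral_potential_le hpq hq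
  have hq0 := hpq.symm.pos
  set κ := 1 - 2 / q with hκ
  have hκ0 : 0 < κ := by rw [hκ, sub_pos, div_lt_one hq0]; exact hq
  have hκ1 : 0 < 1 - κ := by rw [hκ]; ring_nf; positivity
  -- The product c1·c2 is the constant in the identity stating that the Fourier transform of
  -- |ξ|^(-κ) is a multiple of |t|^(-(1 - κ)); here 1 - κ = 2/q is the exponent of the potential.
  set c1 : ℝ := (Gamma (κ / 2) * π ^ (-(κ / 2)))⁻¹ with hc1
  set c2 : ℝ := Gamma ((1 - κ) / 2) * π ^ (-((1 - κ) / 2)) with hc2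
  have hg1 := Gamma_pos_of_pos (show 0 < κ / 2 by positivity)
  have hg2 := Gamma_pos_of_pos (show 0 < (1 - κ) / 2 by positivity)
  have hc1p : 0 < c1 := by positivity
  have hc2p : 0 < c2 := by positivity
  refine ⟨Real.toNNReal c1 * Real.toNNReal c2 * C, fun h hm hh => ?_⟩
  have hsq : ∀ {x : ℝ} (_ : x ≠ 0) (s : ℝ), (π * x ^ 2) ^ (-(s / 2)) = π ^ (-(s / 2)) * |x| ^ (-s) := by
    intro x hx s
    rw [mul_rpow (by positivity) (by positivity), ← sq_abs, ← rpow_natCast, ← rpow_mul (abs_nonneg x)]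
    congr 2
    push_cast; ring
  have A : ∀ ξ : ℝ, ξ ≠ 0 → ENNReal.ofReal (|ξ| ^ (-κ)) = ENNReal.ofReal c1 *
      ∫⁻ u in Set.Ioi (0 : ℝ), ENNReal.ofReal (u ^ (κ / 2 - 1) * rexp (-π * u * ξ ^ 2)) := by
    intro ξ hξ
    have := lintegral_rpow_mul_gaussian (s := κ / 2) (by positivity) (c := π * ξ ^ 2) (by positivity)
    rw [hsq hξ] at this
    have e : ∀ u : ℝ, -(π * ξ ^ 2 * u) = -π * u * ξ ^ 2 := fun u => by ring
    simp_rw [e] at this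
    rw [this, ← ENNReal.ofReal_mul hc1p.le, hc1]
    congr 1
    field_simp
  have B : ∀ t : ℝ, t ≠ 0 → ∫⁻ u in Set.Ioi (0 : ℝ), ENNReal.ofReal (u ^ (κ / 2 - 1)) *
      ENNReal.ofReal (u ^ (-(1 / 2) : ℝ) * rexp (-π / u * t ^ 2)) =
      ENNReal.ofReal c2 * ENNReal.ofReal (|t| ^ (-(2 / q))) := by
    intro t ht
    have := lintegral_rpow_mul_exp_neg_div (s := (1 - κ) / 2) (by positivity) (c := π * t ^ 2)
      (by positivity)
    rw [hsq ht, ← mul_assoc, ENNReal.ofReal_mul (by positivity)] at this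
    rw [hc2, show -(2 / q) = -(1 - κ) by rw [hκ]; ring, ← this]
    refine setLIntegral_congr_fun measurableSet_Ioi fun u hu => ?_
    have hu : 0 < u := hu
    rw [← ENNReal.ofReal_mul (by positivity), ← mul_assoc, ← rpow_add hu]
    ring_nf
  have hFm : Measurable fun ξ => ‖𝓕 h ξ‖ₑ ^ (2 : ℝ) :=
    ((continuous_fourier_of_integrable hh).measurable.enorm).pow_const _
  have hAE : ∀ᵐ ξ : ℝ, ξ ≠ 0 := Measure.ae_ne volume 0
  calc ∫⁻ ξ, ENNReal.ofReal (|ξ| ^ (-κ)) * ‖𝓕 h ξ‖ₑ ^ (2 : ℝ)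
      = ∫⁻ ξ, ENNReal.ofReal c1 * ∫⁻ u in Set.Ioi (0 : ℝ), ENNReal.ofReal (u ^ (κ / 2 - 1)) *
          (ENNReal.ofReal (rexp (-π * u * ξ ^ 2)) * ‖𝓕 h ξ‖ₑ ^ (2 : ℝ)) := by
        refine lintegral_congr_ae ?_
        filter_upwards [hAE] with ξ hξ
        rw [A ξ hξ, mul_assoc, ← lintegral_mul_const _ (by fun_prop)]
        congr 1
        refine setLIntegral_congr_fun measurableSet_Ioi fun u hu => ?_
        have hu : 0 < u := hu
        rw [ENNReal.ofReal_mul (by positivity), mul_assoc]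
    _ = ENNReal.ofReal c1 * ∫⁻ u in Set.Ioi (0 : ℝ), ENNReal.ofReal (u ^ (κ / 2 - 1)) *
          ∫⁻ ξ, (ENNReal.ofReal (rexp (-π * u * ξ ^ 2)) * ‖𝓕 h ξ‖ₑ ^ (2 : ℝ)) := by
        rw [lintegral_const_mul' _ _ (by simp), lintegral_lintegral_swap]
        · congr 1
          refine lintegral_congr fun u => ?_
          rw [lintegral_const_mul' _ _ (by simp)]
        · refine Measurable.aemeasurable ?_
          exact Measurable.mul (by fun_prop) (Measurable.mul (by fun_prop) (hFm.comp measurable_fst))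
    _ ≤ ENNReal.ofReal c1 * ∫⁻ u in Set.Ioi (0 : ℝ), ENNReal.ofReal (u ^ (κ / 2 - 1)) *
          ∫⁻ x, ∫⁻ y, ‖h x‖ₑ * ‖h y‖ₑ *
            ENNReal.ofReal (u ^ (-(1 / 2) : ℝ) * rexp (-π / u * (x - y) ^ 2)) := by
        refine mul_le_mul_right ?_ _
        refine setLIntegral_mono' measurableSet_Ioi fun u hu => ?_
        exact mul_le_mul_right (lintegral_gaussian_mul_fourier_sq_le hh hu) _
    _ = ENNReal.ofReal c1 * ∫⁻ x, ∫⁻ y, ‖h x‖ₑ * ‖h y‖ₑ *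
          ∫⁻ u in Set.Ioi (0 : ℝ), ENNReal.ofReal (u ^ (κ / 2 - 1)) *
            ENNReal.ofReal (u ^ (-(1 / 2) : ℝ) * rexp (-π / u * (x - y) ^ 2)) := by
        congr 1
        have hme : Measurable fun z : ℝ × ℝ × ℝ => ENNReal.ofReal (z.1 ^ (κ / 2 - 1)) *
            (‖h z.2.1‖ₑ * ‖h z.2.2‖ₑ * ENNReal.ofReal
              (z.1 ^ (-(1 / 2) : ℝ) * rexp (-π / z.1 * (z.2.1 - z.2.2) ^ 2))) := by fun_prop
        calc _ = ∫⁻ u in Set.Ioi (0 : ℝ), ∫⁻ x, ∫⁻ y, ENNReal.ofReal (u ^ (κ / 2 - 1)) *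
                (‖h x‖ₑ * ‖h y‖ₑ *
                ENNReal.ofReal (u ^ (-(1 / 2) : ℝ) * rexp (-π / u * (x - y) ^ 2))) := by
              refine lintegral_congr fun u => ?_
              rw [← lintegral_const_mul' _ _ (by simp)]
              refine lintegral_congr fun x => ?_
              rw [← lintegral_const_mul' _ _ (by simp)]
          _ = ∫⁻ x, ∫⁻ u in Set.Ioi (0 : ℝ), ∫⁻ y, ENNReal.ofReal (u ^ (κ / 2 - 1)) *
                (‖h x‖ₑ * ‖h y‖ₑ *
                ENNReal.ofReal (u ^ (-(1 / 2) : ℝ) * rexp (-π / u * (x - y) ^ 2))) := by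
              refine lintegral_lintegral_swap (Measurable.aemeasurable ?_)
              refine Measurable.lintegral_prod_right (f := fun (w : ℝ × ℝ) y =>
                ENNReal.ofReal (w.1 ^ (κ / 2 - 1)) * (‖h w.2‖ₑ * ‖h y‖ₑ * ENNReal.ofReal
                  (w.1 ^ (-(1 / 2) : ℝ) * rexp (-π / w.1 * (w.2 - y) ^ 2)))) ?_
              exact hme.comp (by fun_prop : Measurable fun w : (ℝ × ℝ) × ℝ => (w.1.1, w.1.2, w.2))
          _ = _ := by
              refine lintegral_congr fun x => ?_
              rw [lintegral_lintegral_swap]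
              · refine lintegral_congr fun y => ?_
                rw [← lintegral_const_mul' _ _ (ENNReal.mul_ne_top (by simp) (by simp))]
                refine lintegral_congr fun u => ?_
                ring
              · exact (hme.comp (by fun_prop :
                  Measurable fun w : ℝ × ℝ => (w.1, x, w.2))).aemeasurable
    _ = ENNReal.ofReal c1 * (ENNReal.ofReal c2 * ∫⁻ x, ∫⁻ y, ‖h x‖ₑ * ‖h y‖ₑ *
          ENNReal.ofReal (|x - y| ^ (-(2 / q)))) := by
        congr 1
        rw [← lintegral_const_mul' _ _ (by simp)]
        refine lintegral_congr fun x => ?_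
        rw [← lintegral_const_mul' _ _ (by simp)]
        refine lintegral_congr_ae ?_
        filter_upwards [Measure.ae_ne volume x] with y hy
        rw [B _ (sub_ne_zero.2 hy.symm)]
        ring
    _ ≤ ENNReal.ofReal c1 * (ENNReal.ofReal c2 * (C * (∫⁻ x, ‖h x‖ₑ ^ p) ^ (2 / p))) := by
        gcongr
        exact hC (fun x => ‖h x‖₊) hm.nnnorm
    _ = _ := by
        push_cast
        rw [ENNReal.ofReal, ENNReal.ofReal]
        ring

end FractionalWeight

/-! ### The Hausdorff–Young inequality by real interpolation. -/

section HausdorffYoung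

open FourierTransform

variable {V : Type*} [NormedAddCommGroup V] [InnerProductSpace ℝ V] [FiniteDimensional ℝ V]
  [MeasurableSpace V] [BorelSpace V]

theorem memLp_two_of_bound {α : Type*} [MeasurableSpace α] {μ : Measure α} {f : α → ℂ}
    (hf : Integrable f μ) {K : ℝ} (hK : ∀ x, ‖f x‖ ≤ K) : MemLp f 2 μ := by
  rw [memLp_two_iff_integrable_sq_norm hf.1]
  simp_rw [pow_two]
  refine hf.norm.bdd_mul (c := K) hf.1.norm (Filter.Eventually.of_forall fun x => ?_)
  simpa using hK x

theorem enorm_fourier_le_lintegral (f : V → ℂ) (ξ : V) : ‖𝓕 f ξ‖ₑ ≤ ∫⁻ x, ‖f x‖ₑ := by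
  rw [Real.fourier_eq]
  refine (enorm_integral_le_lintegral_enorm _).trans_eq (lintegral_congr fun x => ?_)
  rw [← ofReal_norm, Circle.norm_smul, ofReal_norm]

/-- Cut f at height h. The part above h has L¹ norm at most h^(1 - p)·N ≤ α/2, so its transform
never exceeds α/2. Where the transform of f exceeds α, that of the lower part is at least α/2, and
Chebyshev with Plancherel bounds the measure. -/
theorem measure_lt_norm_fourier_le {f : V → ℂ} (hfm : Measurable f) (hf : Integrable f)
    {p N α h : ℝ} (hp : 1 < p) (hα : 0 < α) (hh : 0 < h)
    (hN : ∫⁻ x, ‖f x‖ₑ ^ p ≤ ENNReal.ofReal N) (hhN : h ^ (1 - p) * N ≤ α / 2) :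
    volume {ξ | α < ‖𝓕 f ξ‖} ≤ ENNReal.ofReal (4 * α ^ (-2 : ℝ)) *
      ∫⁻ x in {x | ‖f x‖ ≤ h}, ‖f x‖ₑ ^ (2 : ℝ) := by
  have hS : MeasurableSet {x | ‖f x‖ ≤ h} := measurableSet_le hfm.norm measurable_const
  set S := {x | ‖f x‖ ≤ h} with hSdef
  set f1 := Sᶜ.indicator f
  set f2 := S.indicator f
  have hsum : f1 + f2 = f := by rw [add_comm]; exact Set.indicator_self_add_compl S f
  have hf1 : Integrable f1 := hf.indicator hS.compl
  have hf2 : Integrable f2 := hf.indicator hS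
  have hf2' : MemLp f2 2 := by
    refine memLp_two_of_bound hf2 (K := h) fun x => ?_
    by_cases hx : x ∈ S
    · simp only [f2, Set.indicator_of_mem hx]
      exact hx
    · simpa [f2, hx] using hh.le
  have hsmall : ∀ ξ, ‖𝓕 f1 ξ‖ ≤ α / 2 := by
    intro ξ
    have : ‖𝓕 f1 ξ‖ₑ ≤ ENNReal.ofReal (α / 2) := by
      calc ‖𝓕 f1 ξ‖ₑ ≤ ∫⁻ x, ‖f1 x‖ₑ := enorm_fourier_le_lintegral _ _
        _ ≤ ∫⁻ x, ENNReal.ofReal (h ^ (1 - p)) * ‖f x‖ₑ ^ p := by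
            refine lintegral_mono fun x => ?_
            by_cases hx : x ∈ S
            · simp [f1, hx]
            · have hx' : h < ‖f x‖ := by simpa [hSdef] using hx
              have hpos := hh.trans hx'
              simp only [f1, Set.indicator_of_mem (show x ∈ Sᶜ from hx)]
              rw [← ofReal_norm, ENNReal.ofReal_rpow_of_nonneg (norm_nonneg _) (by linarith),
                ← ENNReal.ofReal_mul (by positivity)]
              refine ENNReal.ofReal_le_ofReal ?_
              have e : ‖f x‖ = ‖f x‖ ^ (1 - p) * ‖f x‖ ^ p := by
                rw [← Real.rpow_add hpos]; simp
              conv_lhs => rw [e]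
              gcongr ?_ * _
              exact Real.rpow_le_rpow_of_nonpos hh hx'.le (by linarith)
        _ = ENNReal.ofReal (h ^ (1 - p)) * ∫⁻ x, ‖f x‖ₑ ^ p := by
            rw [lintegral_const_mul' _ _ (by simp)]
        _ ≤ ENNReal.ofReal (h ^ (1 - p)) * ENNReal.ofReal N := by gcongr
        _ ≤ _ := by
            rw [← ENNReal.ofReal_mul (by positivity)]
            exact ENNReal.ofReal_le_ofReal hhN
    rw [← ofReal_norm] at this
    exact (ENNReal.ofReal_le_ofReal_iff (by positivity)).1 this
  have hF : ∀ ξ, 𝓕 f ξ = 𝓕 f1 ξ + 𝓕 f2 ξ := by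
    intro ξ
    conv_lhs => rw [← hsum]
    rw [Real.fourier_eq, Real.fourier_eq, Real.fourier_eq, ← integral_add]
    · simp
    · exact (Real.fourierIntegral_convergent_iff ξ).2 hf1
    · exact (Real.fourierIntegral_convergent_iff ξ).2 hf2
  calc volume {ξ | α < ‖𝓕 f ξ‖}
      ≤ volume {ξ | ENNReal.ofReal ((α / 2) ^ 2) ≤ ‖𝓕 f2 ξ‖ₑ ^ (2 : ℝ)} := by
        refine measure_mono fun ξ hξ => ?_
        have hξ : α < ‖𝓕 f ξ‖ := hξ
        have h1 : α / 2 ≤ ‖𝓕 f2 ξ‖ := by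
          have := norm_add_le (𝓕 f1 ξ) (𝓕 f2 ξ)
          rw [← hF] at this
          linarith [hsmall ξ]
        show ENNReal.ofReal ((α / 2) ^ 2) ≤ ‖𝓕 f2 ξ‖ₑ ^ (2 : ℝ)
        rw [← ofReal_norm, ENNReal.ofReal_rpow_of_nonneg (norm_nonneg _) (by norm_num)]
        refine ENNReal.ofReal_le_ofReal ?_
        rw [Real.rpow_two]
        gcongr
    _ ≤ (∫⁻ ξ, ‖𝓕 f2 ξ‖ₑ ^ (2 : ℝ)) / ENNReal.ofReal ((α / 2) ^ 2) := by
        refine meas_ge_le_lintegral_div ?_ ?_ ?_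
        · exact ((continuous_fourier_of_integrable hf2).measurable.enorm.pow_const _).aemeasurable
        · simpa using hα.ne'
        · simp
    _ = _ := by
        rw [lintegral_fourier_sq hf2 hf2', ← lintegral_indicator hS, ENNReal.div_eq_inv_mul,
          ← ENNReal.ofReal_inv_of_pos (by positivity)]
        congr 1
        · congr 1
          rw [Real.rpow_neg hα.le, Real.rpow_two]; field_simp; norm_num
        · refine lintegral_congr fun x => ?_
          by_cases hx : x ∈ S <;> simp [f2, hx]

/-- The Hausdorff–Young inequality, up to a constant. -/
theorem exists_lintegral_fourier_rpow_le {p q : ℝ} (hpq : p.HolderConjugate q)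
    (hq : 2 < q) : ∃ C : ℝ≥0, ∀ f : V → ℂ, Measurable f → Integrable f →
      ∫⁻ ξ, ‖𝓕 f ξ‖ₑ ^ q ≤ C * (∫⁻ x, ‖f x‖ₑ ^ p) ^ (q - 1) := by
  have hp0 := hpq.pos
  have hq0 := hpq.symm.pos
  have hp1 := hpq.lt
  have hpe : p = q / (q - 1) := hpq.symm.conjugate_eq
  have hpe' : p - 1 = 1 / (q - 1) := by
    rw [hpe]; field_simp [show q - 1 ≠ 0 by linarith]; ring
  have hq2 : 0 < q - 2 := by linarith
  have hq1 : 0 < q - 1 := by linarith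
  set c : ℝ := q * (4 / (q - 2)) * 2 ^ (q - 2) with hc
  have hc0 : 0 < c := by positivity
  refine ⟨Real.toNNReal c, fun f hfm hf => ?_⟩
  by_cases hNtop : ∫⁻ x, ‖f x‖ₑ ^ p = ⊤
  · rw [hNtop, ENNReal.top_rpow_of_pos (by positivity), ENNReal.mul_top]
    · exact le_top
    · simpa using hc0
  by_cases hN0 : ∫⁻ x, ‖f x‖ₑ ^ p = 0
  · rw [lintegral_eq_zero_iff (by fun_prop)] at hN0
    have h0 : f =ᵐ[volume] 0 := by
      filter_upwards [hN0] with x hx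
      simpa [hp0] using hx
    have : ∀ ξ, 𝓕 f ξ = 0 := fun ξ => by
      rw [Real.fourier_congr_ae h0, Real.fourier_eq]; simp
    simp [this, hq0]
  set N := (∫⁻ x, ‖f x‖ₑ ^ p).toReal with hN
  have hfN : ∫⁻ x, ‖f x‖ₑ ^ p = ENNReal.ofReal N := (ENNReal.ofReal_toReal hNtop).symm
  have hNpos : 0 < N := ENNReal.toReal_pos hN0 hNtop
  -- The cutting height depends on the level α and solves h^(1 - p)·N = α/2, since (q - 1)(p - 1) =
  -- 1.
  let h : ℝ → ℝ := fun α => (2 * N / α) ^ (q - 1)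
  have hhm : Measurable h := by fun_prop
  have hcont := continuous_fourier_of_integrable hf
  have hdist : ∀ α ∈ Set.Ioi (0 : ℝ), volume {ξ | α < ‖𝓕 f ξ‖} ≤
      ENNReal.ofReal (4 * α ^ (-2 : ℝ)) * ∫⁻ x in {x | ‖f x‖ ≤ h α}, ‖f x‖ₑ ^ (2 : ℝ) := by
    intro α hα
    have hα : 0 < α := hα
    refine measure_lt_norm_fourier_le hfm hf hp1 hα (by positivity) hfN.le ?_
    simp only [h]
    rw [← Real.rpow_mul (by positivity), show (q - 1) * (1 - p) = -1 by
      rw [show 1 - p = -(p - 1) by ring, hpe']; field_simp, Real.rpow_neg_one]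
    apply le_of_eq
    field_simp
  have hFE : ∫⁻ ξ, ‖𝓕 f ξ‖ₑ ^ q = ∫⁻ ξ, ENNReal.ofReal (‖𝓕 f ξ‖ ^ q) :=
    lintegral_congr fun ξ => by
      rw [← ofReal_norm, ENNReal.ofReal_rpow_of_nonneg (norm_nonneg _) hq0.le]
  rw [hFE, lintegral_rpow_eq_lintegral_meas_lt_mul volume
    (Filter.Eventually.of_forall fun ξ => norm_nonneg _) hcont.norm.aemeasurable hq0]
  have hDm : MeasurableSet {z : ℝ × V | ‖f z.2‖ ≤ h z.1} :=
    measurableSet_le (hfm.norm.comp measurable_snd) (hhm.comp measurable_fst)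
  let D : Set (ℝ × V) := {z : ℝ × V | ‖f z.2‖ ≤ h z.1}
  -- The power α^(q - 3) is the layer-cake weight α^(q - 1) times the α^(-2) of the distribution
  -- estimate; it is integrable at 0 because q > 2.
  let W : ℝ → V → ℝ≥0∞ := fun α x => ENNReal.ofReal (4 * α ^ (q - 3)) *
    D.indicator (fun z => ‖f z.2‖ₑ ^ (2 : ℝ)) (α, x)
  have hWm : Measurable (Function.uncurry W) := by
    refine Measurable.mul (by fun_prop) ?_
    refine Measurable.indicator ?_ hDm
    fun_prop
  have hWx : ∀ x, ∫⁻ α in Set.Ioi 0, W α x ≤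
      ENNReal.ofReal (4 / (q - 2) * (2 * N) ^ (q - 2)) * ‖f x‖ₑ ^ p := by
    intro x
    by_cases hx : f x = 0
    · have : ∀ α, W α x = 0 := fun α => by simp [W, Set.indicator, hx]
      simp [this]
    have hx' : 0 < ‖f x‖ := norm_pos_iff.2 hx
    -- For positive α, ‖f x‖ ≤ h α amounts to α ≤ b, so for fixed x only the levels up to b
    -- contribute.
    set b := 2 * N * ‖f x‖ ^ (1 - p) with hb
    have hb0 : 0 < b := by positivity
    calc ∫⁻ α in Set.Ioi 0, W α x ≤ ∫⁻ α in Set.Ioi 0, (Set.Ioc 0 b).indicator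
          (fun α => ENNReal.ofReal (4 * α ^ (q - 3)) * ‖f x‖ₑ ^ (2 : ℝ)) α := by
          refine setLIntegral_mono' measurableSet_Ioi fun α hα => ?_
          have hα : 0 < α := hα
          by_cases hz : ‖f x‖ ≤ h α
          · have hαb : α ∈ Set.Ioc 0 b := by
              refine ⟨hα, ?_⟩
              have h1 : ‖f x‖ ^ (p - 1) ≤ 2 * N / α := by
                rw [hpe', one_div, Real.rpow_inv_le_iff_of_pos hx'.le (by positivity) hq1]
                exact hz
              rw [le_div_iff₀ hα] at h1
              rw [hb, show 1 - p = -(p - 1) by ring, Real.rpow_neg hx'.le, ← div_eq_mul_inv,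
                le_div_iff₀ (by positivity)]
              linarith
            simp only [Set.indicator_of_mem hαb, W]
            gcongr
            exact Set.indicator_le_self _ _ (α, x)
          · have : (α, x) ∉ D := hz
            simp [W, Set.indicator_of_notMem this]
      _ ≤ ∫⁻ α in Set.Ioc 0 b, ENNReal.ofReal (4 * α ^ (q - 3)) * ‖f x‖ₑ ^ (2 : ℝ) := by
          rw [← lintegral_indicator measurableSet_Ioc]
          exact lintegral_mono' Measure.restrict_le_self le_rfl
      _ = ENNReal.ofReal (4 * (b ^ (q - 2) / (q - 2))) * ‖f x‖ₑ ^ (2 : ℝ) := by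
          rw [lintegral_mul_const _ (by fun_prop), ← ofReal_integral_eq_lintegral_ofReal,
            integral_const_mul, ← intervalIntegral.integral_of_le hb0.le,
            integral_rpow (Or.inl (by linarith))]
          · rw [show q - 3 + 1 = q - 2 by ring, Real.zero_rpow hq2.ne', sub_zero]
          · exact ((intervalIntegral.intervalIntegrable_rpow' (by linarith)).1).const_mul _
          · refine (ae_restrict_mem measurableSet_Ioc).mono fun α hα => ?_
            have : 0 < α := hα.1
            show 0 ≤ 4 * α ^ (q - 3)
            positivity
      _ = _ := by
          rw [← ofReal_norm, ENNReal.ofReal_rpow_of_nonneg hx'.le (by norm_num),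
            ENNReal.ofReal_rpow_of_nonneg hx'.le hp0.le, ← ENNReal.ofReal_mul (by positivity),
            ← ENNReal.ofReal_mul (by positivity)]
          congr 1
          rw [hb, Real.mul_rpow (by positivity) (by positivity), ← Real.rpow_mul hx'.le]
          have : ‖f x‖ ^ p = ‖f x‖ ^ ((1 - p) * (q - 2)) * ‖f x‖ ^ (2 : ℝ) := by
            rw [← Real.rpow_add hx']
            congr 1
            rw [hpe]; field_simp; ring
          rw [this]; ring
  calc _ ≤ ENNReal.ofReal q * ∫⁻ α in Set.Ioi 0, ∫⁻ x, W α x := by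
        refine mul_le_mul_right (setLIntegral_mono' measurableSet_Ioi fun α hα => ?_) _
        refine (mul_le_mul_left (hdist α hα) _).trans_eq ?_
        have hα : 0 < α := hα
        have hSα : MeasurableSet {x | ‖f x‖ ≤ h α} := measurableSet_le hfm.norm measurable_const
        simp only [W]
        rw [lintegral_const_mul' _ _ ENNReal.ofReal_ne_top, ← lintegral_indicator hSα, mul_right_comm,
          ← ENNReal.ofReal_mul (by positivity)]
        congr 2
        rw [mul_assoc, ← Real.rpow_add hα]
        ring_nf
    _ = ENNReal.ofReal q * ∫⁻ x, ∫⁻ α in Set.Ioi 0, W α x := by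
        rw [lintegral_lintegral_swap hWm.aemeasurable]
    _ ≤ ENNReal.ofReal q * ∫⁻ x, ENNReal.ofReal (4 / (q - 2) * (2 * N) ^ (q - 2)) * ‖f x‖ₑ ^ p :=
        mul_le_mul_right (lintegral_mono hWx) _
    _ = _ := by
        rw [lintegral_const_mul' _ _ (by simp), hfN,
          ENNReal.ofReal_rpow_of_nonneg hNpos.le hq1.le, ← ENNReal.ofReal_mul (by positivity),
          ← ENNReal.ofReal_mul (by positivity), ENNReal.ofNNReal_toNNReal,
          ← ENNReal.ofReal_mul hc0.le]
        congr 1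
        rw [hc, Real.mul_rpow (by norm_num) hNpos.le,
          show q - 1 = (q - 2) + 1 by ring, Real.rpow_add_one hNpos.ne']
        ring

end HausdorffYoung

/-! ### Bilinear forms with an oscillating bilinear phase. -/

section Oscillatory

open FourierTransform RealInnerProductSpace

variable {V : Type*} [NormedAddCommGroup V] [InnerProductSpace ℝ V] [FiniteDimensional ℝ V]
  [MeasurableSpace V] [BorelSpace V]

theorem enorm_circle_mul (c : Circle) (z : ℂ) : ‖(c : ℂ) * z‖ₑ = ‖z‖ₑ := by
  rw [← ofReal_norm, norm_mul, Circle.norm_coe, one_mul, ofReal_norm]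

theorem lintegral_comp_continuousLinearMap (L : V →L[ℝ] V) (hL : LinearMap.det (L : V →ₗ[ℝ] V) ≠ 0)
    {g : V → ℝ≥0∞} (hg : Measurable g) :
    ∫⁻ x, g (L x) = ENNReal.ofReal |(LinearMap.det (L : V →ₗ[ℝ] V))⁻¹| * ∫⁻ x, g x := by
  rw [← lintegral_map hg L.continuous.measurable]
  have := Measure.map_linearMap_addHaar_eq_smul_addHaar (volume : Measure V) hL
  rw [show Measure.map L volume = Measure.map (L : V →ₗ[ℝ] V) volume from rfl, this,
    lintegral_smul_measure, smul_eq_mul]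

/-- Hölder, the change of variables by L, and Hausdorff–Young. The constant must not depend on L,
because L is later replaced by ξL for every nonzero frequency ξ. -/
theorem exists_enorm_integral_mul_fourier_le (V : Type*) [NormedAddCommGroup V]
    [InnerProductSpace ℝ V] [FiniteDimensional ℝ V] [MeasurableSpace V] [BorelSpace V]
    {p q : ℝ} (hpq : p.HolderConjugate q) (hq : 2 < q) :
    ∃ C : ℝ≥0, ∀ (L : V →L[ℝ] V), LinearMap.det (L : V →ₗ[ℝ] V) ≠ 0 →
      ∀ a b : V → ℂ, Measurable a → Measurable b → Integrable a →
      ‖∫ x, b x * 𝓕 a (L x)‖ₑ ≤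
        C * ENNReal.ofReal (|LinearMap.det (L : V →ₗ[ℝ] V)| ^ (-(1 / q))) *
          ((∫⁻ x, ‖a x‖ₑ ^ p) ^ (1 / p) * (∫⁻ x, ‖b x‖ₑ ^ p) ^ (1 / p)) := by
  obtain ⟨C, hC⟩ := exists_lintegral_fourier_rpow_le (V := V) hpq hq
  have hq0 := hpq.symm.pos
  have hpe : p = q / (q - 1) := hpq.symm.conjugate_eq
  refine ⟨C ^ (1 / q), fun L hL a b ha hb hai => ?_⟩
  have hFm := (continuous_fourier_of_integrable hai).measurable
  have hd : 0 < |LinearMap.det (L : V →ₗ[ℝ] V)| := abs_pos.2 hL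
  calc ‖∫ x, b x * 𝓕 a (L x)‖ₑ ≤ ∫⁻ x, ‖b x‖ₑ * ‖𝓕 a (L x)‖ₑ := by
        refine (enorm_integral_le_lintegral_enorm _).trans_eq (lintegral_congr fun x => ?_)
        rw [enorm_mul]
    _ ≤ (∫⁻ x, ‖b x‖ₑ ^ p) ^ (1 / p) * (∫⁻ x, ‖𝓕 a (L x)‖ₑ ^ q) ^ (1 / q) :=
        ENNReal.lintegral_mul_le_Lp_mul_Lq _ hpq hb.enorm.aemeasurable
          (hFm.comp L.continuous.measurable).enorm.aemeasurable
    _ ≤ (∫⁻ x, ‖b x‖ₑ ^ p) ^ (1 / p) * (ENNReal.ofReal |(LinearMap.det (L : V →ₗ[ℝ] V))⁻¹| *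
          (C * (∫⁻ x, ‖a x‖ₑ ^ p) ^ (q - 1))) ^ (1 / q) := by
        rw [lintegral_comp_continuousLinearMap L hL (g := fun y => ‖𝓕 a y‖ₑ ^ q)
          (hFm.enorm.pow_const _)]
        gcongr
        exact hC a ha hai
    _ = _ := by
        have h0 : (0 : ℝ) ≤ 1 / q := by positivity
        rw [ENNReal.mul_rpow_of_nonneg _ _ h0, ENNReal.mul_rpow_of_nonneg _ _ h0,
          ← ENNReal.rpow_mul, ENNReal.ofReal_rpow_of_nonneg (abs_nonneg _) h0,
          ← ENNReal.coe_rpow_of_nonneg _ h0, abs_inv, Real.inv_rpow hd.le, ← Real.rpow_neg hd.le,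
          show (q - 1) * (1 / q) = 1 / p by rw [hpe]; field_simp]
        ring

/-- Bound for a bilinear oscillatory form with a cutoff that is an inverse Fourier transform. -/
theorem exists_enorm_oscillatory_form_le {p q : ℝ} (hpq : p.HolderConjugate q) (hq : 2 < q)
    {ψ : V → ℂ} (hψ : Integrable ψ) :
    ∃ C : ℝ≥0, ∀ (L : V →L[ℝ] V), LinearMap.det (L : V →ₗ[ℝ] V) ≠ 0 →
      ∀ a b : V → ℂ, Measurable a → Measurable b → Integrable a → Integrable b →
      ‖∫ z : V × V, 𝓕⁻ ψ (z.1 - z.2) * (Real.fourierChar (-⟪z.2, L z.1⟫) * (a z.2 * b z.1))‖ₑ ≤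
        C * ENNReal.ofReal (|LinearMap.det (L : V →ₗ[ℝ] V)| ^ (-(1 / q))) *
          ((∫⁻ x, ‖a x‖ₑ ^ p) ^ (1 / p) * (∫⁻ x, ‖b x‖ₑ ^ p) ^ (1 / p)) := by
  obtain ⟨C, hC⟩ := exists_enorm_integral_mul_fourier_le V hpq hq
  have hK : ∫⁻ ξ, ‖ψ ξ‖ₑ ≠ ⊤ := hψ.2.ne
  refine ⟨(∫⁻ ξ, ‖ψ ξ‖ₑ).toNNReal * C, fun L hL a b ha hb hai hbi => ?_⟩
  rw [ENNReal.coe_mul, ENNReal.coe_toNNReal hK]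
  -- The cutoff is expanded into its frequencies. Each character of z.1 - z.2 splits into a
  -- modulation of a and one of b, which leaves absolute values unchanged, so the cutoff costs only
  -- the L¹ norm of ψ.
  set Φ : V × V → V → ℂ := fun z ξ => Real.fourierChar ⟪ξ, z.1 - z.2⟫ * ψ ξ *
    (Real.fourierChar (-⟪z.2, L z.1⟫) * (a z.2 * b z.1)) with hΦ
  have hab : Integrable (fun z : V × V => a z.2 * b z.1) := by
    have := hbi.mul_prod hai (μ := volume) (ν := volume)
    exact this.congr (Filter.Eventually.of_forall fun z => mul_comm _ _)
  have hab' : Integrable (fun z : V × V => Real.fourierChar (-⟪z.2, L z.1⟫) * (a z.2 * b z.1)) := by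
    refine hab.bdd_mul (c := 1) (Continuous.aestronglyMeasurable (by fun_prop)) ?_
    exact Filter.Eventually.of_forall fun ξ => (Circle.norm_coe _).le
  have hΦi : Integrable (Function.uncurry Φ) ((volume : Measure (V × V)).prod volume) := by
    have h1 := hab'.mul_prod hψ (μ := volume) (ν := volume)
    have h2 : Integrable (fun w : (V × V) × V => (Real.fourierChar ⟪w.2, w.1.1 - w.1.2⟫ : ℂ) *
        ((Real.fourierChar (-⟪w.1.2, L w.1.1⟫) * (a w.1.2 * b w.1.1)) * ψ w.2))
        ((volume : Measure (V × V)).prod volume) := by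
      refine h1.bdd_mul (c := 1) (Continuous.aestronglyMeasurable (by fun_prop)) ?_
      exact Filter.Eventually.of_forall fun ξ => (Circle.norm_coe _).le
    refine h2.congr (Filter.Eventually.of_forall fun w => ?_)
    simp only [hΦ, Function.uncurry]
    ring
  have hslice : ∀ ξ, ‖∫ z, Φ z ξ‖ₑ ≤ ‖ψ ξ‖ₑ *
      (C * ENNReal.ofReal (|LinearMap.det (L : V →ₗ[ℝ] V)| ^ (-(1 / q))) *
          ((∫⁻ x, ‖a x‖ₑ ^ p) ^ (1 / p) * (∫⁻ x, ‖b x‖ₑ ^ p) ^ (1 / p))) := by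
    intro ξ
    let aξ : V → ℂ := fun w => Real.fourierChar (-⟪ξ, w⟫) * a w
    let bξ : V → ℂ := fun x => Real.fourierChar ⟪ξ, x⟫ * b x
    have haξ : Measurable aξ := Measurable.mul (Continuous.measurable (by fun_prop)) ha
    have hbξ : Measurable bξ := Measurable.mul (Continuous.measurable (by fun_prop)) hb
    have haξi : Integrable aξ := hai.bdd_mul (c := 1)
      (Continuous.aestronglyMeasurable (by fun_prop))
      (Filter.Eventually.of_forall fun ξ => (Circle.norm_coe _).le)
    have hbξi : Integrable bξ := hbi.bdd_mul (c := 1)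
      (Continuous.aestronglyMeasurable (by fun_prop))
      (Filter.Eventually.of_forall fun ξ => (Circle.norm_coe _).le)
    have hna : ∀ w, ‖aξ w‖ₑ = ‖a w‖ₑ := fun w => enorm_circle_mul _ _
    have hnb : ∀ w, ‖bξ w‖ₑ = ‖b w‖ₑ := fun w => enorm_circle_mul _ _
    have hprod : Integrable (fun z : V × V => Real.fourierChar (-⟪z.2, L z.1⟫) *
        (aξ z.2 * bξ z.1)) ((volume : Measure V).prod volume) := by
      have h1 : Integrable (fun z : V × V => aξ z.2 * bξ z.1) := by
        have := hbξi.mul_prod haξi (μ := volume) (ν := volume)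
        exact this.congr (Filter.Eventually.of_forall fun z => mul_comm _ _)
      refine h1.bdd_mul (c := 1) (Continuous.aestronglyMeasurable (by fun_prop)) ?_
      exact Filter.Eventually.of_forall fun ξ => (Circle.norm_coe _).le
    have e : ∫ z, Φ z ξ = ψ ξ * ∫ x, bξ x * 𝓕 aξ (L x) := by
      have e1 : ∀ z, Φ z ξ = ψ ξ * (Real.fourierChar (-⟪z.2, L z.1⟫) * (aξ z.2 * bξ z.1)) := by
        intro z
        simp only [hΦ, aξ, bξ]
        rw [inner_sub_right, sub_eq_add_neg, AddChar.map_add_eq_mul, Circle.coe_mul]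
        ring
      simp_rw [e1]
      rw [integral_const_mul]
      congr 1
      rw [Measure.volume_eq_prod, integral_prod _ hprod]
      congr 1
      ext x
      rw [Real.fourier_eq, ← integral_const_mul]
      congr 1
      ext w
      rw [Circle.smul_def, smul_eq_mul]
      ring
    rw [e, enorm_mul]
    refine mul_le_mul_right ((hC L hL aξ bξ haξ hbξ haξi).trans_eq ?_) _
    simp_rw [hna, hnb]
  have hmain : ∫ z : V × V, 𝓕⁻ ψ (z.1 - z.2) * (Real.fourierChar (-⟪z.2, L z.1⟫) *
      (a z.2 * b z.1)) = ∫ ξ, ∫ z, Φ z ξ := by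
    rw [← integral_integral_swap hΦi]
    congr 1
    ext z
    rw [Real.fourierInv_eq, ← integral_mul_const]
    rfl
  rw [hmain]
  refine (enorm_integral_le_lintegral_enorm _).trans ((lintegral_mono hslice).trans_eq ?_)
  rw [lintegral_mul_const'' _ hψ.1.enorm]
  ring

end Oscillatory

/-! ### The bilinear form of the convolution operator, frequency by frequency in the central
variable. -/

section BilinearForm

open FourierTransform RealInnerProductSpace

theorem measurable_fourier_slice {V : Type*} [MeasurableSpace V] {f : V → ℝ → ℂ}
    (hf : Measurable (Function.uncurry f)) :
    Measurable (fun z : V × ℝ => 𝓕 (f z.1) z.2) := by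
  have h : Measurable (fun w : (V × ℝ) × ℝ =>
      (Real.fourierChar (-(w.2 * w.1.2)) : ℂ) * f w.1.1 w.2) := by
    refine Measurable.mul ?_ ?_
    · have : Continuous (fun t : ℝ => (Real.fourierChar t : ℂ)) := by fun_prop
      exact this.measurable.comp (by fun_prop)
    · exact hf.comp (by fun_prop : Measurable fun w : (V × ℝ) × ℝ => (w.1.1, w.2))
  have := (h.stronglyMeasurable.integral_prod_right' (ν := (volume : Measure ℝ))).measurable
  convert! this using 2 with z
  rw [Real.fourier_real_eq]
  rfl

theorem fourier_comp_sub_right (f : ℝ → ℂ) (c ξ : ℝ) :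
    𝓕 (fun s => f (s - c)) ξ = Real.fourierChar (-(c * ξ)) * 𝓕 f ξ := by
  rw [Real.fourier_real_eq, Real.fourier_real_eq, ← integral_const_mul,
    ← integral_sub_right_eq_self (fun s => (Real.fourierChar (-(c * ξ)) : ℂ) *
      Real.fourierChar (-(s * ξ)) • f s) c]
  congr 1
  ext s
  rw [Circle.smul_def, Circle.smul_def, smul_eq_mul, smul_eq_mul, ← mul_assoc, ← Circle.coe_mul,
    ← AddChar.map_add_eq_mul]
  ring_nf

/-- A mixed-norm weighted bound for the partial Fourier transform in the last variable. -/
theorem exists_lintegral_weight_mul_fourier_slice_le {p q : ℝ} (hpq : p.HolderConjugate q)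
    (hq : 2 < q) : ∃ C : ℝ≥0, ∀ {V : Type*} [MeasurableSpace V] (μ : Measure V) [SFinite μ]
      (f : V → ℝ → ℂ), Measurable (Function.uncurry f) → (∀ w, Integrable (f w)) →
      ∫⁻ ξ, ENNReal.ofReal (|ξ| ^ (-(1 - 2 / q))) * (∫⁻ w, ‖𝓕 (f w) ξ‖ₑ ^ p ∂μ) ^ (2 / p) ≤
        C * (∫⁻ w, (∫⁻ s, ‖f w s‖ₑ ^ p) ∂μ) ^ (2 / p) := by
  obtain ⟨C, hC⟩ := exists_lintegral_weight_mul_fourier_sq_le hpq hq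
  have hp0 := hpq.pos
  have hpe : p = q / (q - 1) := hpq.symm.conjugate_eq
  have hp2 : 1 < 2 / p := by
    rw [lt_div_iff₀ hp0, hpe, one_mul, div_lt_iff₀ (by linarith)]; linarith
  refine ⟨C, fun {V} _ μ _ f hfm hfi => ?_⟩
  let wt : ℝ → ℝ≥0∞ := fun ξ => ENNReal.ofReal (|ξ| ^ (-(1 - 2 / q)))
  have hwt : Measurable wt := by fun_prop
  have hF := measurable_fourier_slice hfm
  have hF' : Measurable (fun z : V × ℝ => ‖𝓕 (f z.1) z.2‖ₑ ^ p) := hF.enorm.pow_const p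
  -- Minkowski with exponent 2/p > 1 for the weighted measure in ξ puts the integral over w
  -- outermost; the one-dimensional inequality then applies to each slice.
  have hmk := lintegral_lintegral_rpow_le (μ := μ) (ν := volume.withDensity wt) hp2
    (H := fun w ξ => ‖𝓕 (f w) ξ‖ₑ ^ p) hF'
  have hint : Measurable fun ξ => (∫⁻ w, ‖𝓕 (f w) ξ‖ₑ ^ p ∂μ) ^ (2 / p) :=
    (hF'.comp measurable_swap).lintegral_prod_right'.pow_const _
  rw [lintegral_withDensity_eq_lintegral_mul _ hwt hint] at hmk
  refine hmk.trans ?_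
  have hslice : ∀ w, (∫⁻ ξ, (‖𝓕 (f w) ξ‖ₑ ^ p) ^ (2 / p) ∂(volume.withDensity wt)) ^ (1 / (2 / p)) ≤
      C ^ (p / 2) * ∫⁻ s, ‖f w s‖ₑ ^ p := by
    intro w
    have hint' : Measurable fun ξ => (‖𝓕 (f w) ξ‖ₑ ^ p) ^ (2 / p) :=
      (hF'.comp (measurable_const.prodMk measurable_id)).pow_const _
    rw [lintegral_withDensity_eq_lintegral_mul _ hwt hint']
    have e : ∀ ξ, (‖𝓕 (f w) ξ‖ₑ ^ p) ^ (2 / p) = ‖𝓕 (f w) ξ‖ₑ ^ (2 : ℝ) := fun ξ => by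
      rw [← ENNReal.rpow_mul]; congr 1; field_simp
    simp only [Pi.mul_apply, e]
    rw [one_div_div]
    refine (ENNReal.rpow_le_rpow (hC (f w)
      (hfm.comp (measurable_const.prodMk measurable_id)) (hfi w)) (by positivity)).trans_eq ?_
    rw [ENNReal.mul_rpow_of_nonneg _ _ (by positivity), ← ENNReal.rpow_mul,
      show 2 / p * (p / 2) = 1 by field_simp, ENNReal.rpow_one]
  refine (ENNReal.rpow_le_rpow (lintegral_mono hslice) (by positivity)).trans_eq ?_
  rw [lintegral_const_mul' _ _ (ENNReal.rpow_ne_top_of_nonneg (by positivity) (by simp)),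
    ENNReal.mul_rpow_of_nonneg _ _ (by positivity), ← ENNReal.rpow_mul,
    show p / 2 * (2 / p) = 1 by field_simp, ENNReal.rpow_one]

/-- Parseval's identity for a translate of one factor. -/
theorem integral_mul_translate_eq {f g : ℝ → ℝ}
    (hfi : Integrable f) (hgi : Integrable g) {K : ℝ} (hfK : ∀ s, |f s| ≤ K) (hgK : ∀ s, |g s| ≤ K)
    (c : ℝ) :
    ((∫ t, f (t - c) * g t : ℝ) : ℂ) =
      ∫ ξ, starRingEnd ℂ (𝓕 (fun s => (g s : ℂ)) ξ) *
        (Real.fourierChar (-(c * ξ)) * 𝓕 (fun s => (f s : ℂ)) ξ) := by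
  have hf1 : Integrable fun s => ((f (s - c) : ℝ) : ℂ) := (hfi.comp_sub_right c).ofReal
  have hg1 : Integrable fun s => (g s : ℂ) := hgi.ofReal
  have := integral_conj_fourier_mul_fourier hg1
    (memLp_two_of_bound hg1 (K := K) (by simpa using hgK)) hf1
    (memLp_two_of_bound hf1 (K := K) fun s => by simpa using hfK (s - c))
  simp_rw [fourier_comp_sub_right (fun s => (f s : ℂ)) c] at this
  rw [this, ← integral_complex_ofReal]
  congr 1
  ext t
  push_cast
  rw [Complex.conj_ofReal, mul_comm]

variable {V : Type*} [NormedAddCommGroup V] [MeasurableSpace V]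

/-- Bounded nonnegative measurable functions with bounded support. -/
structure IsTestFunction (R K : ℝ) (f : V × ℝ → ℝ) : Prop where
  measurable : Measurable f
  nonneg : ∀ z, 0 ≤ f z
  le : ∀ z, f z ≤ K
  support : ∀ z, R < ‖z‖ → f z = 0

/-- The Fourier transform in the last variable. -/
@[irreducible] def partialFourier (f : V × ℝ → ℝ) (w : V) (ξ : ℝ) : ℂ := 𝓕 (fun s => (f (w, s) : ℂ)) ξ

namespace IsTestFunction

variable {R K : ℝ} {f : V × ℝ → ℝ}

theorem measurable_slice (hf : IsTestFunction R K f) (w : V) : Measurable fun s => f (w, s) :=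
  hf.measurable.comp (measurable_const.prodMk measurable_id)

theorem abs_le (hf : IsTestFunction R K f) (z : V × ℝ) : |f z| ≤ K := by
  rw [abs_of_nonneg (hf.nonneg z)]; exact hf.le z

theorem integrable_slice (hf : IsTestFunction R K f) (w : V) : Integrable fun s => f (w, s) := by
  have h1 : IntegrableOn (fun s => f (w, s)) (Metric.closedBall (0 : ℝ) R) :=
    Measure.integrableOn_of_bounded (M := K) measure_closedBall_lt_top.ne
      (hf.measurable_slice w).aestronglyMeasurable
      (Filter.Eventually.of_forall fun s => hf.abs_le _)
  refine (integrableOn_iff_integrable_of_support_subset fun s hs => ?_).1 h1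
  rw [mem_closedBall_zero_iff]
  by_contra h
  push Not at h
  exact hs (hf.support _ (h.trans_le (by simp)))

theorem integrable_slice_complex (hf : IsTestFunction R K f) (w : V) :
    Integrable fun s => (f (w, s) : ℂ) := (hf.integrable_slice w).ofReal

theorem slice_eq_zero (hf : IsTestFunction R K f) {w : V} (hw : R < ‖w‖) (s : ℝ) :
    f (w, s) = 0 := hf.support _ (hw.trans_le (by simp))

theorem fourier_slice_eq_zero (hf : IsTestFunction R K f) {w : V} (hw : R < ‖w‖) (ξ : ℝ) :
    partialFourier f w ξ = 0 := by
  rw [partialFourier, Real.fourier_eq]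
  simp [hf.slice_eq_zero hw]

theorem lintegral_slice_sq_le (hf : IsTestFunction R K f) (w : V) :
    ∫⁻ s, ‖(f (w, s) : ℂ)‖ₑ ^ (2 : ℝ) ≤
      ENNReal.ofReal K ^ (2 : ℝ) * volume (Metric.closedBall (0 : ℝ) R) := by
  rw [← lintegral_indicator_const Metric.isClosed_closedBall.measurableSet]
  refine lintegral_mono fun s => ?_
  by_cases hs : s ∈ Metric.closedBall (0 : ℝ) R
  · rw [Set.indicator_of_mem hs, ← ofReal_norm, Complex.norm_real]
    gcongr
    exact hf.abs_le _
  · rw [mem_closedBall_zero_iff, not_le] at hs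
    have : f (w, s) = 0 := hf.support _ (hs.trans_le (by simp))
    simp [this]

theorem lintegral_fourier_slice_sq_le (hf : IsTestFunction R K f) (w : V) :
    ∫⁻ ξ, ‖partialFourier f w ξ‖ₑ ^ (2 : ℝ) ≤
      ENNReal.ofReal K ^ (2 : ℝ) * volume (Metric.closedBall (0 : ℝ) R) := by
  simp only [partialFourier]
  rw [lintegral_fourier_sq (hf.integrable_slice_complex w) (memLp_two_of_bound
    (hf.integrable_slice_complex w) (K := K) fun s => by simpa using hf.abs_le _)]
  exact hf.lintegral_slice_sq_le w

theorem measurable_fourier (hf : IsTestFunction R K f) :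
    Measurable fun z : V × ℝ => partialFourier f z.1 z.2 := by
  simp only [partialFourier]
  exact measurable_fourier_slice (f := fun w s => (f (w, s) : ℂ))
    (Complex.measurable_ofReal.comp hf.measurable)

theorem enorm_partialFourier_le (hf : IsTestFunction R K f) (w : V) (ξ : ℝ) :
    ‖partialFourier f w ξ‖ₑ ≤ ENNReal.ofReal K * volume (Metric.closedBall (0 : ℝ) R) := by
  rw [partialFourier]
  refine (enorm_fourier_le_lintegral _ _).trans ?_
  rw [← lintegral_indicator_const Metric.isClosed_closedBall.measurableSet]
  refine lintegral_mono fun s => ?_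
  by_cases hs : s ∈ Metric.closedBall (0 : ℝ) R
  · rw [Set.indicator_of_mem hs, ← ofReal_norm, Complex.norm_real]
    gcongr
    exact hf.abs_le _
  · rw [mem_closedBall_zero_iff, not_le] at hs
    have : f (w, s) = 0 := hf.support _ (hs.trans_le (by simp))
    simp [this]

variable [InnerProductSpace ℝ V] [FiniteDimensional ℝ V] [BorelSpace V]

theorem integrable_partialFourier (hf : IsTestFunction R K f) (ξ : ℝ) :
    Integrable fun w => partialFourier f w ξ := by
  have hm : Measurable fun w => partialFourier f w ξ :=
    hf.measurable_fourier.comp (measurable_id.prodMk measurable_const)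
  have hfin : ENNReal.ofReal K * volume (Metric.closedBall (0 : ℝ) R) ≠ ⊤ :=
    ENNReal.mul_ne_top (by simp) measure_closedBall_lt_top.ne
  have h1 : IntegrableOn (fun w => partialFourier f w ξ) (Metric.closedBall (0 : V) R) := by
    refine IntegrableOn.of_bound measure_closedBall_lt_top hm.aestronglyMeasurable
      (ENNReal.ofReal K * volume (Metric.closedBall (0 : ℝ) R)).toReal
      (Filter.Eventually.of_forall fun w => ?_)
    rw [← ENNReal.ofReal_le_iff_le_toReal hfin, ofReal_norm]
    exact hf.enorm_partialFourier_le w ξ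
  refine (integrableOn_iff_integrable_of_support_subset fun w hw => ?_).1 h1
  rw [mem_closedBall_zero_iff]
  by_contra h
  push Not at h
  exact hw (hf.fourier_slice_eq_zero h ξ)

theorem lintegral_enorm_rpow (hf : IsTestFunction R K f) {p : ℝ} :
    ∫⁻ w, ∫⁻ s, ‖(f (w, s) : ℂ)‖ₑ ^ p = ∫⁻ z, ENNReal.ofReal (f z) ^ p := by
  rw [Measure.volume_eq_prod, lintegral_prod _ (by have := hf.measurable; fun_prop)]
  refine lintegral_congr fun w => lintegral_congr fun s => ?_
  rw [← ofReal_norm, Complex.norm_real, Real.norm_of_nonneg (hf.nonneg _)]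

end IsTestFunction

variable [InnerProductSpace ℝ V] [FiniteDimensional ℝ V] [BorelSpace V]

/-- Parseval in t turns the shift by the phase into a character. At frequency ξ the terms u and v
are absorbed as modulations and the oscillatory bound is applied to ξL, which produces |ξ|^(-d/q)
with d the dimension of V. The hypothesis `hd` makes this the weight |ξ|^(-(1 - 2/q)) that
Hardy–Littlewood–Sobolev can integrate. -/
theorem exists_lintegral_form_le {p q : ℝ} (hpq : p.HolderConjugate q) (hq : 2 < q)
    (hd : (Module.finrank ℝ V : ℝ) / q = 1 - 2 / q) {χ : V → ℝ} (hχm : Continuous χ)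
    (hχ : ∀ v, χ v ∈ Set.Icc (0 : ℝ) 1) {ψ : V → ℂ} (hψ : Integrable ψ)
    (hψχ : ∀ v, 𝓕⁻ ψ v = χ v) {u v : V → ℝ} (hu : Continuous u) (hv : Continuous v)
    (L : V →L[ℝ] V) (hL : LinearMap.det (L : V →ₗ[ℝ] V) ≠ 0) :
    ∃ C : ℝ≥0, ∀ (R K : ℝ) (f g : V × ℝ → ℝ), IsTestFunction R K f → IsTestFunction R K g →
      ∫⁻ z : V × V, ENNReal.ofReal (χ (z.1 - z.2) *
        ∫ t, f (z.2, t - (u z.1 + v z.2 + ⟪z.2, L z.1⟫)) * g (z.1, t)) ≤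
      C * ((∫⁻ z, ENNReal.ofReal (f z) ^ p) ^ (1 / p) *
        (∫⁻ z, ENNReal.ofReal (g z) ^ p) ^ (1 / p)) := by
  obtain ⟨C1, hC1⟩ := exists_enorm_oscillatory_form_le hpq hq hψ
  obtain ⟨C2, hC2⟩ := exists_lintegral_weight_mul_fourier_slice_le hpq hq
  have hp0 := hpq.pos
  have hq0 := hpq.symm.pos
  set δ : ℝ := |LinearMap.det (L : V →ₗ[ℝ] V)| with hδ
  have hδ0 : 0 < δ := abs_pos.2 hL
  refine ⟨C1 * Real.toNNReal (δ ^ (-(1 / q))) * C2, fun R K f g hf hg => ?_⟩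
  let S : V × V → ℝ := fun z => u z.1 + v z.2 + ⟪z.2, L z.1⟫
  have hS : Continuous S := by fun_prop
  let F : V → ℝ → ℂ := partialFourier f
  let G : V → ℝ → ℂ := partialFourier g
  have hF : Measurable fun z : V × ℝ => F z.1 z.2 := hf.measurable_fourier
  have hG : Measurable fun z : V × ℝ => G z.1 z.2 := hg.measurable_fourier
  let Ψ : V × V → ℝ → ℂ := fun z ξ => (χ (z.1 - z.2) : ℂ) *
    (starRingEnd ℂ (G z.1 ξ) * (Real.fourierChar (-(S z * ξ)) * F z.2 ξ))
  have hΨm : Measurable (Function.uncurry Ψ) := by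
    have m1 : Measurable fun w : (V × V) × ℝ => (χ (w.1.1 - w.1.2) : ℂ) :=
      (Continuous.measurable (by fun_prop))
    have m2 : Measurable fun w : (V × V) × ℝ => starRingEnd ℂ (G w.1.1 w.2) :=
      Complex.continuous_conj.measurable.comp
        (hG.comp (by fun_prop : Measurable fun w : (V × V) × ℝ => (w.1.1, w.2)))
    have m3 : Measurable fun w : (V × V) × ℝ => (Real.fourierChar (-(S w.1 * w.2)) : ℂ) :=
      (Continuous.measurable (by fun_prop))
    have m4 : Measurable fun w : (V × V) × ℝ => F w.1.2 w.2 :=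
      hF.comp (by fun_prop : Measurable fun w : (V × V) × ℝ => (w.1.2, w.2))
    exact m1.mul (m2.mul (m3.mul m4))
  have hΨle : ∀ z ξ, ‖Ψ z ξ‖ₑ ≤ ‖G z.1 ξ‖ₑ * ‖F z.2 ξ‖ₑ := by
    intro z ξ
    have hχ1 : ‖(χ (z.1 - z.2) : ℂ)‖ₑ ≤ 1 := by
      rw [← ofReal_norm, Complex.norm_real, Real.norm_of_nonneg (hχ _).1]
      exact ENNReal.ofReal_le_one.2 (hχ _).2
    simp only [Ψ]
    rw [enorm_mul, enorm_mul, enorm_circle_mul, RCLike.enorm_conj]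
    exact mul_le_of_le_one_left zero_le hχ1
  set c : ℝ≥0∞ := ENNReal.ofReal K ^ (2 : ℝ) * volume (Metric.closedBall (0 : ℝ) R) with hc
  have hcfin : c ≠ ⊤ := ENNReal.mul_ne_top
    (ENNReal.rpow_ne_top_of_nonneg (by norm_num) (by simp)) measure_closedBall_lt_top.ne
  -- This justifies Fubini: for each z, Cauchy–Schwarz and Plancherel in ξ give a bound independent
  -- of z, and Ψ vanishes for z outside a ball.
  have hΨi : Integrable (Function.uncurry Ψ) ((volume : Measure (V × V)).prod volume) := by
    refine ⟨hΨm.aestronglyMeasurable, ?_⟩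
    rw [HasFiniteIntegral, lintegral_prod _ hΨm.enorm.aemeasurable]
    have hle : ∀ z, ∫⁻ ξ, ‖Function.uncurry Ψ (z, ξ)‖ₑ ≤
        (Metric.closedBall (0 : V × V) R).indicator (fun _ => c) z := by
      intro z
      by_cases hz : z ∈ Metric.closedBall (0 : V × V) R
      · rw [Set.indicator_of_mem hz]
        have h2 : (2 : ℝ).HolderConjugate 2 := Real.HolderConjugate.two_two
        calc ∫⁻ ξ, ‖Function.uncurry Ψ (z, ξ)‖ₑ ≤ ∫⁻ ξ, ‖G z.1 ξ‖ₑ * ‖F z.2 ξ‖ₑ :=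
              lintegral_mono fun ξ => hΨle z ξ
          _ ≤ (∫⁻ ξ, ‖G z.1 ξ‖ₑ ^ (2 : ℝ)) ^ (1 / (2 : ℝ)) *
              (∫⁻ ξ, ‖F z.2 ξ‖ₑ ^ (2 : ℝ)) ^ (1 / (2 : ℝ)) :=
              ENNReal.lintegral_mul_le_Lp_mul_Lq _ h2
                (hG.comp (measurable_const.prodMk measurable_id)).enorm.aemeasurable
                (hF.comp (measurable_const.prodMk measurable_id)).enorm.aemeasurable
          _ ≤ c ^ (1 / (2 : ℝ)) * c ^ (1 / (2 : ℝ)) := by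
              gcongr
              · exact hg.lintegral_fourier_slice_sq_le z.1
              · exact hf.lintegral_fourier_slice_sq_le z.2
          _ = c := by
              rw [← ENNReal.rpow_add_of_nonneg _ _ (by norm_num) (by norm_num)]; norm_num
      · rw [Set.indicator_of_notMem hz]
        rw [mem_closedBall_zero_iff, not_le, Prod.norm_def, lt_max_iff] at hz
        have h0 : ∀ ξ, ‖Function.uncurry Ψ (z, ξ)‖ₑ = 0 := by
          intro ξ
          refine le_antisymm ((hΨle z ξ).trans_eq ?_) zero_le
          rcases hz with hz | hz
          · rw [show G z.1 ξ = 0 from hg.fourier_slice_eq_zero hz ξ]; simp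
          · rw [show F z.2 ξ = 0 from hf.fourier_slice_eq_zero hz ξ]; simp
        exact (lintegral_congr h0).trans lintegral_zero |>.le
    refine (lintegral_mono hle).trans_lt ?_
    rw [lintegral_indicator_const Metric.isClosed_closedBall.measurableSet]
    exact ENNReal.mul_lt_top hcfin.lt_top measure_closedBall_lt_top
  let Θ : V × V → ℝ := fun z => χ (z.1 - z.2) * ∫ t, f (z.2, t - S z) * g (z.1, t)
  have hΘ0 : ∀ z, 0 ≤ Θ z := fun z =>
    mul_nonneg (hχ _).1 (integral_nonneg fun t => mul_nonneg (hf.nonneg _) (hg.nonneg _))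
  have hΘΨ : ∀ z, (Θ z : ℂ) = ∫ ξ, Ψ z ξ := by
    intro z
    simp only [Θ, Ψ, F, G, partialFourier]
    rw [integral_const_mul, Complex.ofReal_mul]
    congr 1
    exact integral_mul_translate_eq (f := fun s => f (z.2, s)) (g := fun s => g (z.1, s))
      (hf.integrable_slice _) (hg.integrable_slice _)
      (fun s => hf.abs_le _) (fun s => hg.abs_le _) (S z)
  have hΘi : Integrable Θ := by
    have h1 : Integrable fun z => (Θ z : ℂ) := by
      simp_rw [hΘΨ]
      exact hΨi.integral_prod_left
    exact h1.re
  set A : ℝ≥0∞ := (∫⁻ z, ENNReal.ofReal (f z) ^ p) with hA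
  set B : ℝ≥0∞ := (∫⁻ z, ENNReal.ofReal (g z) ^ p) with hB
  let wt : ℝ → ℝ≥0∞ := fun ξ => ENNReal.ofReal (|ξ| ^ (-(1 - 2 / q)))
  have hwt : Measurable wt := by fun_prop
  let NF : ℝ → ℝ≥0∞ := fun ξ => ∫⁻ w, ‖F w ξ‖ₑ ^ p
  let NG : ℝ → ℝ≥0∞ := fun ξ => ∫⁻ w, ‖G w ξ‖ₑ ^ p
  have hNF : Measurable NF :=
    Measurable.lintegral_prod_right' ((hF.enorm.pow_const p).comp measurable_swap)
  have hNG : Measurable NG :=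
    Measurable.lintegral_prod_right' ((hG.enorm.pow_const p).comp measurable_swap)
  have hslice : ∀ ξ, ξ ≠ 0 → ‖∫ z, Ψ z ξ‖ₑ ≤ C1 * ENNReal.ofReal (δ ^ (-(1 / q))) *
      (wt ξ * (NF ξ ^ (1 / p) * NG ξ ^ (1 / p))) := by
    intro ξ hξ
    have hdet : LinearMap.det ((ξ • L : V →L[ℝ] V) : V →ₗ[ℝ] V) =
        ξ ^ Module.finrank ℝ V * LinearMap.det (L : V →ₗ[ℝ] V) := by
      rw [← LinearMap.det_smul]; rfl
    have hdet0 : LinearMap.det ((ξ • L : V →L[ℝ] V) : V →ₗ[ℝ] V) ≠ 0 := by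
      rw [hdet]; exact mul_ne_zero (pow_ne_zero _ hξ) hL
    have hFξ : Measurable fun w => F w ξ := hF.comp (measurable_id.prodMk measurable_const)
    have hGξ : Measurable fun w => G w ξ := hG.comp (measurable_id.prodMk measurable_const)
    have hcu : Continuous fun x => (Real.fourierChar (-(u x * ξ)) : ℂ) := by fun_prop
    have hcv : Continuous fun x => (Real.fourierChar (-(v x * ξ)) : ℂ) := by fun_prop
    have key := hC1 (ξ • L) hdet0 (fun w => Real.fourierChar (-(v w * ξ)) * F w ξ)
      (fun x => Real.fourierChar (-(u x * ξ)) * starRingEnd ℂ (G x ξ))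
      (hcv.measurable.mul hFξ)
      (hcu.measurable.mul (Complex.continuous_conj.measurable.comp hGξ))
      ((hf.integrable_partialFourier ξ).bdd_mul (c := 1) hcv.aestronglyMeasurable
        (Filter.Eventually.of_forall fun _ => (Circle.norm_coe _).le))
      (Integrable.bdd_mul (c := 1)
        ((hg.integrable_partialFourier ξ).congr' (g := fun x => starRingEnd ℂ (G x ξ))
          (Complex.continuous_conj.measurable.comp hGξ).aestronglyMeasurable
          (Filter.Eventually.of_forall fun _ => (RCLike.norm_conj _).symm))
        hcu.aestronglyMeasurable
        (Filter.Eventually.of_forall fun _ => (Circle.norm_coe _).le))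
    have e1 : ∀ z : V × V, 𝓕⁻ ψ (z.1 - z.2) * (Real.fourierChar (-⟪z.2, (ξ • L) z.1⟫) *
        (Real.fourierChar (-(v z.2 * ξ)) * F z.2 ξ *
          (Real.fourierChar (-(u z.1 * ξ)) * starRingEnd ℂ (G z.1 ξ)))) = Ψ z ξ := by
      intro z
      have e2 : Real.fourierChar (-(S z * ξ)) = Real.fourierChar (-(u z.1 * ξ)) *
          Real.fourierChar (-(v z.2 * ξ)) * Real.fourierChar (-⟪z.2, (ξ • L) z.1⟫) := by
        rw [← AddChar.map_add_eq_mul, ← AddChar.map_add_eq_mul]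
        congr 1
        simp only [S, _root_.smul_apply, inner_smul_right]
        ring
      simp only [Ψ]
      rw [hψχ, e2]
      push_cast
      ring
    simp_rw [e1, enorm_circle_mul, RCLike.enorm_conj] at key
    refine key.trans_eq ?_
    rw [hdet, abs_mul, abs_pow, Real.mul_rpow (by positivity) hδ0.le, ← Real.rpow_natCast,
      ← Real.rpow_mul (abs_nonneg _), ENNReal.ofReal_mul (by positivity)]
    have : (Module.finrank ℝ V : ℝ) * -(1 / q) = -(1 - 2 / q) := by rw [← hd]; ring
    rw [this]
    simp only [NF, NG, wt]
    ring
  have hNFle : ∫⁻ ξ, wt ξ * NF ξ ^ (2 / p) ≤ C2 * A ^ (2 / p) := by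
    have := hC2 (volume : Measure V) (fun w s => (f (w, s) : ℂ))
      (Complex.measurable_ofReal.comp hf.measurable) hf.integrable_slice_complex
    rw [hf.lintegral_enorm_rpow] at this
    simpa only [NF, F, partialFourier] using this
  have hNGle : ∫⁻ ξ, wt ξ * NG ξ ^ (2 / p) ≤ C2 * B ^ (2 / p) := by
    have := hC2 (volume : Measure V) (fun w s => (g (w, s) : ℂ))
      (Complex.measurable_ofReal.comp hg.measurable) hg.integrable_slice_complex
    rw [hg.lintegral_enorm_rpow] at this
    simpa only [NG, G, partialFourier] using this
  have hroot : ∀ X : ℝ≥0∞, (X ^ (2 / p)) ^ (1 / 2 : ℝ) = X ^ (1 / p) := fun X => by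
    rw [← ENNReal.rpow_mul]; congr 1; field_simp
  calc ∫⁻ z, ENNReal.ofReal (Θ z) = ‖∫ z, (Θ z : ℂ)‖ₑ := by
        rw [integral_complex_ofReal, ← ofReal_norm, Complex.norm_real,
          Real.norm_of_nonneg (integral_nonneg hΘ0),
          ofReal_integral_eq_lintegral_ofReal hΘi (Filter.Eventually.of_forall hΘ0)]
    _ = ‖∫ ξ, ∫ z, Ψ z ξ‖ₑ := by
        simp_rw [hΘΨ]
        rw [integral_integral_swap hΨi]
    _ ≤ ∫⁻ ξ, ‖∫ z, Ψ z ξ‖ₑ := enorm_integral_le_lintegral_enorm _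
    _ ≤ ∫⁻ ξ, C1 * ENNReal.ofReal (δ ^ (-(1 / q))) * (wt ξ * (NF ξ ^ (1 / p) * NG ξ ^ (1 / p))) := by
        refine lintegral_mono_ae ?_
        filter_upwards [Measure.ae_ne volume (0 : ℝ)] with ξ hξ using hslice ξ hξ
    -- Half of the weight goes to each factor, in preparation for Cauchy–Schwarz in ξ.
    _ = C1 * ENNReal.ofReal (δ ^ (-(1 / q))) *
          ∫⁻ ξ, (wt ξ * NF ξ ^ (2 / p)) ^ (1 / 2 : ℝ) * (wt ξ * NG ξ ^ (2 / p)) ^ (1 / 2 : ℝ) := by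
        rw [lintegral_const_mul' _ _ (ENNReal.mul_ne_top (by simp) (by simp))]
        congr 1
        refine lintegral_congr fun ξ => ?_
        rw [ENNReal.mul_rpow_of_nonneg _ _ (by norm_num), ENNReal.mul_rpow_of_nonneg _ _ (by norm_num),
          hroot, hroot]
        have : wt ξ = wt ξ ^ (1 / 2 : ℝ) * wt ξ ^ (1 / 2 : ℝ) := by
          rw [← ENNReal.rpow_add_of_nonneg _ _ (by norm_num) (by norm_num)]; norm_num
        conv_lhs => rw [this]
        ring
    _ ≤ C1 * ENNReal.ofReal (δ ^ (-(1 / q))) * ((C2 * A ^ (2 / p)) ^ (1 / 2 : ℝ) *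
          (C2 * B ^ (2 / p)) ^ (1 / 2 : ℝ)) := by
        gcongr
        refine (ENNReal.lintegral_mul_norm_pow_le (hwt.mul (hNF.pow_const _)).aemeasurable
          (hwt.mul (hNG.pow_const _)).aemeasurable (by norm_num) (by norm_num) (by norm_num)).trans ?_
        exact mul_le_mul' (ENNReal.rpow_le_rpow hNFle (by norm_num))
          (ENNReal.rpow_le_rpow hNGle (by norm_num))
    _ = _ := by
        rw [ENNReal.mul_rpow_of_nonneg _ _ (by norm_num), ENNReal.mul_rpow_of_nonneg _ _ (by norm_num),
          hroot, hroot]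
        have : (C2 : ℝ≥0∞) = (C2 : ℝ≥0∞) ^ (1 / 2 : ℝ) * (C2 : ℝ≥0∞) ^ (1 / 2 : ℝ) := by
          rw [← ENNReal.rpow_add_of_nonneg _ _ (by norm_num) (by norm_num)]; norm_num
        push_cast
        conv_rhs => rw [this]
        rw [ENNReal.ofReal]
        ring

end BilinearForm

/-! ### The endpoint estimate for convolution with `nuZero` on the Heisenberg group. -/

section Heisenberg

open FourierTransform RealInnerProductSpace

variable {n : ℕ}

theorem measurable_heis_mul_inv : Measurable fun z : Heis n × Heis n => z.1 * z.2⁻¹ := by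
  simp only [Heis.mul_def, Heis.inv_def]
  have : Continuous fun z : Heis n × Heis n => symplForm z.1.1 (-z.2.1) := by
    simp only [symplForm, dotProduct, mulVec]
    fun_prop
  exact (Continuous.measurable (by fun_prop))

theorem continuous_quadPhi (A : Matrix (Fin n ⊕ Fin n) (Fin n ⊕ Fin n) ℝ) :
    Continuous (quadPhi A) := by
  show Continuous fun y : R2n n => ∑ i, y.ofLp i * ∑ j, A i j * y.ofLp j
  fun_prop

/-- Right convolution of a nonnegative function by a measure. -/
def lconv (μ : Measure (Heis n)) (F : Heis n → ℝ≥0∞) (x : Heis n) : ℝ≥0∞ :=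
  ∫⁻ y, F (x * y⁻¹) ∂μ

theorem measurable_lconv (μ : Measure (Heis n)) [SFinite μ] {F : Heis n → ℝ≥0∞}
    (hF : Measurable F) : Measurable (lconv μ F) :=
  (hF.comp measurable_heis_mul_inv).lintegral_prod_right'

/-- The phase of the kernel of convolution with `nuZero`. -/
def heisPhase (A : Matrix (Fin n ⊕ Fin n) (Fin n ⊕ Fin n) ℝ) (x w : R2n n) : ℝ :=
  quadPhi A (x - w) - symplForm x w

/-- The linear map giving the mixed part of the phase. -/
def mixedMap (A : Matrix (Fin n ⊕ Fin n) (Fin n ⊕ Fin n) ℝ) : R2n n →L[ℝ] R2n n :=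
  (Matrix.toLpLin 2 2 (-((2 : ℝ) • A + symplJ n)ᵀ)).toContinuousLinearMap

theorem det_mixedMap_ne_zero {A : Matrix (Fin n ⊕ Fin n) (Fin n ⊕ Fin n) ℝ}
    (h : ((2 : ℝ) • A + symplJ n).det ≠ 0) :
    LinearMap.det (mixedMap A : R2n n →ₗ[ℝ] R2n n) ≠ 0 := by
  have : (mixedMap A : R2n n →ₗ[ℝ] R2n n) =
      Matrix.toLpLin 2 2 (-((2 : ℝ) • A + symplJ n)ᵀ) := rfl
  rw [this, Matrix.toLpLin_eq_toLin, LinearMap.det_toLin, Matrix.det_neg, Matrix.det_transpose]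
  exact mul_ne_zero (pow_ne_zero _ (by norm_num)) h

/-- Expanding φ(x - w), symmetry of A merges the two cross terms into -2xᵗAw, which combines with
the symplectic term into one bilinear form. Its nondegeneracy is that of 2A + J. -/
theorem heisPhase_eq {A : Matrix (Fin n ⊕ Fin n) (Fin n ⊕ Fin n) ℝ} (hA : A.IsSymm)
    (x w : R2n n) : heisPhase A x w = quadPhi A x + quadPhi A w + ⟪w, mixedMap A x⟫ := by
  have hin : ⟪w, mixedMap A x⟫ = -(2 * (x.ofLp ⬝ᵥ (A *ᵥ w.ofLp)) + symplForm x w) := by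
    have h1 : (mixedMap A x).ofLp = (-((2 : ℝ) • A + symplJ n)ᵀ) *ᵥ x.ofLp := rfl
    rw [EuclideanSpace.inner_eq_star_dotProduct, h1, star_trivial, neg_mulVec, neg_dotProduct,
      mulVec_transpose, ← dotProduct_mulVec, add_mulVec, dotProduct_add, smul_mulVec,
      dotProduct_smul, smul_eq_mul, symplForm]
  have hsymm : w.ofLp ⬝ᵥ (A *ᵥ x.ofLp) = x.ofLp ⬝ᵥ (A *ᵥ w.ofLp) := by
    rw [dotProduct_mulVec, ← mulVec_transpose, hA.eq, dotProduct_comm]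
  rw [hin, heisPhase, quadPhi, quadPhi, quadPhi, WithLp.ofLp_sub, mulVec_sub, dotProduct_sub,
    sub_dotProduct, sub_dotProduct, hsymm]
  ring

theorem heis_mul_inv_graph (A : Matrix (Fin n ⊕ Fin n) (Fin n ⊕ Fin n) ℝ) (x w : R2n n) (t : ℝ) :
    ((x, t) : Heis n) * ((x - w, quadPhi A (x - w)) : Heis n)⁻¹ = (w, t - heisPhase A x w) := by
  rw [Heis.mul_def, Heis.inv_def]
  refine Prod.ext ?_ ?_
  · simp
  · simp only [heisPhase]
    rw [show -(x - w) = w + -x by abel, symplForm_add_right,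
      show symplForm x (-x) = 0 by
        rw [← neg_eq_zero, ← symplForm_neg_left, symplForm_self]]
    ring

section nuZero

variable {A : Matrix (Fin n ⊕ Fin n) (Fin n ⊕ Fin n) ℝ} {η : R2n n → ℝ}

theorem lintegral_nuZero (hη : IsCutoff η) {F : Heis n → ℝ≥0∞} (hF : Measurable F) :
    ∫⁻ y, F y ∂(nuZero A η) = ∫⁻ y, ENNReal.ofReal (η y) * F (y, quadPhi A y) := by
  have hηm : Measurable fun y => ENNReal.ofReal (η y) :=
    hη.smooth.continuous.measurable.ennreal_ofReal
  have hFm : Measurable fun y : R2n n => F (y, quadPhi A y) := hF.comp (measurable_graph A)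
  rw [nuZero, lintegral_map hF (measurable_graph A),
    lintegral_withDensity_eq_lintegral_mul _ hηm hFm]
  rfl

theorem lconv_nuZero (hη : IsCutoff η) {F : Heis n → ℝ≥0∞} (hF : Measurable F) (x : R2n n)
    (t : ℝ) : lconv (nuZero A η) F (x, t) =
      ∫⁻ w, ENNReal.ofReal (η (x - w)) * F (w, t - heisPhase A x w) := by
  have hFm : Measurable fun y : Heis n => F ((x, t) * y⁻¹) :=
    hF.comp (measurable_heis_mul_inv.comp (measurable_const.prodMk measurable_id))
  rw [lconv, lintegral_nuZero hη hFm, ← lintegral_sub_left_eq_self _ x]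
  refine lintegral_congr fun w => ?_
  rw [← heis_mul_inv_graph]

theorem hasCompactSupport_cutoff (hη : IsCutoff η) : HasCompactSupport η := by
  refine HasCompactSupport.of_support_subset_isCompact (isCompact_closedBall (0 : R2n n) 2) ?_
  intro y hy
  rw [mem_closedBall_zero_iff]
  by_contra h
  push Not at h
  exact hy (hη.eq_zero y h.le)

/-- The cutoff is a Schwartz function, so its Fourier transform serves as ψ. -/
theorem exists_integrable_fourierInv_eq_cutoff (hη : IsCutoff η) :
    ∃ ψ : R2n n → ℂ, Integrable ψ ∧ ∀ v, 𝓕⁻ ψ v = η v := by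
  have hg₁ : HasCompactSupport (Complex.ofRealCLM ∘ η) :=
    (hasCompactSupport_cutoff hη).comp_left rfl
  have hg₂ : ContDiff ℝ ∞ (Complex.ofRealCLM ∘ η) :=
    Complex.ofRealCLM.contDiff.comp hη.smooth
  let s : SchwartzMap (R2n n) ℂ := hg₁.toSchwartzMap hg₂
  refine ⟨⇑(𝓕 s : SchwartzMap (R2n n) ℂ), SchwartzMap.integrable _, fun v => ?_⟩
  rw [← SchwartzMap.fourierInv_coe, FourierTransform.fourierInv_fourier_eq]
  simp [s]

theorem isFiniteMeasure_nuZero (hη : IsCutoff η) : IsFiniteMeasure (nuZero A η) := by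
  refine ⟨?_⟩
  rw [← lintegral_one, lintegral_nuZero hη measurable_const]
  simp only [mul_one]
  exact (hη.smooth.continuous.integrable_of_hasCompactSupport
    (hasCompactSupport_cutoff hη)).lintegral_lt_top

end nuZero

theorem exists_lintegral_lconv_mul_le {A : Matrix (Fin n ⊕ Fin n) (Fin n ⊕ Fin n) ℝ}
    (hA : A.IsSymm) (hdet : ((2 : ℝ) • A + symplJ n).det ≠ 0) {η : R2n n → ℝ} (hη : IsCutoff η)
    {p q : ℝ} (hpq : p.HolderConjugate q) (hq : q = 2 * n + 2) (hn : 1 ≤ n) :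
    ∃ C : ℝ≥0, ∀ (R K : ℝ) (f g : Heis n → ℝ), IsTestFunction R K f → IsTestFunction R K g →
      ∫⁻ x, lconv (nuZero A η) (fun z => ENNReal.ofReal (f z)) x * ENNReal.ofReal (g x) ≤
        C * ((∫⁻ z, ENNReal.ofReal (f z) ^ p) ^ (1 / p) *
          (∫⁻ z, ENNReal.ofReal (g z) ^ p) ^ (1 / p)) := by
  have hn' : (1 : ℝ) ≤ n := by exact_mod_cast hn
  obtain ⟨ψ, hψ, hψη⟩ := exists_integrable_fourierInv_eq_cutoff hη
  -- This equation in dimension 2n is what singles out the exponent q = 2n + 2.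
  have hd : (Module.finrank ℝ (R2n n) : ℝ) / q = 1 - 2 / q := by
    rw [finrank_euclideanSpace, Fintype.card_sum, Fintype.card_fin, hq]
    push_cast
    field_simp
    ring
  obtain ⟨C, hC⟩ := exists_lintegral_form_le hpq (by rw [hq]; linarith) hd hη.smooth.continuous
    hη.mem_Icc hψ hψη (continuous_quadPhi A) (continuous_quadPhi A) (mixedMap A)
    (det_mixedMap_ne_zero hdet)
  refine ⟨C, fun R K f g hf hg => ?_⟩
  refine le_of_eq_of_le ?_ (hC R K f g hf hg)
  have hfm : Measurable fun z => ENNReal.ofReal (f z) := hf.measurable.ennreal_ofReal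
  have hgm : Measurable fun z => ENNReal.ofReal (g z) := hg.measurable.ennreal_ofReal
  have hηc := hη.smooth.continuous
  have hSc : Continuous fun z : R2n n × R2n n => heisPhase A z.1 z.2 := by
    simp only [heisPhase_eq hA]
    have := continuous_quadPhi A
    fun_prop
  have hm3 : Measurable fun z : R2n n × R2n n × ℝ => ENNReal.ofReal (η (z.1 - z.2.1)) *
      (ENNReal.ofReal (f (z.2.1, z.2.2 - heisPhase A z.1 z.2.1)) * ENNReal.ofReal (g (z.1, z.2.2))) := by
    have hηm : Measurable fun z : R2n n × R2n n × ℝ => η (z.1 - z.2.1) :=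
      Continuous.measurable (by fun_prop)
    have hfm' : Measurable fun z : R2n n × R2n n × ℝ =>
        ENNReal.ofReal (f (z.2.1, z.2.2 - heisPhase A z.1 z.2.1)) := by
      have h1 := hSc.comp (by fun_prop : Continuous fun z : R2n n × R2n n × ℝ => (z.1, z.2.1))
      have h2 : Measurable fun z : R2n n × R2n n × ℝ =>
          ((z.2.1, z.2.2 - heisPhase A z.1 z.2.1) : Heis n) :=
        (Continuous.prodMk (by fun_prop) (Continuous.sub (by fun_prop) h1)).measurable
      exact hfm.comp h2
    have hgm' : Measurable fun z : R2n n × R2n n × ℝ => ENNReal.ofReal (g (z.1, z.2.2)) :=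
      hgm.comp (by fun_prop : Measurable fun z : R2n n × R2n n × ℝ => (z.1, z.2.2))
    exact hηm.ennreal_ofReal.mul (hfm'.mul hgm')
  have : SFinite (nuZero A η) := by have := isFiniteMeasure_nuZero (A := A) hη; infer_instance
  have hlm : Measurable fun x => lconv (nuZero A η) (fun z => ENNReal.ofReal (f z)) x *
      ENNReal.ofReal (g x) := (measurable_lconv _ hfm).mul hgm
  rw [Measure.volume_eq_prod, lintegral_prod _ hlm.aemeasurable]
  rw [Measure.volume_eq_prod, lintegral_prod]
  · refine lintegral_congr fun x => ?_
    calc ∫⁻ t, lconv (nuZero A η) (fun z => ENNReal.ofReal (f z)) (x, t) * ENNReal.ofReal (g (x, t))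
        = ∫⁻ t, ∫⁻ w, ENNReal.ofReal (η (x - w)) * (ENNReal.ofReal (f (w, t - heisPhase A x w)) *
            ENNReal.ofReal (g (x, t))) := by
          refine lintegral_congr fun t => ?_
          rw [lconv_nuZero hη hfm, ← lintegral_mul_const' _ _ (by simp)]
          simp only [mul_assoc]
      _ = ∫⁻ w, ∫⁻ t, ENNReal.ofReal (η (x - w)) * (ENNReal.ofReal (f (w, t - heisPhase A x w)) *
            ENNReal.ofReal (g (x, t))) := by
          refine lintegral_lintegral_swap (Measurable.aemeasurable ?_)
          exact hm3.comp (by fun_prop : Measurable fun z : ℝ × R2n n => (x, z.2, z.1))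
      _ = _ := by
          refine lintegral_congr fun w => ?_
          simp only
          rw [lintegral_const_mul' _ _ (by simp), ENNReal.ofReal_mul (hη.mem_Icc _).1,
            ofReal_integral_eq_lintegral_ofReal, ← heisPhase_eq hA]
          · simp_rw [ENNReal.ofReal_mul (hf.nonneg _)]
          · refine (hg.integrable_slice x).bdd_mul (c := K) ?_ ?_
            · exact ((hf.measurable_slice w).comp (by fun_prop)).aestronglyMeasurable
            · exact Filter.Eventually.of_forall fun t => hf.abs_le _
          · exact Filter.Eventually.of_forall fun t => mul_nonneg (hf.nonneg _) (hg.nonneg _)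
  · refine Measurable.aemeasurable (Measurable.ennreal_ofReal (Measurable.mul
      (Continuous.measurable (by fun_prop)) ?_))
    refine StronglyMeasurable.measurable (StronglyMeasurable.integral_prod_right'
      (f := fun z : (R2n n × R2n n) × ℝ => f (z.1.2, z.2 - (quadPhi A z.1.1 + quadPhi A z.1.2 +
        ⟪z.1.2, mixedMap A z.1.1⟫)) * g (z.1.1, z.2)) (Measurable.stronglyMeasurable ?_))
    have := continuous_quadPhi A
    refine Measurable.mul (hf.measurable.comp (Continuous.measurable (by fun_prop)))
      (hg.measurable.comp (by fun_prop))

theorem isTestFunction_toReal {V : Type*} [NormedAddCommGroup V] [MeasurableSpace V]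
    {F : V × ℝ → ℝ≥0∞} (hF : Measurable F) {K : ℝ≥0} {R K' R' : ℝ} (hFK : ∀ x, F x ≤ K)
    (hFR : ∀ x ∉ Metric.closedBall (0 : V × ℝ) R, F x = 0) (hK : K ≤ K') (hR : R ≤ R') :
    IsTestFunction R' K' fun z => (F z).toReal where
  measurable := hF.ennreal_toReal
  nonneg z := ENNReal.toReal_nonneg
  le z := (ENNReal.toReal_le_coe_of_le_coe (hFK z)).trans hK
  support z hz := by
    rw [hFR z, ENNReal.toReal_zero]
    rw [mem_closedBall_zero_iff, not_le]
    exact hR.trans_lt hz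

theorem lconv_iSup (μ : Measure (Heis n)) {F : ℕ → Heis n → ℝ≥0∞} (hF : ∀ k, Measurable (F k))
    (hmono : Monotone F) (x : Heis n) :
    lconv μ (fun z => ⨆ k, F k z) x = ⨆ k, lconv μ (F k) x := by
  refine lintegral_iSup (fun k => ?_) (fun i j hij y => hmono hij _)
  exact (hF k).comp (measurable_heis_mul_inv.comp (measurable_const.prodMk measurable_id))

/-- The endpoint estimate. -/
theorem exists_lintegral_lconv_rpow_le {A : Matrix (Fin n ⊕ Fin n) (Fin n ⊕ Fin n) ℝ}
    (hA : A.IsSymm) (hdet : ((2 : ℝ) • A + symplJ n).det ≠ 0) {η : R2n n → ℝ} (hη : IsCutoff η)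
    {p q : ℝ} (hpq : p.HolderConjugate q) (hq : q = 2 * n + 2) (hn : 1 ≤ n) :
    ∃ C : ℝ≥0, ∀ F : Heis n → ℝ≥0∞, Measurable F →
      ∫⁻ x, lconv (nuZero A η) F x ^ q ≤ C * (∫⁻ x, F x ^ p) ^ (q / p) := by
  obtain ⟨C, hC⟩ := exists_lintegral_lconv_mul_le hA hdet hη hpq hq hn
  have hp0 := hpq.pos
  have hq0 := hpq.symm.pos
  have hfinν := isFiniteMeasure_nuZero (A := A) hη
  let S : ℕ → Set (Heis n) := fun k => Metric.closedBall 0 k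
  have hSm : ∀ k, MeasurableSet (S k) := fun k => Metric.isClosed_closedBall.measurableSet
  have hSmono : Monotone S := fun i j hij => Metric.closedBall_subset_closedBall (by exact_mod_cast hij)
  have hSU : ⋃ k, S k = Set.univ := Metric.iUnion_closedBall_nat 0
  have hSfin : ∀ k, volume (S k) < ⊤ := fun k => measure_closedBall_lt_top
  -- Duality converts the bilinear estimate into a norm estimate for bounded F vanishing off a ball;
  -- monotone convergence extends it to all nonnegative F.
  have hbdd : ∀ F : Heis n → ℝ≥0∞, Measurable F → ∀ (K : ℝ≥0) (k : ℕ), (∀ x, F x ≤ K) →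
      (∀ x ∉ S k, F x = 0) →
      ∫⁻ x, lconv (nuZero A η) F x ^ q ≤ C ^ q * (∫⁻ x, F x ^ p) ^ (q / p) := by
    intro F hF K k hFK hFk
    refine (lintegral_rpow_le_of_forall_lintegral_mul_le hpq (measurable_lconv _ hF) S hSm hSmono
      hSU hSfin (C * (∫⁻ x, F x ^ p) ^ (1 / p)) ?_).trans_eq ?_
    · intro g hg K' k' hgK hgk
      have hFt : ∀ x, ENNReal.ofReal (F x).toReal = F x := fun x =>
        ENNReal.ofReal_toReal (ne_top_of_le_ne_top ENNReal.coe_ne_top (hFK x))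
      have hgt : ∀ x, ENNReal.ofReal (g x).toReal = g x := fun x =>
        ENNReal.ofReal_toReal (ne_top_of_le_ne_top ENNReal.coe_ne_top (hgK x))
      have := hC (max k k') (max K K') (fun z => (F z).toReal) (fun z => (g z).toReal)
        (isTestFunction_toReal hF hFK hFk (le_max_left _ _) (le_max_left _ _))
        (isTestFunction_toReal hg hgK hgk (le_max_right _ _) (le_max_right _ _))
      simp_rw [hFt, hgt] at this
      rwa [mul_assoc]
    · rw [ENNReal.mul_rpow_of_nonneg _ _ hq0.le, ← ENNReal.rpow_mul, div_mul_eq_mul_div, one_mul]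
  refine ⟨C ^ q, fun F hF => ?_⟩
  rw [ENNReal.coe_rpow_of_nonneg _ hq0.le]
  have hFk := measurable_truncation hF hSm
  have e : ∀ x, lconv (nuZero A η) F x ^ q =
      ⨆ k, lconv (nuZero A η) (truncation S F k) x ^ q := by
    intro x
    have h1 : F = fun z => ⨆ k, truncation S F k z :=
      funext fun z => (iSup_truncation hSmono hSU z).symm
    conv_lhs => rw [h1]
    rw [lconv_iSup _ hFk (truncation_mono hSmono)]
    exact (ENNReal.orderIsoRpow q hq0).map_iSup _
  simp_rw [e]
  rw [lintegral_iSup (fun k => (measurable_lconv _ (hFk k)).pow_const q)]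
  · refine iSup_le fun k => (hbdd _ (hFk k) k k (fun x => ?_) fun x hx => ?_).trans ?_
    · simpa using truncation_le_natCast k x
    · exact truncation_of_notMem hx
    · gcongr
      exact truncation_le k _
  · intro i j hij x
    refine ENNReal.rpow_le_rpow (lintegral_mono fun y => ?_) hq0.le
    exact truncation_mono hSmono hij _

end Heisenberg

/-! ### Interpolation of positive convolution operators and passage to complex functions. -/

section Sufficiency

variable {n : ℕ}

theorem continuous_symplForm_left (y : R2n n) : Continuous fun x => symplForm x y := by
  simp only [symplForm, dotProduct, mulVec]
  fun_prop

theorem continuous_heis_mul_right (y : Heis n) : Continuous fun x : Heis n => x * y := by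
  have h1 : Continuous fun x : Heis n => symplForm x.1 y.1 :=
    (continuous_symplForm_left y.1).comp continuous_fst
  exact Continuous.prodMk (by fun_prop) (by fun_prop)

/-- A right translation shifts x by a constant and, for each x, shifts t by an amount depending on x
only; both shifts preserve Lebesgue measure. -/
theorem lintegral_heis_mul_right_eq_self {G : Heis n → ℝ≥0∞} (hG : Measurable G) (y : Heis n) :
    ∫⁻ x, G (x * y) = ∫⁻ x, G x := by
  have hm : Measurable fun x : Heis n => G (x * y) :=
    hG.comp (continuous_heis_mul_right y).measurable
  rw [Measure.volume_eq_prod, lintegral_prod _ hm.aemeasurable, lintegral_prod _ hG.aemeasurable,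
    ← lintegral_add_right_eq_self (fun x => ∫⁻ t, G (x, t)) y.1]
  refine lintegral_congr fun x => ?_
  rw [← lintegral_add_right_eq_self (fun t => G (x + y.1, t)) (y.2 + symplForm x y.1)]
  refine lintegral_congr fun t => ?_
  rw [Heis.mul_def]
  congr 2
  exact add_assoc _ _ _

theorem lintegral_lconv (μ : Measure (Heis n)) [SFinite μ] {G : Heis n → ℝ≥0∞}
    (hG : Measurable G) : ∫⁻ x, lconv μ G x = μ Set.univ * ∫⁻ x, G x := by
  have h : Measurable (Function.uncurry fun x y : Heis n => G (x * y⁻¹)) :=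
    hG.comp measurable_heis_mul_inv
  simp only [lconv]
  rw [lintegral_lintegral_swap h.aemeasurable]
  simp_rw [lintegral_heis_mul_right_eq_self hG]
  rw [lintegral_const, mul_comm]

/-- Hölder with three factors, applied to F = 1^α · (F^a)^β · (F^b)^γ. Positivity of the kernel lets
this pointwise bound replace Riesz–Thorin. -/
theorem lconv_le_of_weights (μ : Measure (Heis n)) {F : Heis n → ℝ≥0∞} (hF : Measurable F)
    {α β γ a b : ℝ} (hα : 0 ≤ α) (hβ : 0 ≤ β) (hγ : 0 ≤ γ) (hsum : α + β + γ = 1) (ha : 0 ≤ a)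
    (hb : 0 ≤ b) (hab : a * β + b * γ = 1) (x : Heis n) :
    lconv μ F x ≤ μ Set.univ ^ α * lconv μ (fun z => F z ^ a) x ^ β *
      lconv μ (fun z => F z ^ b) x ^ γ := by
  have hm : Measurable fun y => F (x * y⁻¹) :=
    hF.comp (measurable_heis_mul_inv.comp (measurable_const.prodMk measurable_id))
  have h := ENNReal.lintegral_prod_norm_pow_le (μ := μ) (Finset.univ : Finset (Fin 3))
    (f := ![fun _ => 1, fun y => F (x * y⁻¹) ^ a, fun y => F (x * y⁻¹) ^ b])
    (p := ![α, β, γ]) ?_ ?_ ?_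
  · simp only [Fin.prod_univ_three, Matrix.cons_val_zero, Matrix.cons_val_one, Matrix.cons_val,
      ENNReal.one_rpow, one_mul, lintegral_one] at h
    refine le_of_eq_of_le (lintegral_congr fun y => ?_) h
    rw [← ENNReal.rpow_mul, ← ENNReal.rpow_mul,
      ← ENNReal.rpow_add_of_nonneg _ _ (by positivity) (by positivity), hab, ENNReal.rpow_one]
  · intro i _
    fin_cases i
    · exact aemeasurable_const
    · exact (hm.pow_const a).aemeasurable
    · exact (hm.pow_const b).aemeasurable
  · simp [Fin.sum_univ_three, hsum]
  · intro i _
    fin_cases i <;> simpa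

/-- Interpolation of a positive convolution operator between `L¹ → L¹`, `L^∞ → L^∞` and a given
estimate `L^p₀ → L^q₀`. -/
theorem lintegral_lconv_rpow_le_of_weights (μ : Measure (Heis n)) [IsFiniteMeasure μ]
    {p₀ q₀ : ℝ} (hp₀ : 0 < p₀) (hq₀ : 0 < q₀) {C₀ : ℝ≥0}
    (hC₀ : ∀ F : Heis n → ℝ≥0∞, Measurable F →
      ∫⁻ x, lconv μ F x ^ q₀ ≤ C₀ * (∫⁻ x, F x ^ p₀) ^ (q₀ / p₀))
    {α β γ : ℝ} (hα : 0 ≤ α) (hβ : 0 ≤ β) (hγ : 0 ≤ γ) (hsum : α + β + γ = 1)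
    (hα1 : α < 1) {u v : ℝ} (hu : u = β + γ / p₀) (hv : v = β + γ / q₀) :
    ∃ C : ℝ≥0, ∀ F : Heis n → ℝ≥0∞, Measurable F →
      ∫⁻ x, lconv μ F x ^ v⁻¹ ≤ C * (∫⁻ x, F x ^ u⁻¹) ^ (v⁻¹ / u⁻¹) := by
  have hpos : ∀ r : ℝ, 0 < r → 0 < β + γ / r := by
    intro r hr
    rcases hβ.eq_or_lt with h | h
    · have : 0 < γ := by linarith
      positivity
    · positivity
  have hu0 : 0 < u := hu ▸ hpos p₀ hp₀
  have hv0 : 0 < v := hv ▸ hpos q₀ hq₀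
  set M := μ Set.univ with hM
  have hMtop : M ≠ ⊤ := measure_ne_top _ _
  set P := u⁻¹ with hP
  set Q := v⁻¹ with hQ
  have hP0 : 0 < P := inv_pos.2 hu0
  have hQ0 : 0 < Q := inv_pos.2 hv0
  have hPu : P * u = 1 := inv_mul_cancel₀ hu0.ne'
  have hQv : Q * v = 1 := inv_mul_cancel₀ hv0.ne'
  set c : ℝ≥0∞ := M ^ (α * Q) * (M ^ (β * Q) * (C₀ : ℝ≥0∞) ^ (γ * Q / q₀)) with hc
  have hctop : c ≠ ⊤ := by
    refine ENNReal.mul_ne_top ?_ (ENNReal.mul_ne_top ?_ ?_)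
    · exact ENNReal.rpow_ne_top_of_nonneg (by positivity) hMtop
    · exact ENNReal.rpow_ne_top_of_nonneg (by positivity) hMtop
    · exact ENNReal.rpow_ne_top_of_nonneg (by positivity) ENNReal.coe_ne_top
  refine ⟨c.toNNReal, fun F hF => ?_⟩
  rw [ENNReal.coe_toNNReal hctop]
  set N := ∫⁻ x, F x ^ P with hN
  have hm1 := measurable_lconv μ (hF.pow_const P)
  have hm2 := measurable_lconv μ (hF.pow_const (P / p₀))
  -- The weights α, β, γ belong to the exponent points (0, 0), (1, 1) and (1/p₀, 1/q₀). With a = P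
  -- and b = P/p₀, the L¹ bound applies to F^P and the given estimate to F^(P/p₀), and both then
  -- involve only the integral of F^P. The assumption α < 1 keeps P and Q finite.
  have hpt : ∀ x, lconv μ F x ^ Q ≤ M ^ (α * Q) * (lconv μ (fun z => F z ^ P) x ^ (β * Q) *
      (lconv μ (fun z => F z ^ (P / p₀)) x ^ q₀) ^ (γ * Q / q₀)) := by
    intro x
    have h := lconv_le_of_weights μ hF hα hβ hγ hsum (a := P) (b := P / p₀) hP0.le (by positivity)
      (by rw [← hPu, hu]; ring) x
    refine (ENNReal.rpow_le_rpow h hQ0.le).trans_eq ?_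
    rw [ENNReal.mul_rpow_of_nonneg _ _ hQ0.le, ENNReal.mul_rpow_of_nonneg _ _ hQ0.le,
      ← ENNReal.rpow_mul, ← ENNReal.rpow_mul, ← ENNReal.rpow_mul, ← ENNReal.rpow_mul, mul_assoc,
      mul_div_cancel₀ _ hq₀.ne']
  calc ∫⁻ x, lconv μ F x ^ Q ≤ ∫⁻ x, M ^ (α * Q) * (lconv μ (fun z => F z ^ P) x ^ (β * Q) *
        (lconv μ (fun z => F z ^ (P / p₀)) x ^ q₀) ^ (γ * Q / q₀)) := lintegral_mono hpt
    _ = M ^ (α * Q) * ∫⁻ x, lconv μ (fun z => F z ^ P) x ^ (β * Q) *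
        (lconv μ (fun z => F z ^ (P / p₀)) x ^ q₀) ^ (γ * Q / q₀) := by
        rw [lintegral_const_mul' _ _ (ENNReal.rpow_ne_top_of_nonneg (by positivity) hMtop)]
    _ ≤ M ^ (α * Q) * ((∫⁻ x, lconv μ (fun z => F z ^ P) x) ^ (β * Q) *
        (∫⁻ x, lconv μ (fun z => F z ^ (P / p₀)) x ^ q₀) ^ (γ * Q / q₀)) := by
        gcongr
        -- The second Hölder inequality, in x, has exponents βQ and γQ/q₀, whose sum is Qv = 1.
        refine ENNReal.lintegral_mul_norm_pow_le hm1.aemeasurable (hm2.pow_const _).aemeasurable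
          (by positivity) (by positivity) ?_
        rw [← hQv, hv]; ring
    _ ≤ M ^ (α * Q) * ((M * N) ^ (β * Q) * (C₀ * N ^ (q₀ / p₀)) ^ (γ * Q / q₀)) := by
        rw [lintegral_lconv μ (hF.pow_const P)]
        gcongr
        refine (hC₀ _ (hF.pow_const _)).trans_eq ?_
        simp_rw [← ENNReal.rpow_mul, div_mul_cancel₀ P hp₀.ne']
        rfl
    _ = c * N ^ (Q / P) := by
        rw [ENNReal.mul_rpow_of_nonneg _ _ (by positivity),
          ENNReal.mul_rpow_of_nonneg _ _ (by positivity), ← ENNReal.rpow_mul,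
          show Q / P = β * Q + q₀ / p₀ * (γ * Q / q₀) by
            rw [hP, div_inv_eq_mul, hu]; field_simp,
          ENNReal.rpow_add_of_nonneg _ _ (by positivity) (by positivity)]
        ring

theorem enorm_heisConv_le (μ : Measure (Heis n)) (f : Heis n → ℂ) (x : Heis n) :
    ‖heisConv f μ x‖ₑ ≤ lconv μ (fun z => ‖f z‖ₑ) x :=
  enorm_integral_le_lintegral_enorm _

theorem measurable_heisConv (μ : Measure (Heis n)) [SFinite μ] {f : Heis n → ℂ}
    (hf : Measurable f) : Measurable (heisConv f μ) :=
  ((hf.comp measurable_heis_mul_inv).stronglyMeasurable.integral_prod_right').measurable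

theorem integrable_of_lconv_lt_top {μ : Measure (Heis n)} {f : Heis n → ℂ} (hf : Measurable f)
    {x : Heis n} (hx : lconv μ (fun z => ‖f z‖ₑ) x < ⊤) :
    Integrable (fun y => f (x * y⁻¹)) μ :=
  ⟨(hf.comp (measurable_heis_mul_inv.comp
    (measurable_const.prodMk measurable_id))).aestronglyMeasurable, hx⟩

theorem convBounded_of_lintegral_le {μ : Measure (Heis n)} [SFinite μ] {P Q : ℝ} (hP : 0 < P)
    (hQ : 0 < Q) {C : ℝ≥0} (hC : ∀ F : Heis n → ℝ≥0∞, Measurable F →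
      ∫⁻ x, lconv μ F x ^ Q ≤ C * (∫⁻ x, F x ^ P) ^ (Q / P)) :
    ConvBounded μ (ENNReal.ofReal P) (ENNReal.ofReal Q) := by
  refine ⟨C ^ (1 / Q), fun f hf hfP => ?_⟩
  have hP0 : ENNReal.ofReal P ≠ 0 := by simpa using hP
  have hQ0 : ENNReal.ofReal Q ≠ 0 := by simpa using hQ
  have hm := measurable_lconv μ hf.enorm
  have hfin : ∫⁻ x, ‖f x‖ₑ ^ P < ⊤ := by
    have := lintegral_rpow_enorm_lt_top_of_eLpNorm_lt_top hP0 ENNReal.ofReal_ne_top hfP.2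
    rwa [ENNReal.toReal_ofReal hP.le] at this
  have hT := hC _ hf.enorm
  have hTfin : ∫⁻ x, lconv μ (fun z => ‖f z‖ₑ) x ^ Q < ⊤ :=
    hT.trans_lt (ENNReal.mul_lt_top ENNReal.coe_lt_top
      (ENNReal.rpow_lt_top_of_nonneg (by positivity) hfin.ne))
  have hbound : eLpNorm (heisConv f μ) (ENNReal.ofReal Q) volume ≤
      (C ^ (1 / Q) : ℝ≥0) * eLpNorm f (ENNReal.ofReal P) volume := by
    rw [eLpNorm_eq_lintegral_rpow_enorm_toReal hQ0 ENNReal.ofReal_ne_top,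
      eLpNorm_eq_lintegral_rpow_enorm_toReal hP0 ENNReal.ofReal_ne_top,
      ENNReal.toReal_ofReal hP.le, ENNReal.toReal_ofReal hQ.le]
    calc (∫⁻ x, ‖heisConv f μ x‖ₑ ^ Q) ^ (1 / Q)
        ≤ (C * (∫⁻ x, ‖f x‖ₑ ^ P) ^ (Q / P)) ^ (1 / Q) := by
          gcongr
          refine (lintegral_mono fun x => ?_).trans hT
          gcongr
          exact enorm_heisConv_le μ f x
      _ = _ := by
          rw [ENNReal.mul_rpow_of_nonneg _ _ (by positivity), ← ENNReal.rpow_mul,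
            ENNReal.coe_rpow_of_nonneg _ (by positivity)]
          congr 2
          field_simp
  refine ⟨?_, ⟨(measurable_heisConv μ hf).aestronglyMeasurable, ?_⟩, hbound⟩
  · filter_upwards [ae_lt_top (hm.pow_const Q) hTfin.ne] with x hx
    refine integrable_of_lconv_lt_top hf ?_
    by_contra h
    rw [not_lt, top_le_iff] at h
    rw [h, ENNReal.top_rpow_of_pos hQ] at hx
    exact lt_irrefl _ hx
  · exact hbound.trans_lt (ENNReal.mul_lt_top ENNReal.coe_lt_top hfP.2)

theorem convBounded_top (μ : Measure (Heis n)) [IsFiniteMeasure μ] : ConvBounded μ ⊤ ⊤ := by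
  refine ⟨(μ Set.univ).toNNReal, fun f hf hft => ?_⟩
  rw [ENNReal.coe_toNNReal (measure_ne_top _ _)]
  set c := eLpNorm f ⊤ volume with hc
  have hc' : c = eLpNormEssSup f volume := eLpNorm_exponent_top
  -- Since μ may be singular, a Haar-null set need not be μ-null. But the convolution of its
  -- indicator has integral zero, so for almost every x the point x·y⁻¹ avoids N for μ-almost every
  -- y.
  let N : Set (Heis n) := {z | c < ‖f z‖ₑ}
  have hNm : MeasurableSet N := measurableSet_lt measurable_const hf.enorm
  have hN0 : volume N = 0 := by
    rw [show N = {z | eLpNormEssSup f volume < ‖f z‖ₑ} by rw [← hc']]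
    exact meas_eLpNormEssSup_lt
  have hind : Measurable (N.indicator fun _ => (1 : ℝ≥0∞)) := measurable_const.indicator hNm
  have hint : ∫⁻ x, lconv μ (N.indicator fun _ => 1) x = 0 := by
    rw [lintegral_lconv μ hind, lintegral_indicator_const hNm, hN0]
    simp
  rw [lintegral_eq_zero_iff (measurable_lconv μ hind)] at hint
  have hae : ∀ᵐ x : Heis n, lconv μ (fun z => ‖f z‖ₑ) x ≤ μ Set.univ * c := by
    filter_upwards [hint] with x hx
    have hmx : Measurable fun y : Heis n => (x * y⁻¹) :=
      measurable_heis_mul_inv.comp (measurable_const.prodMk measurable_id)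
    have hm' : Measurable fun y : Heis n => N.indicator (fun _ => (1 : ℝ≥0∞)) (x * y⁻¹) :=
      hind.comp hmx
    rw [lconv, Pi.zero_apply, lintegral_eq_zero_iff hm'] at hx
    calc lconv μ (fun z => ‖f z‖ₑ) x ≤ ∫⁻ _, c ∂μ := by
          refine lintegral_mono_ae ?_
          filter_upwards [hx] with y hy
          by_contra h
          have hyN : x * y⁻¹ ∈ N := not_le.1 h
          simp [Set.indicator_of_mem hyN] at hy
      _ = _ := by rw [lintegral_const, mul_comm]
  have hbound : eLpNorm (heisConv f μ) ⊤ volume ≤ μ Set.univ * c := by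
    rw [eLpNorm_exponent_top]
    refine eLpNormEssSup_le_of_ae_enorm_bound ?_
    filter_upwards [hae] with x hx using (enorm_heisConv_le μ f x).trans hx
  have hfin : μ Set.univ * c < ⊤ := ENNReal.mul_lt_top (measure_lt_top _ _) hft.2
  refine ⟨?_, ⟨(measurable_heisConv μ hf).aestronglyMeasurable, hbound.trans_lt hfin⟩, hbound⟩
  filter_upwards [hae] with x hx using integrable_of_lconv_lt_top hf (hx.trans_lt hfin)

end Sufficiency

/-! ### Necessary conditions from indicator functions of slabs. -/

section Necessity

open RealInnerProductSpace Filter Topology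

variable {n : ℕ}

/-- If r > s, dividing by δ^s and letting δ → 0 would give a ≤ 0. Each necessary condition below is
read off from such a comparison of powers. -/
theorem le_of_mul_rpow_le_mul_rpow {a b r s δ₀ : ℝ} (ha : 0 < a) (hδ₀ : 0 < δ₀)
    (h : ∀ δ : ℝ, 0 < δ → δ < δ₀ → a * δ ^ s ≤ b * δ ^ r) : r ≤ s := by
  by_contra! hlt
  have hlim : Tendsto (fun δ : ℝ => b * δ ^ (r - s)) (𝓝[>] 0) (𝓝 (b * 0)) := by
    refine Tendsto.const_mul b ?_
    have h0 : ContinuousAt (fun δ : ℝ => δ ^ (r - s)) 0 :=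
      Real.continuousAt_rpow_const _ _ (Or.inr (by linarith))
    have h1 := h0.tendsto
    simp only [Real.zero_rpow (sub_ne_zero.2 hlt.ne')] at h1
    exact h1.mono_left nhdsWithin_le_nhds
  have hle : a ≤ b * 0 := by
    refine ge_of_tendsto hlim ?_
    filter_upwards [Ioo_mem_nhdsGT hδ₀] with δ hδ
    have h1 := h δ hδ.1 hδ.2
    have h2 : 0 < δ ^ s := Real.rpow_pos_of_pos hδ.1 s
    rw [Real.rpow_sub hδ.1, ← mul_div_assoc, le_div_iff₀ h2]
    exact h1
  linarith

theorem lconv_indicator_one (μ : Measure (Heis n)) {E : Set (Heis n)} (hE : MeasurableSet E)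
    (x : Heis n) :
    lconv μ (E.indicator fun _ => 1) x = μ ((fun y => x * y⁻¹) ⁻¹' E) := by
  have hmx : Measurable fun y : Heis n => x * y⁻¹ :=
    measurable_heis_mul_inv.comp (measurable_const.prodMk measurable_id)
  rw [← lintegral_indicator_one (hmx hE)]
  rfl

theorem enorm_heisConv_indicator_one (μ : Measure (Heis n)) [IsFiniteMeasure μ] {E : Set (Heis n)}
    (hE : MeasurableSet E) (x : Heis n) :
    ‖heisConv (E.indicator fun _ => (1 : ℂ)) μ x‖ₑ = lconv μ (E.indicator fun _ => 1) x := by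
  have hmx : Measurable fun y : Heis n => x * y⁻¹ :=
    measurable_heis_mul_inv.comp (measurable_const.prodMk measurable_id)
  have h : heisConv (E.indicator fun _ => (1 : ℂ)) μ x
      = ∫ y, ((fun y => x * y⁻¹) ⁻¹' E).indicator (fun _ => (1 : ℂ)) y ∂μ := rfl
  rw [lconv_indicator_one μ hE, h, integral_indicator_const _ (hmx hE), enorm_smul, enorm_one,
    mul_one, measureReal_def, Real.enorm_of_nonneg ENNReal.toReal_nonneg,
    ENNReal.ofReal_toReal (measure_ne_top _ _)]

/-- Testing a bounded convolution operator on indicator functions. -/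
theorem ConvBounded.exists_indicator_bound {μ : Measure (Heis n)} [IsFiniteMeasure μ] {p q : ℝ≥0∞}
    (hq1 : 1 ≤ q) (h : ConvBounded μ p q) :
    ∃ C : ℝ, ∀ (E G : Set (Heis n)) (VE VG c : ℝ), MeasurableSet E → MeasurableSet G →
      0 < VE → 0 < VG → 0 ≤ c → volume E = ENNReal.ofReal VE → volume G = ENNReal.ofReal VG →
      (∀ x ∈ G, ENNReal.ofReal c ≤ lconv μ (E.indicator fun _ => 1) x) →
      c * VG ^ q⁻¹.toReal ≤ C * VE ^ p⁻¹.toReal := by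
  obtain ⟨C, hC⟩ := h
  refine ⟨C, fun E G VE VG c hE hG hVE hVG hc hEv hGv hlow => ?_⟩
  have hf : Measurable (E.indicator fun _ => (1 : ℂ)) := measurable_const.indicator hE
  have hEtop : volume E ≠ ⊤ := hEv ▸ ENNReal.ofReal_ne_top
  have hfp : MemLp (E.indicator fun _ => (1 : ℂ)) p volume :=
    memLp_indicator_const p hE 1 (Or.inr hEtop)
  have h1 := (hC _ hf hfp).2.2
  have h2 : eLpNorm (G.indicator fun _ => c) q volume
      ≤ eLpNorm (heisConv (E.indicator fun _ => (1 : ℂ)) μ) q volume := by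
    refine eLpNorm_mono_enorm fun x => ?_
    by_cases hx : x ∈ G
    · rw [Set.indicator_of_mem hx, enorm_heisConv_indicator_one μ hE, Real.enorm_of_nonneg hc]
      exact hlow x hx
    · rw [Set.indicator_of_notMem hx, enorm_zero]
      exact zero_le
  have hG0 : volume G ≠ 0 := by rw [hGv]; simpa using hVG
  rw [eLpNorm_indicator_const' hG hG0 (by positivity)] at h2
  have h3 := h2.trans (h1.trans (mul_le_mul_right (eLpNorm_indicator_const_le (1 : ℂ) p) _))
  rw [enorm_one, one_mul, hEv, hGv, Real.enorm_of_nonneg hc,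
    ENNReal.ofReal_rpow_of_pos hVE, ENNReal.ofReal_rpow_of_pos hVG, ← ENNReal.ofReal_mul hc,
    ← ENNReal.ofReal_coe_nnreal, ← ENNReal.ofReal_mul C.coe_nonneg,
    ENNReal.ofReal_le_ofReal_iff (by positivity)] at h3
  simpa only [ENNReal.toReal_inv, one_div] using h3

/-- The set of points of the Heisenberg group over a ball whose height is close to a graph. -/
def slab (r : ℝ) (g : R2n n → ℝ) (h : ℝ) : Set (Heis n) :=
  {z | ‖z.1‖ < r ∧ |z.2 - g z.1| < h}

theorem measurableSet_slab (r : ℝ) {g : R2n n → ℝ} (hg : Continuous g) (h : ℝ) :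
    MeasurableSet (slab r g h) := by
  have h1 : IsOpen {z : Heis n | ‖z.1‖ < r} := isOpen_lt (by fun_prop) continuous_const
  have h2 : IsOpen {z : Heis n | |z.2 - g z.1| < h} := isOpen_lt (by fun_prop) continuous_const
  exact (h1.inter h2).measurableSet

/-- The volume of the unit ball of `ℝ²ⁿ`. -/
def unitBallVol (n : ℕ) : ℝ := (volume (Metric.ball (0 : R2n n) 1)).toReal

theorem unitBallVol_pos (n : ℕ) : 0 < unitBallVol n :=
  ENNReal.toReal_pos (Metric.measure_ball_pos _ _ one_pos).ne' measure_ball_lt_top.ne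

theorem volume_ball_R2n (x : R2n n) {r : ℝ} (hr : 0 < r) :
    volume (Metric.ball x r) = ENNReal.ofReal (r ^ (2 * (n : ℝ)) * unitBallVol n) := by
  have hpow : r ^ (2 * (n : ℝ)) = r ^ Module.finrank ℝ (R2n n) := by
    rw [finrank_euclideanSpace, Fintype.card_sum, Fintype.card_fin, ← Real.rpow_natCast]
    congr 1
    push_cast
    ring
  rw [Measure.addHaar_ball_of_pos _ _ hr, hpow, ENNReal.ofReal_mul (by positivity), unitBallVol,
    ENNReal.ofReal_toReal measure_ball_lt_top.ne]

theorem volume_slab {r : ℝ} (hr : 0 < r) {g : R2n n → ℝ} (hg : Continuous g) {h : ℝ}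
    (hh : 0 < h) :
    volume (slab r g h) = ENNReal.ofReal (r ^ (2 * (n : ℝ)) * unitBallVol n * (2 * h)) := by
  rw [Measure.volume_eq_prod, Measure.prod_apply (measurableSet_slab r hg h)]
  have hsec : ∀ x : R2n n, volume (Prod.mk x ⁻¹' slab r g h)
      = (Metric.ball (0 : R2n n) r).indicator (fun _ => ENNReal.ofReal (2 * h)) x := by
    intro x
    by_cases hx : x ∈ Metric.ball (0 : R2n n) r
    · rw [Set.indicator_of_mem hx, ← Real.volume_ball (g x)]
      congr 1
      ext t
      simp [slab, Real.dist_eq, mem_ball_zero_iff.1 hx]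
    · rw [Set.indicator_of_notMem hx]
      have : Prod.mk x ⁻¹' slab r g h = ∅ := by
        ext t
        simp only [slab, Set.mem_preimage, Set.mem_ofPred_eq, Set.mem_empty_iff_false, iff_false]
        exact fun hxt => hx (mem_ball_zero_iff.2 hxt.1)
      rw [this, measure_empty]
  simp_rw [hsec]
  rw [lintegral_indicator_const measurableSet_ball, volume_ball_R2n _ hr,
    ← ENNReal.ofReal_mul (by positivity), mul_comm]

section Phase

variable {A : Matrix (Fin n ⊕ Fin n) (Fin n ⊕ Fin n) ℝ} {η : R2n n → ℝ}

/-- The phase vanishes on the diagonal, hence φ(w) = -⟨w, Lw⟩/2 with L = `mixedMap A`. One constant,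
the norm of L, then controls every term of the phase. -/
theorem abs_quadPhi_le (hA : A.IsSymm) (w : R2n n) :
    |quadPhi A w| ≤ ‖mixedMap A‖ * ‖w‖ * ‖w‖ := by
  have h0 : heisPhase A w w = 0 := by
    rw [heisPhase, sub_self, symplForm_self]
    simp [quadPhi]
  have h1 := heisPhase_eq hA w w
  have h2 : |⟪w, mixedMap A w⟫| ≤ ‖mixedMap A‖ * ‖w‖ * ‖w‖ := by
    refine (abs_real_inner_le_norm _ _).trans ?_
    rw [mul_comm]
    gcongr
    exact (mixedMap A).le_opNorm w
  have h3 : quadPhi A w = -⟪w, mixedMap A w⟫ / 2 := by linarith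
  rw [h3, abs_div, abs_neg, abs_two]
  linarith [abs_nonneg ⟪w, mixedMap A w⟫]

theorem abs_inner_mixedMap_le (x w : R2n n) :
    |⟪w, mixedMap A x⟫| ≤ ‖mixedMap A‖ * ‖x‖ * ‖w‖ := by
  refine (abs_real_inner_le_norm _ _).trans ?_
  rw [mul_comm]
  gcongr
  exact (mixedMap A).le_opNorm x

theorem abs_heisPhase_sub_quadPhi_left_le (hA : A.IsSymm) {x w : R2n n} {r : ℝ} (hx : ‖x‖ ≤ 1)
    (hw : ‖w‖ ≤ 1) (hwr : ‖w‖ ≤ r) :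
    |heisPhase A x w - quadPhi A x| ≤ 2 * ‖mixedMap A‖ * r := by
  have hK : 0 ≤ ‖mixedMap A‖ := norm_nonneg _
  rw [heisPhase_eq hA, show quadPhi A x + quadPhi A w + ⟪w, mixedMap A x⟫ - quadPhi A x
    = quadPhi A w + ⟪w, mixedMap A x⟫ by ring]
  calc _ ≤ ‖mixedMap A‖ * ‖w‖ * ‖w‖ + ‖mixedMap A‖ * ‖x‖ * ‖w‖ :=
        (abs_add_le _ _).trans (add_le_add (abs_quadPhi_le hA w) (abs_inner_mixedMap_le x w))
    _ ≤ ‖mixedMap A‖ * 1 * r + ‖mixedMap A‖ * 1 * r := by gcongr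
    _ = _ := by ring

theorem abs_heisPhase_sub_quadPhi_right_le (hA : A.IsSymm) {x w : R2n n} {r : ℝ} (hx : ‖x‖ ≤ 1)
    (hw : ‖w‖ ≤ 1) (hxr : ‖x‖ ≤ r) :
    |heisPhase A x w - quadPhi A w| ≤ 2 * ‖mixedMap A‖ * r := by
  have hK : 0 ≤ ‖mixedMap A‖ := norm_nonneg _
  have hr : 0 ≤ r := (norm_nonneg x).trans hxr
  rw [heisPhase_eq hA, show quadPhi A x + quadPhi A w + ⟪w, mixedMap A x⟫ - quadPhi A w
    = quadPhi A x + ⟪w, mixedMap A x⟫ by ring]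
  calc _ ≤ ‖mixedMap A‖ * ‖x‖ * ‖x‖ + ‖mixedMap A‖ * ‖x‖ * ‖w‖ :=
        (abs_add_le _ _).trans (add_le_add (abs_quadPhi_le hA x) (abs_inner_mixedMap_le x w))
    _ ≤ ‖mixedMap A‖ * r * 1 + ‖mixedMap A‖ * r * 1 := by gcongr
    _ = _ := by ring

theorem abs_heisPhase_le (hA : A.IsSymm) {x w : R2n n} {r : ℝ} (hx : ‖x‖ ≤ r) (hw : ‖w‖ ≤ r) :
    |heisPhase A x w| ≤ 3 * ‖mixedMap A‖ * r ^ 2 := by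
  have hK : 0 ≤ ‖mixedMap A‖ := norm_nonneg _
  have hr : 0 ≤ r := (norm_nonneg x).trans hx
  rw [heisPhase_eq hA]
  calc _ ≤ ‖mixedMap A‖ * ‖x‖ * ‖x‖ + ‖mixedMap A‖ * ‖w‖ * ‖w‖ + ‖mixedMap A‖ * ‖x‖ * ‖w‖ :=
        (abs_add_le _ _).trans (add_le_add ((abs_add_le _ _).trans
          (add_le_add (abs_quadPhi_le hA x) (abs_quadPhi_le hA w))) (abs_inner_mixedMap_le x w))
    _ ≤ ‖mixedMap A‖ * r * r + ‖mixedMap A‖ * r * r + ‖mixedMap A‖ * r * r := by gcongr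
    _ = _ := by ring

/-- Since η = 1 on the unit ball, the admissible w in the ball around x₀ contribute its full volume.
-/
theorem le_lconv_nuZero_indicator (hη : IsCutoff η) {E : Set (Heis n)} (hE : MeasurableSet E)
    {x : R2n n} {t : ℝ} {x₀ : R2n n} {r : ℝ} (hr : 0 < r)
    (h : ∀ w ∈ Metric.ball x₀ r, ‖x - w‖ ≤ 1 ∧ (w, t - heisPhase A x w) ∈ E) :
    ENNReal.ofReal (r ^ (2 * (n : ℝ)) * unitBallVol n)
      ≤ lconv (nuZero A η) (E.indicator fun _ => 1) (x, t) := by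
  rw [lconv_nuZero hη (measurable_const.indicator hE), ← volume_ball_R2n x₀ hr,
    ← lintegral_indicator_one measurableSet_ball]
  refine lintegral_mono fun w => ?_
  by_cases hw : w ∈ Metric.ball x₀ r
  · rw [Set.indicator_of_mem hw, Set.indicator_of_mem (h w hw).2, hη.eq_one _ (h w hw).1]
    simp
  · rw [Set.indicator_of_notMem hw]
    exact zero_le

variable {p q : ℝ≥0∞}

/-- Two slabs of bounded width and height comparable to 1/δ: the convolution is bounded below on the
smaller one, and both volumes are of order 1/δ. This forces p ≤ q. -/
theorem ConvBounded.inv_le_inv (hA : A.IsSymm) (hη : IsCutoff η) (hq : 1 ≤ q)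
    (h : ConvBounded (nuZero A η) p q) : q⁻¹.toReal ≤ p⁻¹.toReal := by
  have := isFiniteMeasure_nuZero (A := A) hη
  obtain ⟨C, hC⟩ := h.exists_indicator_bound hq
  set u := p⁻¹.toReal
  set v := q⁻¹.toReal
  set K := ‖mixedMap A‖
  have hK : 0 ≤ K := norm_nonneg _
  have hκ := unitBallVol_pos n
  set κ := unitBallVol n
  rw [← neg_le_neg_iff]
  -- For points of norm at most 3 the phase is at most 27K, so 54K < 1/δ lets the slab of
  -- half-height 1/δ contain the shifts of the one of half-height 1/(2δ).
  refine le_of_mul_rpow_le_mul_rpow (a := κ * κ ^ v)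
    (b := C * ((3 : ℝ) ^ (2 * (n : ℝ)) * κ * 2) ^ u) (δ₀ := (54 * K + 1)⁻¹)
    (by positivity) (by positivity) fun δ hδ hδ₀ => ?_
  have hL : 54 * K < δ⁻¹ := by
    have := (lt_inv_comm₀ hδ (by positivity)).1 hδ₀
    linarith
  have hL0 : 0 < δ⁻¹ := inv_pos.2 hδ
  have h1 := hC (slab 3 (fun _ => 0) δ⁻¹) (slab 1 (fun _ => 0) (δ⁻¹ / 2))
    ((3 : ℝ) ^ (2 * (n : ℝ)) * κ * (2 * δ⁻¹)) ((1 : ℝ) ^ (2 * (n : ℝ)) * κ * (2 * (δ⁻¹ / 2)))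
    ((1 : ℝ) ^ (2 * (n : ℝ)) * κ)
    (measurableSet_slab _ continuous_const _) (measurableSet_slab _ continuous_const _)
    (by positivity) (by positivity) (by positivity)
    (volume_slab (by norm_num) continuous_const hL0)
    (volume_slab (by norm_num) continuous_const (by positivity)) ?_
  · rw [Real.one_rpow, one_mul, mul_div_cancel₀ _ two_ne_zero, ← mul_assoc,
      Real.mul_rpow hκ.le hL0.le, Real.mul_rpow (by positivity) hL0.le,
      Real.inv_rpow hδ.le, Real.inv_rpow hδ.le, ← Real.rpow_neg hδ.le, ← Real.rpow_neg hδ.le,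
      ← mul_assoc, ← mul_assoc] at h1
    exact h1
  · rintro ⟨x, t⟩ ⟨hx, ht⟩
    refine le_lconv_nuZero_indicator hη (measurableSet_slab _ continuous_const _) (x₀ := x)
      one_pos fun w hw => ?_
    rw [mem_ball_iff_norm'] at hw
    have hx' : ‖x‖ < 1 := hx
    have hw2 : ‖w‖ < 3 := by
      have := norm_le_norm_add_norm_sub' w x
      rw [norm_sub_rev] at this
      linarith
    refine ⟨hw.le, hw2, ?_⟩
    have h2 := abs_heisPhase_le hA (x := x) (w := w) (r := 3) (by linarith) hw2.le
    simp only [sub_zero] at ht ⊢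
    refine (abs_sub _ _).trans_lt ?_
    linarith

/-- A box of size δ at the origin, of volume about δ^(2n + 1), is spread over a δ-neighbourhood of
the graph of φ, of volume about δ, with values at least of order δ^(2n). -/
theorem ConvBounded.inv_sub_le_inv (hA : A.IsSymm) (hη : IsCutoff η) (hq : 1 ≤ q)
    (h : ConvBounded (nuZero A η) p q) :
    (2 * (n : ℝ) + 1) * p⁻¹.toReal - 2 * n ≤ q⁻¹.toReal := by
  have := isFiniteMeasure_nuZero (A := A) hη
  obtain ⟨C, hC⟩ := h.exists_indicator_bound hq
  set u := p⁻¹.toReal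
  set v := q⁻¹.toReal
  set K := ‖mixedMap A‖
  have hK : 0 ≤ K := norm_nonneg _
  have hκ := unitBallVol_pos n
  set κ := unitBallVol n
  rw [sub_le_iff_le_add']
  refine le_of_mul_rpow_le_mul_rpow (a := κ * ((1 / 2 : ℝ) ^ (2 * (n : ℝ)) * κ * 2) ^ v)
    (b := C * (κ * (2 * (2 * K + 1))) ^ u) (δ₀ := 1 / 2)
    (by positivity) (by positivity) fun δ hδ hδ₀ => ?_
  -- The factor 2K + 1 absorbs the error 2Kδ in replacing the phase by φ(x), plus the half-height δ
  -- of the target slab.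
  have h1 := hC (slab δ (fun _ => 0) ((2 * K + 1) * δ)) (slab (1 / 2) (quadPhi A) δ)
    (δ ^ (2 * (n : ℝ)) * κ * (2 * ((2 * K + 1) * δ))) ((1 / 2 : ℝ) ^ (2 * (n : ℝ)) * κ * (2 * δ))
    (δ ^ (2 * (n : ℝ)) * κ)
    (measurableSet_slab _ continuous_const _) (measurableSet_slab _ (continuous_quadPhi A) _)
    (by positivity) (by positivity) (by positivity)
    (volume_slab hδ continuous_const (by positivity))
    (volume_slab (by norm_num) (continuous_quadPhi A) hδ) ?_
  · rw [show δ ^ (2 * (n : ℝ)) * κ * (2 * ((2 * K + 1) * δ))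
      = κ * (2 * (2 * K + 1)) * δ ^ (2 * (n : ℝ) + 1) by
        rw [Real.rpow_add_one hδ.ne']; ring, ← mul_assoc ((1 / 2 : ℝ) ^ (2 * (n : ℝ)) * κ),
      Real.mul_rpow (y := δ) (by positivity) hδ.le,
      Real.mul_rpow (y := δ ^ (2 * (n : ℝ) + 1)) (by positivity) (by positivity),
      ← Real.rpow_mul hδ.le] at h1
    rw [Real.rpow_add hδ]
    linarith
  · rintro ⟨x, t⟩ ⟨hx, ht⟩
    refine le_lconv_nuZero_indicator hη (measurableSet_slab _ continuous_const _) (x₀ := 0)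
      hδ fun w hw => ?_
    rw [mem_ball_zero_iff] at hw
    have hx' : ‖x‖ < 1 / 2 := hx
    refine ⟨(norm_sub_le _ _).trans (by linarith), hw, ?_⟩
    have h2 := abs_heisPhase_sub_quadPhi_left_le hA (x := x) (w := w) (r := δ) (by linarith)
      (by linarith) hw.le
    simp only at ht ⊢
    rw [show t - heisPhase A x w - 0 = (t - quadPhi A x) - (heisPhase A x w - quadPhi A x) by ring]
    refine (abs_sub _ _).trans_lt ?_
    linarith

/-- The dual example: a δ-neighbourhood of the graph of -φ has volume about δ, and its convolution
is bounded below on a box of size δ, of volume about δ^(2n + 1). -/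
theorem ConvBounded.inv_le_mul_inv (hA : A.IsSymm) (hη : IsCutoff η) (hq : 1 ≤ q)
    (h : ConvBounded (nuZero A η) p q) :
    p⁻¹.toReal ≤ (2 * (n : ℝ) + 1) * q⁻¹.toReal := by
  have := isFiniteMeasure_nuZero (A := A) hη
  obtain ⟨C, hC⟩ := h.exists_indicator_bound hq
  set u := p⁻¹.toReal
  set v := q⁻¹.toReal
  set K := ‖mixedMap A‖
  have hK : 0 ≤ K := norm_nonneg _
  have hκ := unitBallVol_pos n
  set κ := unitBallVol n
  refine le_of_mul_rpow_le_mul_rpow (a := (1 / 2 : ℝ) ^ (2 * (n : ℝ)) * κ * (κ * 2) ^ v)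
    (b := C * ((1 / 2 : ℝ) ^ (2 * (n : ℝ)) * κ * (2 * (2 * K + 1))) ^ u) (δ₀ := 1 / 2)
    (by positivity) (by positivity) fun δ hδ hδ₀ => ?_
  have h1 := hC (slab (1 / 2) (fun w => -quadPhi A w) ((2 * K + 1) * δ)) (slab δ (fun _ => 0) δ)
    ((1 / 2 : ℝ) ^ (2 * (n : ℝ)) * κ * (2 * ((2 * K + 1) * δ))) (δ ^ (2 * (n : ℝ)) * κ * (2 * δ))
    ((1 / 2 : ℝ) ^ (2 * (n : ℝ)) * κ)
    (measurableSet_slab _ (continuous_quadPhi A).neg _) (measurableSet_slab _ continuous_const _)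
    (by positivity) (by positivity) (by positivity)
    (volume_slab (by norm_num) (continuous_quadPhi A).neg (by positivity))
    (volume_slab hδ continuous_const hδ) ?_
  · rw [show δ ^ (2 * (n : ℝ)) * κ * (2 * δ) = κ * 2 * δ ^ (2 * (n : ℝ) + 1) by
        rw [Real.rpow_add_one hδ.ne']; ring, ← mul_assoc 2, ← mul_assoc _ _ δ,
      Real.mul_rpow (by positivity) hδ.le, Real.mul_rpow (by positivity) (by positivity),
      ← Real.rpow_mul hδ.le, ← mul_assoc, ← mul_assoc] at h1
    exact h1
  · rintro ⟨x, t⟩ ⟨hx, ht⟩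
    refine le_lconv_nuZero_indicator hη (measurableSet_slab _ (continuous_quadPhi A).neg _)
      (x₀ := 0) (by norm_num) fun w hw => ?_
    rw [mem_ball_zero_iff] at hw
    have hx' : ‖x‖ < δ := hx
    refine ⟨(norm_sub_le _ _).trans (by linarith), hw, ?_⟩
    have h2 := abs_heisPhase_sub_quadPhi_right_le hA (x := x) (w := w) (r := δ) (by linarith)
      (by linarith) hx'.le
    simp only [sub_zero, Pi.neg_apply] at ht ⊢
    rw [show t - heisPhase A x w - -quadPhi A w = t - (heisPhase A x w - quadPhi A w) by ring]
    refine (abs_sub _ _).trans_lt ?_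
    linarith

end Phase

end Necessity

/-! ### The triangle and the type set. -/

section TypeSet

variable {n : ℕ}

theorem mem_convexHull_exponents_iff (hn : 1 ≤ n) (z : ℝ × ℝ) :
    z ∈ convexHull ℝ {((0 : ℝ), (0 : ℝ)), (1, 1),
        ((2 * (n : ℝ) + 1) / (2 * (n : ℝ) + 2), 1 / (2 * (n : ℝ) + 2))} ↔
      z.2 ≤ z.1 ∧ z.1 ≤ (2 * (n : ℝ) + 1) * z.2 ∧ (2 * (n : ℝ) + 1) * z.1 - 2 * n ≤ z.2 := by
  have hn' : (0 : ℝ) < n := by exact_mod_cast hn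
  constructor
  · intro hz
    have hc : Convex ℝ {z : ℝ × ℝ | z.2 ≤ z.1 ∧ z.1 ≤ (2 * (n : ℝ) + 1) * z.2 ∧
        (2 * (n : ℝ) + 1) * z.1 - 2 * n ≤ z.2} := by
      rintro ⟨x1, x2⟩ ⟨h1, h2, h3⟩ ⟨y1, y2⟩ ⟨h4, h5, h6⟩ a b ha hb hab
      simp only [Set.mem_ofPred_eq, Prod.smul_mk, Prod.mk_add_mk, smul_eq_mul] at *
      obtain rfl : b = 1 - a := by linarith
      refine ⟨?_, ?_, ?_⟩
      · linarith [mul_le_mul_of_nonneg_left h1 ha, mul_le_mul_of_nonneg_left h4 hb]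
      · linarith [mul_le_mul_of_nonneg_left h2 ha, mul_le_mul_of_nonneg_left h5 hb]
      · linarith [mul_le_mul_of_nonneg_left h3 ha, mul_le_mul_of_nonneg_left h6 hb]
    refine convexHull_min ?_ hc hz
    rintro w (rfl | rfl | rfl) <;> simp only [Set.mem_ofPred_eq]
    · refine ⟨le_rfl, by simp, ?_⟩
      linarith
    · refine ⟨le_rfl, ?_, ?_⟩ <;> linarith
    · refine ⟨?_, ?_, ?_⟩
      · gcongr
        linarith
      · exact le_of_eq (by ring)
      · rw [← sub_nonneg]
        refine le_of_eq ?_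
        field_simp
        ring
  · rintro ⟨h1, h2, h3⟩
    have h := (convex_convexHull ℝ {((0 : ℝ), (0 : ℝ)), (1, 1),
        ((2 * (n : ℝ) + 1) / (2 * (n : ℝ) + 2), 1 / (2 * (n : ℝ) + 2))}).sum_mem
      (t := (Finset.univ : Finset (Fin 3)))
      -- These are the barycentric coordinates of z; each is a positive multiple of the slack in one
      -- of the three inequalities.
      (w := ![(2 * n - (2 * n + 1) * z.1 + z.2) / (2 * n), ((2 * n + 1) * z.2 - z.1) / (2 * n),
        (z.1 - z.2) * (n + 1) / n])
      (z := ![(0, 0), (1, 1),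
        ((2 * (n : ℝ) + 1) / (2 * (n : ℝ) + 2), 1 / (2 * (n : ℝ) + 2))]) ?_ ?_ ?_
    · convert h
      simp only [Fin.sum_univ_three, Matrix.cons_val_zero, Matrix.cons_val_one, Matrix.cons_val,
        Prod.smul_mk, Prod.mk_add_mk, smul_eq_mul]
      refine Prod.ext ?_ ?_
      · simp only
        field_simp
        ring
      · simp only
        field_simp
        ring
    · intro i _
      fin_cases i
      · exact div_nonneg (by linarith) (by linarith)
      · exact div_nonneg (by linarith) (by linarith)
      · exact div_nonneg (mul_nonneg (by linarith) (by linarith)) (by linarith)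
    · simp only [Fin.sum_univ_three, Matrix.cons_val_zero, Matrix.cons_val_one, Matrix.cons_val]
      field_simp
      ring
    · intro i _
      fin_cases i <;> exact subset_convexHull ℝ _ (by simp)

theorem mem_typeSet_nuZero (hn : 1 ≤ n) {A : Matrix (Fin n ⊕ Fin n) (Fin n ⊕ Fin n) ℝ}
    (hA : A.IsSymm) (hdet : ((2 : ℝ) • A + symplJ n).det ≠ 0) {η : R2n n → ℝ} (hη : IsCutoff η)
    {u v : ℝ} (h1 : v ≤ u) (h2 : u ≤ (2 * (n : ℝ) + 1) * v)
    (h3 : (2 * (n : ℝ) + 1) * u - 2 * n ≤ v) : (u, v) ∈ typeSet (nuZero A η) := by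
  have := isFiniteMeasure_nuZero (A := A) hη
  have hn' : (0 : ℝ) < n := by exact_mod_cast hn
  have hv0 : 0 ≤ v := by
    have : 0 ≤ 2 * (n : ℝ) * v := by linarith
    exact nonneg_of_mul_nonneg_right this (by positivity)
  have hu1 : u ≤ 1 := by
    have : 2 * (n : ℝ) * u ≤ 2 * n * 1 := by linarith
    exact le_of_mul_le_mul_left this (by positivity)
  -- If v = 0 then u = 0 as well. This vertex, with p = q = ∞, is the only point not covered by the
  -- interpolation with finite exponents.
  rcases hv0.eq_or_lt with hv | hv
  · have hu : u = 0 := by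
      rw [← hv] at h1 h2
      linarith
    exact ⟨⊤, ⊤, le_top, le_top, by simp [hu, ← hv], convBounded_top _⟩
  · have hu : 0 < u := hv.trans_le h1
    obtain ⟨C₀, hC₀⟩ := exists_lintegral_lconv_rpow_le hA hdet hη
      (p := (2 * n + 2) / (2 * n + 1)) (q := 2 * n + 2)
      (by
        rw [Real.holderConjugate_iff]
        refine ⟨?_, ?_⟩
        · rw [lt_div_iff₀ (by positivity)]
          linarith
        · field_simp
          ring) rfl hn
    -- The interpolation weights are the barycentric coordinates of (u, v) in the triangle; α < 1
    -- holds because v ≤ u and u > 0.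
    obtain ⟨C, hC⟩ := lintegral_lconv_rpow_le_of_weights (nuZero A η) (by positivity)
      (by positivity) hC₀ (α := (2 * n - (2 * n + 1) * u + v) / (2 * n))
      (β := ((2 * n + 1) * v - u) / (2 * n)) (γ := (u - v) * (n + 1) / n)
      (div_nonneg (by linarith) (by linarith)) (div_nonneg (by linarith) (by linarith))
      (div_nonneg (mul_nonneg (by linarith) (by linarith)) (by linarith))
      (by field_simp; ring)
      (by
        rw [div_lt_one (by positivity)]
        have : 0 < 2 * (n : ℝ) * u := by positivity
        linarith)
      (u := u) (v := v) (by field_simp; ring) (by field_simp; ring)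
    refine ⟨ENNReal.ofReal u⁻¹, ENNReal.ofReal v⁻¹, ?_, ?_, ?_,
      convBounded_of_lintegral_le (inv_pos.2 hu) (inv_pos.2 hv) hC⟩
    · rw [ENNReal.one_le_ofReal]
      exact (one_le_inv₀ hu).2 hu1
    · rw [ENNReal.one_le_ofReal]
      exact (one_le_inv₀ hv).2 (h1.trans hu1)
    · rw [ENNReal.toReal_inv, ENNReal.toReal_inv, ENNReal.toReal_ofReal (inv_pos.2 hu).le,
        ENNReal.toReal_ofReal (inv_pos.2 hv).le, inv_inv, inv_inv]

end TypeSet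

end

theorem theorem4 (n : ℕ) (hn : 1 ≤ n)
    (A : Matrix (Fin n ⊕ Fin n) (Fin n ⊕ Fin n) ℝ) (hA : A.IsSymm)
    (hdet_add : ((2 : ℝ) • A + symplJ n).det ≠ 0)
    (hdet_sub : ((2 : ℝ) • A - symplJ n).det ≠ 0)
    (η : R2n n → ℝ) (hη : IsCutoff η) :
    typeSet (nuZero A η) =
      convexHull ℝ {((0 : ℝ), (0 : ℝ)), (1, 1),
        ((2 * (n : ℝ) + 1) / (2 * (n : ℝ) + 2), 1 / (2 * (n : ℝ) + 2))} := by
  refine Set.Subset.antisymm ?_ ?_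
  · rintro z ⟨p, q, hp, hq, rfl, h⟩
    exact (mem_convexHull_exponents_iff hn _).2
      ⟨h.inv_le_inv hA hη hq, h.inv_le_mul_inv hA hη hq, h.inv_sub_le_inv hA hη hq⟩
  · intro z hz
    obtain ⟨h1, h2, h3⟩ := (mem_convexHull_exponents_iff hn z).1 hz
    exact mem_typeSet_nuZero hn hA hdet_add hη h1 h2 h3
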